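/- Let $q=e^{2\pi i\tau}$ for $\tau$ in the upper half-plane, $\theta(\tau)=\sum_{s\in\mathbb Z}q^{s^2}$, $E_2=1-24\sum_{n\ge1}\sigma_1(n)q^n$ and $E_4=1+240\sum_{n\ge1}\sigma_3(n)q^n$, where $\sigma_k(n)=\sum_{d\mid n}d^k$. For a function $F$ on the upper half-plane put $F[4](\tau)=F(4\tau)$ and $D(F)=\frac{1}{2\pi i}\frac{dF}{d\tau}$. For an integer $k\ge0$ and $w=k+\frac12$, let $M_w(\Gamma_0(4))$ be the complex vector space of holomorphic functions on the upper half-plane that transform like $\theta^{2w}$ under $\Gamma_0(4)$ and are holomorphic at all the cusps, and let $M_w^+$ be the subspace of the forms with a Fourier expansion $\sum_{n\ge0}a(n)q^n$ such that $a(n)=0$ whenever $(-1)^kn\not\equiv0,1\pmod 4$. **Proposition.** The form $\theta E_2[4]-6D(\theta)$ is a basis of $M_{5/2}^+$, and the form $\theta E_4[4]$ is a basis of $M_{9/2}^+$. Moreover, for every fundamental discriminant $D>1$ (that is, $D>1$ is the discriminant of a real quadratic field), with $\chi_D$ the quadratic character $n\mapsto\left(\frac Dn\right)$ given by the Kronecker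 symbol, $$L(\chi_D,-1)=-\frac15S_1(D,4),\qquad L(\chi_D,-3)=S_3(D,4),$$ where $S_k(m,N)=\sum_{s\in\mathbb Z}\sigma_k\!\left(\frac{m-s^2}{N}\right)$, with $\sigma_k(x)=0$ if $x$ is not a positive integer. -/

import Mathlib

open scoped UpperHalfPlane Manifold MatrixGroups NumberTheorySymbols

noncomputable section

namespace HalfIntegralWeight

/-! ### Theta function and the operations on functions on the upper half-plane -/

/-- The parameter `q = exp (2 π i τ)`. -/
def q (τ : ℍ) : ℂ := Complex.exp (2 * Real.pi * Complex.I * τ)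

/-- `θ(τ) = ∑_{s ∈ ℤ} q ^ (s ^ 2)`. -/
def theta (τ : ℍ) : ℂ := ∑' s : ℤ, q τ ^ (s ^ 2)

/-- The defining series of `θ` converges, and `θ(τ)` is Jacobi's theta function at `2 τ`. -/
theorem hasSum_theta (τ : ℍ) :
    HasSum (fun s : ℤ => q τ ^ (s ^ 2)) (jacobiTheta (2 * τ)) := by
  have him : 0 < (2 * (τ : ℂ)).im := by simpa using τ.im_pos
  have h := (hasSum_jacobiTheta₂_term 0 him)
  rw [← jacobiTheta_eq_jacobiTheta₂] at h
  convert h using 2 with s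
  rw [jacobiTheta₂_term, q, ← Complex.exp_int_mul]
  congr 1
  push_cast
  ring

theorem theta_eq_jacobiTheta (τ : ℍ) : theta τ = jacobiTheta (2 * τ) :=
  (hasSum_theta τ).tsum_eq

/-- The point `d τ` of the upper half-plane, for `d ≥ 1`. -/
def dilate (d : ℕ+) (τ : ℍ) : ℍ :=
  ⟨(d : ℂ) * τ, by simpa using τ.im_pos⟩

/-- `F[d]`, the function `τ ↦ F(d τ)`. -/
def levelRaise (F : ℍ → ℂ) (d : ℕ+) : ℍ → ℂ := fun τ => F (dilate d τ)

/-! ### Modular forms of half-integral weight on `Γ₀(4)` and the Kohnen plus space -/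

/-- The space `M_w(Γ₀(4))` of modular forms of weight `w = κ / 2`: holomorphic functions on the
upper half-plane which transform like `θ ^ κ = θ ^ (2 w)` under `Γ₀(4)` and which are holomorphic
at all the cusps. As usual for the last condition, all `(c τ + d) ^ (-w) f((a τ + b) / (c τ + d))`
with `(a, b; c, d)` in `SL₂(ℤ)` are bounded as `Im τ → ∞`. -/
def modularForms (κ : ℕ) : Submodule ℂ (ℍ → ℂ) where
  carrier := {f | MDiff f ∧
    (∀ γ ∈ CongruenceSubgroup.Gamma0 4, ∀ τ : ℍ,
      f (γ • τ) * theta τ ^ κ = theta (γ • τ) ^ κ * f τ) ∧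
    ∀ α : SL(2, ℤ), UpperHalfPlane.IsBoundedAtImInfty fun τ : ℍ =>
      (UpperHalfPlane.denom α τ) ^ (-((κ : ℂ) / 2)) * f (α • τ)}
  zero_mem' := by
    refine ⟨mdifferentiable_const, by simp, fun α => ?_⟩
    simp only [Pi.zero_apply, mul_zero]
    exact UpperHalfPlane.zero_form_isBoundedAtImInfty
  add_mem' := by
    rintro f g ⟨hf, hf', hf''⟩ ⟨hg, hg', hg''⟩
    refine ⟨hf.add hg, fun γ hγ τ => ?_, fun α => ?_⟩
    · simp only [Pi.add_apply, add_mul, mul_add, hf' γ hγ τ, hg' γ hγ τ]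
    · simp only [Pi.add_apply, mul_add]
      exact (hf'' α).add (hg'' α)
  smul_mem' := by
    rintro c f ⟨hf, hf', hf''⟩
    refine ⟨hf.const_smul c, fun γ hγ τ => ?_, fun α => ?_⟩
    · simp only [Pi.smul_apply, smul_eq_mul, mul_assoc, hf' γ hγ τ, mul_left_comm]
    · simp only [Pi.smul_apply, smul_eq_mul, mul_left_comm _ c]
      exact (hf'' α).const_mul_left c

/-- The Kohnen plus space `M_{k + 1/2}^+`: the forms in `M_{k + 1/2}(Γ₀(4))` with a Fourier
expansion `∑_{n ≥ 0} a(n) q ^ n` in which `a(n) = 0` if `(-1) ^ k n` is not `0` or `1`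
modulo `4`. -/
def plusSpace (k : ℕ) : Submodule ℂ (ℍ → ℂ) where
  carrier := {f | f ∈ modularForms (2 * k + 1) ∧
    ∃ a : ℕ → ℂ, (∀ τ : ℍ, HasSum (fun n => a n * q τ ^ n) (f τ)) ∧
      ∀ n : ℕ, ¬ ((-1) ^ k * (n : ℤ) ≡ 0 [ZMOD 4] ∨ (-1) ^ k * (n : ℤ) ≡ 1 [ZMOD 4]) →
        a n = 0}
  zero_mem' := ⟨zero_mem _, 0, by simp [hasSum_zero], by simp⟩
  add_mem' := by
    rintro f g ⟨hf, a, ha, ha'⟩ ⟨hg, b, hb, hb'⟩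
    refine ⟨add_mem hf hg, a + b, fun τ => ?_, fun n hn => ?_⟩
    · simpa only [Pi.add_apply, add_mul] using (ha τ).add (hb τ)
    · simp [ha' n hn, hb' n hn]
  smul_mem' := by
    rintro c f ⟨hf, a, ha, ha'⟩
    refine ⟨Submodule.smul_mem _ c hf, c • a, fun τ => ?_, fun n hn => ?_⟩
    · simpa only [Pi.smul_apply, smul_eq_mul, mul_assoc] using (ha τ).mul_left c
    · simp [ha' n hn]

/-! ### The sums `S_k(m, N)` -/

/-- `S_k(m, N) = ∑_{s ∈ ℤ} σ_k((m - s ^ 2) / N)`, where `σ_k(x) = 0` unless `x` is a positive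
integer (note that `σ_k(0) = 0` in Mathlib, and that `Int.toNat` of a negative integer is `0`).
For `N ≥ 1` only finitely many terms are nonzero. -/
def sigmaSum (k : ℕ) (m : ℤ) (N : ℕ) : ℕ :=
  ∑ᶠ s : ℤ, if (N : ℤ) ∣ m - s ^ 2 then
    ArithmeticFunction.sigma k ((m - s ^ 2) / (N : ℤ)).toNat else 0

/-- The sum defining `S_k(m, N)` is finite: it can be restricted to `|s| ≤ |m|`. -/
theorem sigmaSum_eq_sum (k : ℕ) (m : ℤ) (N : ℕ) :
    sigmaSum k m N = ∑ s ∈ Finset.Icc (-|m|) |m|, if (N : ℤ) ∣ m - s ^ 2 then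
      ArithmeticFunction.sigma k ((m - s ^ 2) / (N : ℤ)).toNat else 0 := by
  refine finsum_eq_sum_of_support_subset _ fun s hs => ?_
  by_contra hmem
  refine hs ?_
  have hlt : m - s ^ 2 < 0 := by
    have h1 : |m| < |s| := by
      by_contra hle
      exact hmem (by simpa [abs_le] using (not_lt.mp hle))
    have h2 : |s| ≤ s ^ 2 := by
      rw [← sq_abs s]; nlinarith [abs_nonneg m, Int.add_one_le_iff.mpr h1]
    linarith [le_abs_self m]
  have h0 : ((m - s ^ 2) / (N : ℤ)).toNat = 0 := by
    rcases N.eq_zero_or_pos with rfl | hN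
    · simp
    · exact Int.toNat_of_nonpos
        (Int.ediv_nonpos_of_nonpos_of_neg hlt.le (by exact_mod_cast hN))
  simp only [h0]
  simp

/-! ### Fundamental discriminants, the Kronecker symbol and the quadratic character `χ_D` -/

/-- `D` is a discriminant of a quadratic field, or `D = 1`. -/
def IsFundamentalDiscriminant (D : ℤ) : Prop :=
  (D ≡ 1 [ZMOD 4] ∧ Squarefree D) ∨
    ∃ m : ℤ, D = 4 * m ∧ (m ≡ 2 [ZMOD 4] ∨ m ≡ 3 [ZMOD 4]) ∧ Squarefree m

/-- The Kronecker symbol `(D / n)` for `n ≥ 0`. Here `ZMod.χ₈ D` is `(D / 2)`: it is `0` if `D` is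
even, `1` if `D` is `±1` modulo `8`, and `-1` if `D` is `±3` modulo `8`. The odd part of `n` is
dealt with by the Jacobi symbol, and `(D / 0)` is `1` if `D = ±1` and `0` otherwise. -/
def kronecker (D : ℤ) (n : ℕ) : ℤ :=
  if n = 0 then (if D.natAbs = 1 then 1 else 0)
  else ZMod.χ₈ (D : ZMod 8) ^ n.factorization 2 * J(D | n / 2 ^ n.factorization 2)

theorem odd_ordCompl {n : ℕ} (hn : n ≠ 0) : Odd (n / 2 ^ n.factorization 2) := by
  rw [← Nat.not_even_iff_odd, even_iff_two_dvd]
  exact Nat.not_dvd_ordCompl Nat.prime_two hn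

theorem kronecker_of_one_mod_four {D : ℤ} (hD : D % 4 = 1) (n : ℕ) :
    kronecker D n = J(n | D.natAbs) := by
  have hodd : Odd D.natAbs := by rw [Nat.odd_iff]; omega
  rcases eq_or_ne n 0 with rfl | hn
  · rw [kronecker, if_pos rfl]
    split_ifs with h
    · simp [h]
    · rw [Nat.cast_zero, jacobiSym.zero_left (by omega)]
  · rw [kronecker, if_neg hn]
    have hm := odd_ordCompl hn
    have hfac := Nat.ordProj_mul_ordCompl_eq_self n 2
    set m := n / 2 ^ n.factorization 2
    have h8 : ZMod.χ₈ (D : ZMod 8) = ZMod.χ₈ (D.natAbs : ZMod 8) := by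
      rcases Int.natAbs_eq D with h | h
      · conv_lhs => rw [h]
        simp
      · conv_lhs => rw [h]
        rw [Int.cast_neg, Int.cast_natCast]
        generalize (D.natAbs : ZMod 8) = x
        revert x
        decide
    have hrec : J(D | m) = J(m | D.natAbs) := by
      rcases Int.natAbs_eq D with h | h
      · conv_lhs => rw [h]
        exact jacobiSym.quadratic_reciprocity_one_mod_four (by omega) hm
      · conv_lhs => rw [h]
        rw [jacobiSym.neg _ hm]
        rcases Nat.odd_mod_four_iff.mp (Nat.odd_iff.mp hm) with h4 | h4
        · rw [ZMod.χ₄_nat_one_mod_four h4, one_mul]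
          exact jacobiSym.quadratic_reciprocity_one_mod_four' hodd h4
        · rw [ZMod.χ₄_nat_three_mod_four h4,
            jacobiSym.quadratic_reciprocity_three_mod_four (by omega) h4]
          ring
    rw [h8, hrec, ← jacobiSym.at_two hodd, ← jacobiSym.pow_left, ← jacobiSym.mul_left]
    congr 1
    exact_mod_cast hfac

theorem kronecker_of_four_mul {D m : ℤ} (hD : D = 4 * m) (n : ℕ) :
    kronecker D n = if Odd n then J(m | n) else 0 := by
  have h8 : ZMod.χ₈ (D : ZMod 8) = 0 := by
    rw [hD]; push_cast
    generalize (m : ZMod 8) = x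
    revert x
    decide
  split_ifs with h
  · have hn : n ≠ 0 := by rintro rfl; simp at h
    have h0 : n.factorization 2 = 0 :=
      Nat.factorization_eq_zero_of_not_dvd (by rw [← even_iff_two_dvd]; simpa using h)
    rw [kronecker, if_neg hn, h0, hD, pow_zero, pow_zero, Nat.div_one, one_mul,
      jacobiSym.mul_left, jacobiSym.at_four h, one_mul]
  · rcases eq_or_ne n 0 with rfl | hn
    · rw [kronecker, if_pos rfl, if_neg (by omega)]
    · have h0 : n.factorization 2 ≠ 0 :=
        (Nat.prime_two.factorization_pos_of_dvd hn
          (even_iff_two_dvd.mp (by simpa using h))).ne'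
      rw [kronecker, if_neg hn, h8, zero_pow h0, zero_mul]

theorem kronecker_mod {D : ℤ} (hD : D % 4 = 0 ∨ D % 4 = 1) (n : ℕ) :
    kronecker D (n % D.natAbs) = kronecker D n := by
  rcases hD with hD | hD
  · obtain ⟨m, rfl⟩ := Int.dvd_of_emod_eq_zero hD
    have hN : (4 * m).natAbs = 4 * m.natAbs := by omega
    have hpar : (n % (4 * m).natAbs) % 2 = n % 2 := by
      rw [hN]; exact Nat.mod_mod_of_dvd _ (Dvd.dvd.mul_right (by norm_num) _)
    rw [kronecker_of_four_mul rfl, kronecker_of_four_mul rfl]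
    by_cases h : Odd n
    · have h' : Odd (n % (4 * m).natAbs) := by
        rw [Nat.odd_iff] at h ⊢; omega
      rw [if_pos h, if_pos h', hN, ← jacobiSym.mod_right m h]
    · have h' : ¬ Odd (n % (4 * m).natAbs) := by
        rw [Nat.odd_iff] at h ⊢; omega
      rw [if_neg h, if_neg h']
  · rw [kronecker_of_one_mod_four hD, kronecker_of_one_mod_four hD, Int.natCast_mod,
      ← jacobiSym.mod_left]

theorem kronecker_one (D : ℤ) : kronecker D 1 = 1 := by simp [kronecker]

theorem kronecker_mul {D : ℤ} (hD : D % 4 = 0 ∨ D % 4 = 1) (a b : ℕ) :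
    kronecker D (a * b) = kronecker D a * kronecker D b := by
  rcases hD with hD | hD
  · obtain ⟨m, rfl⟩ := Int.dvd_of_emod_eq_zero hD
    simp only [kronecker_of_four_mul rfl]
    by_cases ha : Odd a <;> by_cases hb : Odd b <;> simp [ha, hb, Nat.odd_mul]
    exact jacobiSym.mul_right' m (by rintro rfl; simp at ha) (by rintro rfl; simp at hb)
  · simp only [kronecker_of_one_mod_four hD]
    push_cast
    exact jacobiSym.mul_left _ _ _

theorem kronecker_eq_zero {D : ℤ} (hD : D % 4 = 0 ∨ D % 4 = 1) {n : ℕ}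
    (h : ¬ n.Coprime D.natAbs) : kronecker D n = 0 := by
  rcases hD with hD | hD
  · obtain ⟨m, rfl⟩ := Int.dvd_of_emod_eq_zero hD
    rw [kronecker_of_four_mul rfl]
    split_ifs with hn
    · refine jacobiSym.eq_zero_iff.mpr ⟨by rintro rfl; simp at hn, fun hg => h ?_⟩
      have hN : (4 * m).natAbs = 2 ^ 2 * m.natAbs := by omega
      rw [hN]
      refine Nat.Coprime.mul_right (Nat.Coprime.pow_right 2 hn.coprime_two_right) ?_
      have : Nat.gcd m.natAbs n = 1 := by simpa [Int.gcd] using hg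
      exact (Nat.Coprime.symm this)
    · rfl
  · rw [kronecker_of_one_mod_four hD]
    refine jacobiSym.eq_zero_iff.mpr ⟨by omega, fun hg => h ?_⟩
    rwa [Int.gcd, Int.natAbs_natCast, Int.natAbs_natCast] at hg

theorem IsFundamentalDiscriminant.mod_four {D : ℤ} (hD : IsFundamentalDiscriminant D) :
    D % 4 = 0 ∨ D % 4 = 1 := by
  rcases hD with ⟨h, -⟩ | ⟨m, rfl, -⟩
  · exact Or.inr h
  · left; omega

theorem IsFundamentalDiscriminant.natAbs_ne_zero {D : ℤ} (hD : IsFundamentalDiscriminant D) :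
    D.natAbs ≠ 0 := by
  rcases hD with ⟨h, -⟩ | ⟨m, rfl, h, -⟩ <;> unfold Int.ModEq at h <;> omega

/-- The quadratic character `χ_D`, `n ↦ (D / n)`, as a Dirichlet character modulo `|D|`. -/
def quadraticChar (D : ℤ) (hD : IsFundamentalDiscriminant D) : DirichletCharacter ℂ D.natAbs where
  toFun x := (kronecker D x.val : ℂ)
  map_one' := by
    have : NeZero D.natAbs := ⟨hD.natAbs_ne_zero⟩
    rw [ZMod.val_one_eq_one_mod, kronecker_mod hD.mod_four, kronecker_one, Int.cast_one]
  map_mul' x y := by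
    have : NeZero D.natAbs := ⟨hD.natAbs_ne_zero⟩
    rw [ZMod.val_mul, kronecker_mod hD.mod_four, kronecker_mul hD.mod_four, Int.cast_mul]
  map_nonunit' x hx := by
    have : NeZero D.natAbs := ⟨hD.natAbs_ne_zero⟩
    have h : ¬ x.val.Coprime D.natAbs := by
      rwa [← ZMod.isUnit_iff_coprime, ZMod.natCast_zmod_val]
    simp [kronecker_eq_zero hD.mod_four h]

theorem quadraticChar_natCast (D : ℤ) (hD : IsFundamentalDiscriminant D) (n : ℕ) :
    quadraticChar D hD (n : ZMod D.natAbs) = (kronecker D n : ℂ) := by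
  change ((kronecker D (n : ZMod D.natAbs).val : ℤ) : ℂ) = _
  rw [ZMod.val_natCast, kronecker_mod hD.mod_four]

/-- `L(χ_D, s)`, by analytic continuation. -/
def quadraticL (D : ℤ) (hD : IsFundamentalDiscriminant D) (s : ℂ) : ℂ :=
  haveI : NeZero D.natAbs := ⟨hD.natAbs_ne_zero⟩
  (quadraticChar D hD).LFunction s

end HalfIntegralWeight

end

/-! The statements about the plus spaces and those about L-values are proved independently of each
other.

L-values. For a nonsquare `D > 0` and odd `n`, let `F(x)` be the sum of `max(Q(x), 0) ^ n` over the
integral quadratic functions `Q` of discriminant `D` with negative leading coefficient (Zagier's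
sums). `F` has period 1, and `F(x) - x ^ (2n) F(1/x)` is the polynomial `∑ Q(x) ^ n` over the
finitely many `Q = (a, b, c)` with `a < 0 < c`. For `n = 1, 3` this polynomial is `S (1 - x ^ (2n))`
with `S = ∑ c ^ n = S_n(D, 4)`, and the Euclidean algorithm together with a contraction argument
makes `F` constant, equal to `S` (`quadSum_eq`, `quadSum_one`, `quadSum_three`). Integrating over a
period and unfolding gives `S` as an explicit constant times `D ^ (n + 1/2) ∑ N(A) / A ^ (n + 1)`,
where `N(A)` counts the roots modulo `A` of a quadratic polynomial of discriminant `D`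
(`hasSum_rootCount`). For fundamental `D` the Euler product of this series is `ζ(s) L(χ_D, s) /
ζ(2s)` at `s = n + 1` (`tsum_rootCount_mul_zeta`). The functional equation, which needs the Gauss
sum of `χ_D` to be `√D` with its sign, carries `L(χ_D, n + 1)` to `L(χ_D, -n)`. The sign comes from
Landsberg–Schaar reciprocity and Dirichlet's theorem on primes.

Plus spaces. For `f` in the plus space of weight `2m + 1/2` put `g(z) = f(z/4)` and `Θ(z) = θ(z/4)`.
Exponents are `0` or `1` modulo 4, so translation by 1 has only the eigenvalues `1` and `i` on `g`,
and `g(z+2) = (1+i) g(z+1) - i g(z)`. The determinant `W = g(z) Θ(z+2) - g(z+2) Θ(z)` is therefore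
multiplied by `i` under `z ↦ z + 1`; modularity under `Γ₀(4)` gives its behaviour under `z ↦ -1/z`;
and `W / η ^ 6` is a level one form of weight `2m - 2`. If `W = 0`, then `g / Θ` is a level one form
of weight `2m`. For `m = 1`, `W` is a multiple of `η ^ 6` and determines `f`, because there is no
level one form of weight 2. For `m = 2`, `W = 0` for the same reason and `f = θ M[4]` with `M` a
multiple of `E₄`. Both spaces thus have dimension at most one. Division by `Θ` uses that `θ` has no
zeros (`jacobiTheta_ne_zero`).

The two given forms have constant term 1. They lie in the plus space because `θ ^ 4` has weight 2,
the anomaly of `E₂[4]` cancels that of `D(θ)`, and growth bounds for `θ`, `E₂`, `E₄` at all cusps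
survive products, `τ ↦ 4τ` and differentiation. -/

namespace HalfIntegralWeight

open scoped ENNReal

/-! ### Sums over quadratic functions of fixed discriminant -/

/-- The value of the quadratic function `a x ^ 2 + b x + c` at `x`. -/
def quadValue (Q : ℤ × ℤ × ℤ) (x : ℝ) : ℝ := Q.1 * x ^ 2 + Q.2.1 * x + Q.2.2

/-- The discriminant of `a x ^ 2 + b x + c`. -/
def quadDisc (Q : ℤ × ℤ × ℤ) : ℤ := Q.2.1 ^ 2 - 4 * Q.1 * Q.2.2

/-- The sum of `max (Q x) 0 ^ n` over the quadratic functions `Q` with discriminant `D` and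
negative leading coefficient. -/
noncomputable def quadSum (D : ℤ) (n : ℕ) (x : ℝ) : ℝ≥0∞ :=
  ∑' Q : ℤ × ℤ × ℤ, if quadDisc Q = D ∧ Q.1 < 0 then ENNReal.ofReal (quadValue Q x) ^ n else 0

/-- The quadratic functions `Q` of discriminant `D` with `Q(∞) < 0 < Q(0)`. -/
noncomputable def simpleForms (D : ℤ) : Finset (ℤ × ℤ × ℤ) :=
  (Finset.Icc (-D) D ×ˢ Finset.Icc (-D) D ×ˢ Finset.Icc (-D) D).filter
    fun Q => quadDisc Q = D ∧ Q.1 < 0 ∧ 0 < Q.2.2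

/-- When `a < 0 < c`, both terms of `D = b ^ 2 + 4 |a| c` are nonnegative, which bounds all three
coefficients by `D`; the box in the definition loses nothing. -/
theorem mem_simpleForms {D : ℤ} {Q : ℤ × ℤ × ℤ} :
    Q ∈ simpleForms D ↔ quadDisc Q = D ∧ Q.1 < 0 ∧ 0 < Q.2.2 := by
  refine ⟨fun h => (Finset.mem_filter.mp h).2, fun h => Finset.mem_filter.mpr ⟨?_, h⟩⟩
  obtain ⟨a, b, c⟩ := Q
  obtain ⟨h1, h2, h3⟩ := h
  simp only [quadDisc] at h1 h2 h3
  simp only [Finset.mem_product, Finset.mem_Icc]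
  have hb : |b| ≤ b ^ 2 := by
    rw [← sq_abs]
    rcases (abs_nonneg b).eq_or_lt with h | h
    · simp [← h]
    · nlinarith
  have := abs_le.mp (le_refl |b|)
  refine ⟨⟨?_, ?_⟩, ⟨?_, ?_⟩, ?_, ?_⟩ <;> nlinarith

/-- The symmetry `Q(x) ↦ Q(-x)`: it removes the odd powers of `x` from `∑ Q(x) ^ n`. -/
theorem sum_simpleForms_neg_middle (D : ℤ) {M : Type*} [AddCommMonoid M] (f : ℤ × ℤ × ℤ → M) :
    ∑ Q ∈ simpleForms D, f (Q.1, -Q.2.1, Q.2.2) = ∑ Q ∈ simpleForms D, f Q := by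
  refine Finset.sum_nbij' (fun Q => (Q.1, -Q.2.1, Q.2.2)) (fun Q => (Q.1, -Q.2.1, Q.2.2))
    ?_ ?_ ?_ ?_ ?_ <;> simp [mem_simpleForms, quadDisc]

/-- The symmetry `Q(x) ↦ -x ^ 2 Q(1/x)`: for odd `n` it makes the coefficients of `x ^ j` and `x ^
(2n - j)` in `∑ Q(x) ^ n` opposite, up to the sign that the odd powers of `b` carry. -/
theorem sum_simpleForms_neg_swap (D : ℤ) {M : Type*} [AddCommMonoid M] (f : ℤ × ℤ × ℤ → M) :
    ∑ Q ∈ simpleForms D, f (-Q.2.2, -Q.2.1, -Q.1) = ∑ Q ∈ simpleForms D, f Q := by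
  refine Finset.sum_nbij' (fun Q => (-Q.2.2, -Q.2.1, -Q.1)) (fun Q => (-Q.2.2, -Q.2.1, -Q.1))
    ?_ ?_ ?_ ?_ ?_ <;> simp [mem_simpleForms, quadDisc]
  · intro a b c h h1 h2; exact ⟨by linarith, h2, h1⟩
  · intro a b c h h1 h2; exact ⟨by linarith, h2, h1⟩

theorem quadSum_add_one (D : ℤ) (n : ℕ) (x : ℝ) : quadSum D n (x + 1) = quadSum D n x := by
  let e : ℤ × ℤ × ℤ ≃ ℤ × ℤ × ℤ :=
    { toFun := fun Q => (Q.1, Q.2.1 + 2 * Q.1, Q.1 + Q.2.1 + Q.2.2)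
      invFun := fun Q => (Q.1, Q.2.1 - 2 * Q.1, Q.1 - Q.2.1 + Q.2.2)
      left_inv := fun ⟨a, b, c⟩ => by ext <;> simp; ring
      right_inv := fun ⟨a, b, c⟩ => by ext <;> simp; ring }
  rw [quadSum, quadSum, ← e.tsum_eq
    (fun Q : ℤ × ℤ × ℤ => if quadDisc Q = D ∧ Q.1 < 0 then ENNReal.ofReal (quadValue Q x) ^ n else 0)]
  refine tsum_congr fun Q => ?_
  have h1 : quadDisc (e Q) = quadDisc Q := by simp only [quadDisc, e, Equiv.coe_fn_mk]; ring
  have h2 : quadValue (e Q) x = quadValue Q (x + 1) := by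
    simp only [quadValue, e, Equiv.coe_fn_mk]; push_cast; ring
  rw [h1, h2]
  rfl

theorem quadSum_add_int (D : ℤ) (n : ℕ) (x : ℝ) (m : ℤ) : quadSum D n (x + m) = quadSum D n x := by
  have h : Function.Periodic (quadSum D n) 1 := quadSum_add_one D n
  simpa using (h.int_mul m) x

theorem quadSum_zero {D : ℤ} {n : ℕ} (hn : n ≠ 0) :
    quadSum D n 0 = ∑ Q ∈ simpleForms D, ENNReal.ofReal Q.2.2 ^ n := by
  rw [quadSum, tsum_eq_sum (s := simpleForms D)]
  · refine Finset.sum_congr rfl fun Q hQ => ?_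
    rw [mem_simpleForms] at hQ
    rw [if_pos ⟨hQ.1, hQ.2.1⟩, quadValue]
    simp
  · intro Q hQ
    rw [mem_simpleForms] at hQ
    split_ifs with h
    · have : (Q.2.2 : ℝ) ≤ 0 := by
        have : Q.2.2 ≤ 0 := by by_contra! h'; exact hQ ⟨h.1, h.2, h'⟩
        exact_mod_cast this
      rw [ENNReal.ofReal_of_nonpos (by simpa [quadValue] using this), zero_pow hn]
    · rfl

/-- `x ^ (2n) F(1/x)` is the same sum with the condition `a < 0` replaced by `c < 0`. Forms with `a,
c < 0` occur on both sides; those with `a < 0 < c` are the simple forms and those with `c < 0 < a`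
their negatives. No coefficient `a` or `c` vanishes because `D` is not a square. Values in `ℝ≥0∞`
make the identity independent of convergence, and moving the negatives to the left avoids
subtraction. -/
theorem quadSum_inv {D : ℤ} (hD : ¬ IsSquare D) (n : ℕ) {x : ℝ} (hx : x ≠ 0) :
    quadSum D n x + ∑ Q ∈ simpleForms D, ENNReal.ofReal (-quadValue Q x) ^ n =
      ENNReal.ofReal (x ^ 2) ^ n * quadSum D n x⁻¹ +
        ∑ Q ∈ simpleForms D, ENNReal.ofReal (quadValue Q x) ^ n := by
  have hc {a b c : ℤ} (h : quadDisc (a, b, c) = D) : a ≠ 0 ∧ c ≠ 0 := by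
    constructor <;> rintro rfl <;> exact hD ⟨b, by simp [quadDisc] at h; rw [← h]; ring⟩
  have h1 : ENNReal.ofReal (x ^ 2) ^ n * quadSum D n x⁻¹ = ∑' Q : ℤ × ℤ × ℤ,
      if quadDisc Q = D ∧ Q.2.2 < 0 then ENNReal.ofReal (quadValue Q x) ^ n else 0 := by
    let e : ℤ × ℤ × ℤ ≃ ℤ × ℤ × ℤ :=
      { toFun := fun Q => (Q.2.2, Q.2.1, Q.1)
        invFun := fun Q => (Q.2.2, Q.2.1, Q.1)
        left_inv := fun ⟨a, b, c⟩ => rfl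
        right_inv := fun ⟨a, b, c⟩ => rfl }
    rw [quadSum, ← ENNReal.tsum_mul_left, ← e.tsum_eq]
    refine tsum_congr fun Q => ?_
    have h1 : quadDisc (e Q) = quadDisc Q := by simp only [quadDisc, e, Equiv.coe_fn_mk]; ring
    have h2 : x ^ 2 * quadValue (e Q) x⁻¹ = quadValue Q x := by
      simp only [quadValue, e, Equiv.coe_fn_mk]; field_simp; ring
    rw [h1, mul_ite, mul_zero, ← h2, ENNReal.ofReal_mul (sq_nonneg x), mul_pow]
    rfl
  have h2 : ∑ Q ∈ simpleForms D, ENNReal.ofReal (quadValue Q x) ^ n = ∑' Q : ℤ × ℤ × ℤ,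
      if quadDisc Q = D ∧ Q.1 < 0 ∧ 0 < Q.2.2 then ENNReal.ofReal (quadValue Q x) ^ n else 0 := by
    rw [tsum_eq_sum (s := simpleForms D)]
    · exact Finset.sum_congr rfl fun Q hQ => by rw [if_pos (mem_simpleForms.mp hQ)]
    · exact fun Q hQ => by rw [if_neg (mt mem_simpleForms.mpr hQ)]
  have h3 : ∑ Q ∈ simpleForms D, ENNReal.ofReal (-quadValue Q x) ^ n = ∑' Q : ℤ × ℤ × ℤ,
      if quadDisc Q = D ∧ 0 < Q.1 ∧ Q.2.2 < 0 then ENNReal.ofReal (quadValue Q x) ^ n else 0 := by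
    rw [← (Equiv.neg (ℤ × ℤ × ℤ)).tsum_eq, tsum_eq_sum (s := simpleForms D)]
    · refine Finset.sum_congr rfl fun Q hQ => ?_
      have hQ' := mem_simpleForms.mp hQ
      rw [if_pos]
      · congr 2; simp [quadValue]; ring
      · simpa [quadDisc] using hQ'
    · refine fun Q hQ => ?_
      rw [if_neg]
      contrapose! hQ
      rw [mem_simpleForms]
      simpa [quadDisc] using hQ
  rw [h1, h2, h3, quadSum, ← ENNReal.tsum_add, ← ENNReal.tsum_add]
  refine tsum_congr fun ⟨a, b, c⟩ => ?_
  by_cases h : quadDisc (a, b, c) = D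
  · obtain ⟨ha, hc⟩ := hc h
    simp only [h, true_and]
    rcases ha.lt_or_gt with ha | ha <;> rcases hc.lt_or_gt with hc | hc <;>
      simp [ha, hc, ha.not_gt, hc.not_gt]
  · simp [h]

theorem quadSum_inv_ne_top {D : ℤ} (hD : ¬ IsSquare D) (n : ℕ) {x : ℝ} (hx : x ≠ 0)
    (h : quadSum D n x⁻¹ ≠ ⊤) : quadSum D n x ≠ ⊤ := by
  have h' := quadSum_inv hD n hx
  refine ne_top_of_le_ne_top ?_ (le_self_add.trans h'.le)
  refine ENNReal.add_ne_top.mpr ⟨ENNReal.mul_ne_top (by finiteness) h, ?_⟩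
  exact ENNReal.sum_ne_top.mpr fun Q _ => by finiteness

/-- For odd `n`, `max r 0 ^ n - max (-r) 0 ^ n = r ^ n`, so the two finite sums combine to a
polynomial. -/
theorem toReal_quadSum_inv {D : ℤ} (hD : ¬ IsSquare D) {n : ℕ} (hn : Odd n) {x : ℝ} (hx : x ≠ 0)
    (h : quadSum D n x⁻¹ ≠ ⊤) :
    (quadSum D n x).toReal = x ^ (2 * n) * (quadSum D n x⁻¹).toReal +
      ∑ Q ∈ simpleForms D, quadValue Q x ^ n := by
  have h' := congrArg ENNReal.toReal (quadSum_inv hD n hx)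
  have h1 (r : ℝ) : max r 0 ^ n - max (-r) 0 ^ n = r ^ n := by
    rcases le_total 0 r with h | h
    · rw [max_eq_left h, max_eq_right (by linarith), zero_pow hn.pos.ne', sub_zero]
    · rw [max_eq_right h, max_eq_left (by linarith), zero_pow hn.pos.ne', hn.neg_pow]; ring
  rw [ENNReal.toReal_add (quadSum_inv_ne_top hD n hx h)
    (ENNReal.sum_ne_top.mpr fun Q _ => by finiteness),
    ENNReal.toReal_add (ENNReal.mul_ne_top (by finiteness) h)
    (ENNReal.sum_ne_top.mpr fun Q _ => by finiteness), ENNReal.toReal_mul, ENNReal.toReal_pow,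
    ENNReal.toReal_ofReal (sq_nonneg x), ← pow_mul, ENNReal.toReal_sum (fun _ _ => by finiteness),
    ENNReal.toReal_sum (fun _ _ => by finiteness)] at h'
  simp only [ENNReal.toReal_pow, ENNReal.toReal_ofReal'] at h'
  have h2 : ∑ Q ∈ simpleForms D, quadValue Q x ^ n = ∑ Q ∈ simpleForms D,
      (max (quadValue Q x) 0 ^ n - max (-quadValue Q x) 0 ^ n) :=
    Finset.sum_congr rfl fun Q _ => (h1 _).symm
  rw [h2, Finset.sum_sub_distrib]
  linarith

/-- If the odd polynomial in the inversion formula is `S (1 - x ^ (2 n))`, then the sum is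
constant. -/
theorem quadSum_eq {D : ℤ} (hD : ¬ IsSquare D) {n : ℕ} (hn : Odd n) {S : ℝ}
    (h0 : quadSum D n 0 = ENNReal.ofReal S) (hS : 0 ≤ S)
    (hp : ∀ x, ∑ Q ∈ simpleForms D, quadValue Q x ^ n = S * (1 - x ^ (2 * n))) (x : ℝ) :
    quadSum D n x = ENNReal.ofReal S := by
  -- Euclidean algorithm: translation reduces `p / q` to `r / q` with `0 ≤ r < q`, and inversion
  -- leads to `q / r`, of smaller denominator.
  have hrat (q : ℕ) : q ≠ 0 → ∀ p : ℤ, quadSum D n (p / q) = ENNReal.ofReal S := by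
    induction q using Nat.strong_induction_on with
    | _ q ih =>
      intro hq p
      have hq' : (q : ℝ) ≠ 0 := by exact_mod_cast hq
      have hdiv : (p : ℝ) / q = ((p % q : ℤ) : ℝ) / q + ((p / q : ℤ) : ℝ) := by
        have : (p : ℝ) = ((p % q + q * (p / q) : ℤ) : ℝ) := by rw [Int.emod_add_mul_ediv]
        rw [this]; push_cast; field_simp
      have hnn := Int.emod_nonneg p (b := (q : ℤ)) (by exact_mod_cast hq)
      have hlt := Int.emod_lt_of_pos p (b := (q : ℤ)) (by positivity)
      rw [hdiv, quadSum_add_int]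
      lift p % q to ℕ using hnn with r hr
      rcases eq_or_ne r 0 with rfl | hr0
      · simpa using h0
      have hr' : (r : ℝ) ≠ 0 := by exact_mod_cast hr0
      have hx : (((r : ℤ) : ℝ) / q) ≠ 0 := div_ne_zero (by exact_mod_cast hr') hq'
      have hinv : quadSum D n (((r : ℤ) : ℝ) / q)⁻¹ = ENNReal.ofReal S := by
        rw [inv_div]
        exact_mod_cast ih r (by exact_mod_cast hlt) hr0 q
      have hf : quadSum D n (((r : ℤ) : ℝ) / q)⁻¹ ≠ ⊤ := by rw [hinv]; finiteness
      have := toReal_quadSum_inv hD hn hx hf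
      rw [hinv, ENNReal.toReal_ofReal hS, hp] at this
      rw [← ENNReal.ofReal_toReal (quadSum_inv_ne_top hD n hx hf), this]
      congr 1; ring
  -- Each finite partial sum is continuous and is at most `S` on the dense set of rationals, hence
  -- everywhere. This also yields convergence at irrational points.
  have hle (x : ℝ) : quadSum D n x ≤ ENNReal.ofReal S := by
    rw [quadSum, ENNReal.tsum_eq_iSup_sum]
    refine iSup_le fun s => ?_
    have hcl : IsClosed {x : ℝ | ∑ Q ∈ s, (if quadDisc Q = D ∧ Q.1 < 0 then
        ENNReal.ofReal (quadValue Q x) ^ n else 0) ≤ ENNReal.ofReal S} := by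
      refine isClosed_le (continuous_finsetSum _ fun Q _ => ?_) continuous_const
      split_ifs
      · refine (ENNReal.continuous_pow n).comp (ENNReal.continuous_ofReal.comp ?_)
        unfold quadValue; fun_prop
      · exact continuous_const
    have hd : Set.range ((↑) : ℚ → ℝ) ⊆ {x : ℝ | ∑ Q ∈ s, (if quadDisc Q = D ∧ Q.1 < 0 then
        ENNReal.ofReal (quadValue Q x) ^ n else 0) ≤ ENNReal.ofReal S} := by
      rintro _ ⟨r, rfl⟩
      refine (ENNReal.sum_le_tsum s).trans ?_
      have := hrat r.den r.den_nz r.num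
      rw [← Rat.cast_def] at this
      exact this.le
    have := hcl.closure_subset_iff.mpr hd
    rw [Rat.denseRange_cast.closure_range] at this
    exact this (Set.mem_univ x)
  have hfin (x : ℝ) : quadSum D n x ≠ ⊤ := ne_top_of_le_ne_top (by finiteness) (hle x)
  -- The defect `G` lies in `[0, S]`, has period 1 and satisfies the homogeneous equation `G(x) = x
  -- ^ (2n) G(1/x)`. Any upper bound for it can be divided by 4, so it vanishes.
  let G : ℝ → ℝ := fun x => S - (quadSum D n x).toReal
  have hG0 (x : ℝ) : 0 ≤ G x := sub_nonneg.mpr (ENNReal.toReal_le_of_le_ofReal hS (hle x))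
  have hGS (x : ℝ) : G x ≤ S := sub_le_self _ ENNReal.toReal_nonneg
  have hGp (x : ℝ) (m : ℤ) : G (x + m) = G x := by simp only [G, quadSum_add_int]
  have hGi (x : ℝ) (hx : x ≠ 0) : G x = x ^ (2 * n) * G x⁻¹ := by
    simp only [G]; rw [toReal_quadSum_inv hD hn hx (hfin _), hp]; ring
  have hpow {y : ℝ} (hy : 0 ≤ y) (hy' : y ≤ 1 / 2) : y ^ (2 * n) ≤ 1 / 4 := by
    calc y ^ (2 * n) ≤ y ^ 2 := pow_le_pow_of_le_one hy (by linarith) (by have := hn.pos; omega)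
      _ ≤ 1 / 4 := by nlinarith
  have hstep {M : ℝ} (hM : ∀ x, G x ≤ M) (x : ℝ) : G x ≤ M / 4 := by
    have hM0 : 0 ≤ M := (hG0 0).trans (hM 0)
    suffices ∀ x ∈ Set.Ico (0 : ℝ) 1, G x ≤ M / 4 by
      have h := this (Int.fract x) ⟨Int.fract_nonneg x, Int.fract_lt_one x⟩
      rwa [← hGp _ ⌊x⌋, Int.fract_add_floor] at h
    rintro x ⟨hx0, hx1⟩
    rcases hx0.eq_or_lt with rfl | hx0
    · have : G 0 = 0 := by simp [G, h0, ENNReal.toReal_ofReal hS]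
      linarith
    rcases le_or_gt x (1 / 2) with hx | hx
    · rw [hGi x hx0.ne']
      nlinarith [hpow hx0.le hx, hM x⁻¹, hG0 x⁻¹, pow_nonneg hx0.le (2 * n)]
    -- For `x > 1/2` the factor `x ^ (2n)` may be close to 1; inverting, translating by `-1` and
    -- inverting again gives the factor `(1 - x) ^ (2n)` instead.
    · have hy : x⁻¹ - 1 ≠ 0 := by
        rw [sub_ne_zero]; exact (one_lt_inv₀ hx0 |>.mpr hx1).ne'
      have h1 : G x⁻¹ = G (x⁻¹ - 1) := by
        have := hGp (x⁻¹ - 1) 1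
        rwa [Int.cast_one, sub_add_cancel] at this
      rw [hGi x hx0.ne', h1, hGi _ hy, ← mul_assoc, ← mul_pow,
        show x * (x⁻¹ - 1) = 1 - x by field_simp]
      nlinarith [hpow (y := 1 - x) (by linarith) (by linarith), hM (x⁻¹ - 1)⁻¹, hG0 (x⁻¹ - 1)⁻¹,
        pow_nonneg (sub_nonneg.mpr hx1.le) (2 * n)]
  have hbound (m : ℕ) : ∀ x, G x ≤ S * (1 / 4) ^ m := by
    induction m with
    | zero => simpa using hGS
    | succ m ih => intro x; have := hstep ih x; rw [pow_succ]; linarith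
  have hlim : Filter.Tendsto (fun m : ℕ => S * (1 / 4 : ℝ) ^ m) Filter.atTop (nhds (S * 0)) :=
    (tendsto_pow_atTop_nhds_zero_of_lt_one (by norm_num) (by norm_num)).const_mul S
  rw [mul_zero] at hlim
  have hGx : G x ≤ 0 := ge_of_tendsto' hlim fun m => hbound m x
  rw [← ENNReal.ofReal_toReal (hfin x)]
  congr 1
  have := hG0 x
  simp only [G] at this hGx
  linarith

theorem quadSum_zero_eq_ofReal {D : ℤ} {n : ℕ} (hn : n ≠ 0) :
    quadSum D n 0 = ENNReal.ofReal (∑ Q ∈ simpleForms D, (Q.2.2 : ℝ) ^ n) := by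
  have h (Q) (hQ : Q ∈ simpleForms D) : (0 : ℝ) ≤ Q.2.2 := by
    exact_mod_cast (mem_simpleForms.mp hQ).2.2.le
  rw [quadSum_zero hn, ENNReal.ofReal_sum_of_nonneg fun Q hQ => pow_nonneg (h Q hQ) n]
  exact Finset.sum_congr rfl fun Q hQ => (ENNReal.ofReal_pow (h Q hQ) n).symm

theorem quadSum_one {D : ℤ} (hD : ¬ IsSquare D) (x : ℝ) :
    quadSum D 1 x = ENNReal.ofReal (∑ Q ∈ simpleForms D, (Q.2.2 : ℝ) ^ 1) := by
  refine quadSum_eq hD odd_one (quadSum_zero_eq_ofReal one_ne_zero) ?_ ?_ x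
  · exact Finset.sum_nonneg fun Q hQ => by
      have : (0 : ℝ) < Q.2.2 := by exact_mod_cast (mem_simpleForms.mp hQ).2.2
      positivity
  · intro x
    have h1 := sum_simpleForms_neg_middle D fun Q => (Q.2.1 : ℝ)
    have h2 := sum_simpleForms_neg_swap D fun Q => (Q.2.2 : ℝ)
    simp only [Int.cast_neg, Finset.sum_neg_distrib] at h1 h2
    simp only [quadValue, pow_one, Finset.sum_add_distrib, ← Finset.sum_mul]
    rw [← h2, show ∑ Q ∈ simpleForms D, (Q.2.1 : ℝ) = 0 by linarith]
    ring

/-- The two symmetries leave only `S (1 - x ^ 6) + β (x ^ 2 - x ^ 4)`. That `β = 0` is forced by the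
consistency of periodicity and inversion, applied along two Euclidean paths to the same point. -/
theorem quadSum_three {D : ℤ} (hD : ¬ IsSquare D) (x : ℝ) :
    quadSum D 3 x = ENNReal.ofReal (∑ Q ∈ simpleForms D, (Q.2.2 : ℝ) ^ 3) := by
  have h3 : Odd 3 := by decide
  set S := ∑ Q ∈ simpleForms D, (Q.2.2 : ℝ) ^ 3 with hSdef
  have hS : 0 ≤ S := Finset.sum_nonneg fun Q hQ => by
    have : (0 : ℝ) < Q.2.2 := by exact_mod_cast (mem_simpleForms.mp hQ).2.2
    positivity
  have h0 : quadSum D 3 0 = ENNReal.ofReal S := quadSum_zero_eq_ofReal three_ne_zero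
  obtain ⟨β, hβ⟩ : ∃ β : ℝ, ∀ x, ∑ Q ∈ simpleForms D, quadValue Q x ^ 3 =
      S * (1 - x ^ 6) + β * (x ^ 2 - x ^ 4) := by
    refine ⟨∑ Q ∈ simpleForms D, (3 * Q.1 * Q.2.2 ^ 2 + 3 * Q.2.1 ^ 2 * Q.2.2 : ℝ), fun x => ?_⟩
    have e1 := sum_simpleForms_neg_middle D fun Q => (3 * Q.1 ^ 2 * Q.2.1 : ℝ)
    have e2 := sum_simpleForms_neg_middle D fun Q => (6 * Q.1 * Q.2.1 * Q.2.2 + Q.2.1 ^ 3 : ℝ)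
    have e3 := sum_simpleForms_neg_middle D fun Q => (3 * Q.2.1 * Q.2.2 ^ 2 : ℝ)
    have e4 := sum_simpleForms_neg_swap D fun Q => (Q.1 ^ 3 : ℝ)
    have e5 := sum_simpleForms_neg_swap D fun Q => (3 * Q.1 ^ 2 * Q.2.2 + 3 * Q.1 * Q.2.1 ^ 2 : ℝ)
    have f1 : ∑ Q ∈ simpleForms D, (3 * Q.1 ^ 2 * Q.2.1 : ℝ) = 0 := by
      have : ∀ Q : ℤ × ℤ × ℤ, (3 * Q.1 ^ 2 * ((-Q.2.1 : ℤ) : ℝ) : ℝ) = -(3 * Q.1 ^ 2 * Q.2.1) := by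
        intro Q; push_cast; ring
      simp only [this, Finset.sum_neg_distrib] at e1
      linarith
    have f2 : ∑ Q ∈ simpleForms D, (6 * Q.1 * Q.2.1 * Q.2.2 + Q.2.1 ^ 3 : ℝ) = 0 := by
      have : ∀ Q : ℤ × ℤ × ℤ, (6 * Q.1 * ((-Q.2.1 : ℤ) : ℝ) * Q.2.2 + ((-Q.2.1 : ℤ) : ℝ) ^ 3 : ℝ) =
          -(6 * Q.1 * Q.2.1 * Q.2.2 + Q.2.1 ^ 3 : ℝ) := by
        intro Q; push_cast; ring
      simp only [this, Finset.sum_neg_distrib] at e2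
      linarith
    have f3 : ∑ Q ∈ simpleForms D, (3 * Q.2.1 * Q.2.2 ^ 2 : ℝ) = 0 := by
      have : ∀ Q : ℤ × ℤ × ℤ, (3 * ((-Q.2.1 : ℤ) : ℝ) * Q.2.2 ^ 2 : ℝ) =
          -(3 * Q.2.1 * Q.2.2 ^ 2 : ℝ) := by
        intro Q; push_cast; ring
      simp only [this, Finset.sum_neg_distrib] at e3
      linarith
    have f4 : ∑ Q ∈ simpleForms D, (Q.1 ^ 3 : ℝ) = -S := by
      rw [← e4, hSdef, ← Finset.sum_neg_distrib]
      exact Finset.sum_congr rfl fun Q _ => by push_cast; ring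
    have f5 : ∑ Q ∈ simpleForms D, (3 * Q.1 ^ 2 * Q.2.2 + 3 * Q.1 * Q.2.1 ^ 2 : ℝ) =
        -∑ Q ∈ simpleForms D, (3 * Q.1 * Q.2.2 ^ 2 + 3 * Q.2.1 ^ 2 * Q.2.2 : ℝ) := by
      rw [← e5, ← Finset.sum_neg_distrib]
      exact Finset.sum_congr rfl fun Q _ => by push_cast; ring
    have key : ∑ Q ∈ simpleForms D, quadValue Q x ^ 3 =
        (∑ Q ∈ simpleForms D, (Q.1 ^ 3 : ℝ)) * x ^ 6 +
        (∑ Q ∈ simpleForms D, (3 * Q.1 ^ 2 * Q.2.1 : ℝ)) * x ^ 5 +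
        (∑ Q ∈ simpleForms D, (3 * Q.1 ^ 2 * Q.2.2 + 3 * Q.1 * Q.2.1 ^ 2 : ℝ)) * x ^ 4 +
        (∑ Q ∈ simpleForms D, (6 * Q.1 * Q.2.1 * Q.2.2 + Q.2.1 ^ 3 : ℝ)) * x ^ 3 +
        (∑ Q ∈ simpleForms D, (3 * Q.1 * Q.2.2 ^ 2 + 3 * Q.2.1 ^ 2 * Q.2.2 : ℝ)) * x ^ 2 +
        (∑ Q ∈ simpleForms D, (3 * Q.2.1 * Q.2.2 ^ 2 : ℝ)) * x + S := by
      simp only [hSdef, Finset.sum_mul, ← Finset.sum_add_distrib]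
      exact Finset.sum_congr rfl fun Q _ => by rw [quadValue]; ring
    rw [key, f1, f2, f3, f4, f5]
    ring
  have hstep {y z : ℝ} (hy : y ≠ 0) (hyz : y⁻¹ = z) (hz : quadSum D 3 z ≠ ⊤) :
      quadSum D 3 y ≠ ⊤ ∧ (quadSum D 3 y).toReal = y ^ 6 * (quadSum D 3 z).toReal +
        (S * (1 - y ^ 6) + β * (y ^ 2 - y ^ 4)) := by
    subst hyz
    exact ⟨quadSum_inv_ne_top hD 3 hy hz, by rw [toReal_quadSum_inv hD h3 hy hz, hβ]⟩
  have hint (m : ℤ) : quadSum D 3 m = ENNReal.ofReal S := by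
    have := quadSum_add_int D 3 0 m
    rwa [zero_add, h0] at this
  have v2 : quadSum D 3 2 = ENNReal.ofReal S := by exact_mod_cast hint 2
  have v3 : quadSum D 3 (-3) = ENNReal.ofReal S := by exact_mod_cast hint (-3)
  have hSt : (ENNReal.ofReal S).toReal = S := ENNReal.toReal_ofReal hS
  -- Inversion gives the values `S + 3β/16` at `1/2` and `S + 8β/81` at `-1/3`. The point `2/3` is a
  -- translate of `-1/3` and also the inverse of `3/2`, a translate of `1/2`; the second route gives
  -- `S + 64β/243`, so `β = 0`.
  obtain ⟨fa, ea⟩ := hstep (y := 1 / 2) (z := 2) (by norm_num) (by norm_num) (by rw [v2]; finiteness)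
  obtain ⟨fb, eb⟩ := hstep (y := -1 / 3) (z := -3) (by norm_num) (by norm_num)
    (by rw [v3]; finiteness)
  have p1 : quadSum D 3 (3 / 2) = quadSum D 3 (1 / 2) := by
    have := quadSum_add_one D 3 (1 / 2); norm_num at this ⊢; exact this
  have p2 : quadSum D 3 (2 / 3) = quadSum D 3 (-1 / 3) := by
    have := quadSum_add_one D 3 (-1 / 3); norm_num at this ⊢; exact this
  obtain ⟨fc, ec⟩ := hstep (y := 2 / 3) (z := 3 / 2) (by norm_num) (by norm_num) (by rwa [p1])
  rw [p2, eb, p1, ea, v2, v3, hSt] at ec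
  have hβ0 : β = 0 := by linarith
  refine quadSum_eq hD h3 h0 hS (fun x => ?_) x
  rw [hβ, hβ0]; ring

/-- A simple form amounts to `s = b` together with a divisor `c` of `(D - s ^ 2) / 4 = -a c`, which
is positive. -/
theorem sum_simpleForms_eq_sigmaSum {D : ℤ} (hD0 : 0 < D) (n : ℕ) :
    ∑ Q ∈ simpleForms D, (Q.2.2 : ℝ) ^ n = (sigmaSum n D 4 : ℝ) := by
  rw [sigmaSum_eq_sum]
  have h : ∀ s : ℤ, (if ((4 : ℕ) : ℤ) ∣ D - s ^ 2 then
      ArithmeticFunction.sigma n ((D - s ^ 2) / ((4 : ℕ) : ℤ)).toNat else 0 : ℕ) =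
      ∑ c ∈ if (4 : ℤ) ∣ D - s ^ 2 then ((D - s ^ 2) / 4).toNat.divisors else ∅, c ^ n := by
    intro s
    push_cast
    split_ifs
    · rw [ArithmeticFunction.sigma_apply]
    · simp
  simp only [h]
  rw [Finset.sum_sigma']
  push_cast
  refine Finset.sum_bij' (fun Q _ => ⟨Q.2.1, Q.2.2.toNat⟩)
    (fun p _ => (-((D - p.1 ^ 2) / 4 / (p.2 : ℤ)), p.1, (p.2 : ℤ))) ?_ ?_ ?_ ?_ ?_
  · rintro ⟨a, b, c⟩ hQ
    have hQ' := hQ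
    simp only [simpleForms, Finset.mem_filter, Finset.mem_product, Finset.mem_Icc] at hQ'
    obtain ⟨h1, h2, h3⟩ := mem_simpleForms.mp hQ
    simp only [quadDisc] at h1 h2 h3
    have hdiv : D - b ^ 2 = 4 * (-a * c) := by rw [← h1]; ring
    simp only [Finset.mem_sigma, Finset.mem_Icc, abs_of_pos hD0]
    refine ⟨hQ'.1.2.1, ?_⟩
    rw [if_pos ⟨_, hdiv⟩, hdiv, Int.mul_ediv_cancel_left _ (by norm_num), Nat.mem_divisors]
    lift c to ℕ using h3.le
    obtain ⟨m, rfl⟩ : ∃ m : ℕ, a = -m := ⟨a.natAbs, by omega⟩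
    have : - -(m : ℤ) * c = ((m * c : ℕ) : ℤ) := by push_cast; ring
    rw [this, Int.toNat_natCast, Int.toNat_natCast]
    refine ⟨Dvd.intro_left m rfl, Nat.mul_ne_zero ?_ ?_⟩ <;> omega
  · rintro ⟨b, c⟩ hp
    simp only [Finset.mem_sigma, Finset.mem_Icc] at hp
    obtain ⟨hb, hc⟩ := hp
    split_ifs at hc with h4
    swap; · simp at hc
    rw [Nat.mem_divisors] at hc
    obtain ⟨m, hm⟩ := h4
    rw [hm, Int.mul_ediv_cancel_left _ (by norm_num)] at hc
    lift m to ℕ using by omega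
    rw [Int.toNat_natCast] at hc
    obtain ⟨⟨t, rfl⟩, h0⟩ := hc
    have hc0 : c ≠ 0 := left_ne_zero_of_mul h0
    have ht0 : t ≠ 0 := right_ne_zero_of_mul h0
    rw [mem_simpleForms]
    simp only [hm]
    rw [Int.mul_ediv_cancel_left _ (by norm_num), Nat.cast_mul,
      Int.mul_ediv_cancel_left _ (by exact_mod_cast hc0)]
    refine ⟨?_, by omega, by omega⟩
    simp only [quadDisc]
    push_cast at hm
    linarith
  · rintro ⟨a, b, c⟩ hQ
    obtain ⟨h1, h2, h3⟩ := mem_simpleForms.mp hQ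
    simp only [quadDisc] at h1 h2 h3
    have hdiv : D - b ^ 2 = 4 * (c * -a) := by rw [← h1]; ring
    simp only [Int.toNat_of_nonneg h3.le]
    rw [hdiv, Int.mul_ediv_cancel_left _ (by norm_num), Int.mul_ediv_cancel_left _ h3.ne', neg_neg]
  · rintro ⟨b, c⟩ hp
    simp
  · rintro ⟨a, b, c⟩ hQ
    obtain ⟨h1, h2, h3⟩ := mem_simpleForms.mp hQ
    simp only at h3 ⊢
    congr 1
    exact_mod_cast (Int.toNat_of_nonneg h3.le).symm

/-! ### Integration over a period and the Dirichlet series of root counts -/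

open MeasureTheory
open scoped ENNReal
theorem tsum_setLIntegral_Ioc_sub_intCast (φ : ℝ → ℝ≥0∞) :
    ∑' m : ℤ, ∫⁻ x in Set.Ioc 0 1, φ (x - m) = ∫⁻ x, φ x := by
  have h (m : ℤ) : ∫⁻ x in Set.Ioc 0 1, φ (x - m) =
      ∫⁻ x in Set.Ioc (((-m : ℤ) : ℝ)) ((-m : ℤ) + 1), φ x := by
    have h := (measurePreserving_sub_right volume (m : ℝ)).setLIntegral_comp_preimage_emb
      (MeasurableEquiv.subRight (m : ℝ)).measurableEmbedding φ (Set.Ioc ((-m : ℤ) : ℝ) ((-m : ℤ) + 1))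
    rw [← h]
    simp
  simp only [h]
  refine ((Equiv.neg ℤ).tsum_eq (fun m : ℤ => ∫⁻ x in Set.Ioc (m : ℝ) (m + 1), φ x)).trans ?_
  rw [← lintegral_iUnion (fun _ => measurableSet_Ioc) (Set.pairwise_disjoint_Ioc_intCast ℝ),
    iUnion_Ioc_intCast, Measure.restrict_univ]

/-- The constant `4 ^ (-n) / 2 * ∫ u in (-1)..1, (1 - u ^ 2) ^ n`. -/
noncomputable def quadConst (n : ℕ) : ℝ := (4 ^ n)⁻¹ / 2 * ∫ u in (-1 : ℝ)..1, (1 - u ^ 2) ^ n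

/-- The integrand is supported where `|2Ax - c| ≤ √D`; the substitution `2Ax - c = √D u` reduces to
the integral in `quadConst`. -/
theorem lintegral_quad {D A : ℝ} (hD : 0 < D) (hA : 0 < A) (c : ℝ) {n : ℕ} (hn : n ≠ 0) :
    ∫⁻ x : ℝ, ENNReal.ofReal ((D - (2 * A * x - c) ^ 2) / (4 * A)) ^ n =
      ENNReal.ofReal (quadConst n * √D ^ (2 * n + 1) / A ^ (n + 1)) := by
  set s := √D with hs
  have hs0 : 0 < s := Real.sqrt_pos.mpr hD
  have hsD : D = s ^ 2 := (Real.sq_sqrt hD.le).symm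
  rw [hsD]
  have hle : (c - s) / (2 * A) ≤ (c + s) / (2 * A) := by gcongr; linarith
  have hcont : Continuous fun x : ℝ => ((s ^ 2 - (2 * A * x - c) ^ 2) / (4 * A)) ^ n := by fun_prop
  have h1 : (fun x : ℝ => ENNReal.ofReal ((s ^ 2 - (2 * A * x - c) ^ 2) / (4 * A)) ^ n) =
      (Set.Ioc ((c - s) / (2 * A)) ((c + s) / (2 * A))).indicator
        fun x => ENNReal.ofReal (((s ^ 2 - (2 * A * x - c) ^ 2) / (4 * A)) ^ n) := by
    ext x
    by_cases hx : x ∈ Set.Ioc ((c - s) / (2 * A)) ((c + s) / (2 * A))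
    · rw [Set.indicator_of_mem hx, ENNReal.ofReal_pow]
      rw [Set.mem_Ioc, div_lt_iff₀ (by positivity), le_div_iff₀ (by positivity)] at hx
      exact div_nonneg (by nlinarith) (by positivity)
    · rw [Set.indicator_of_notMem hx, ENNReal.ofReal_of_nonpos, zero_pow hn]
      rw [Set.mem_Ioc, div_lt_iff₀ (by positivity), le_div_iff₀ (by positivity), not_and_or,
        not_lt, not_le] at hx
      refine div_nonpos_of_nonpos_of_nonneg ?_ (by positivity)
      rcases hx with hx | hx <;> nlinarith
  rw [h1, lintegral_indicator measurableSet_Ioc, ← ofReal_integral_eq_lintegral_ofReal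
    (hcont.integrableOn_Ioc), ← intervalIntegral.integral_of_le hle]
  · congr 1
    rw [intervalIntegral.integral_comp_mul_sub (fun u => ((s ^ 2 - u ^ 2) / (4 * A)) ^ n)
      (by positivity), show 2 * A * ((c - s) / (2 * A)) - c = s * (-1) by field_simp; ring,
      show 2 * A * ((c + s) / (2 * A)) - c = s * 1 by field_simp; ring,
      ← intervalIntegral.smul_integral_comp_mul_left]
    have h2 (u : ℝ) : ((s ^ 2 - (s * u) ^ 2) / (4 * A)) ^ n =
        (s ^ (2 * n) / (4 * A) ^ n) * (1 - u ^ 2) ^ n := by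
      rw [pow_mul, ← div_pow, ← mul_pow]; congr 1; ring
    simp only [h2, intervalIntegral.integral_const_mul, quadConst, smul_eq_mul]
    rw [mul_pow]
    field_simp
    ring
  · refine (ae_restrict_iff' measurableSet_Ioc).mpr (ae_of_all _ fun x hx => ?_)
    rw [Set.mem_Ioc, div_lt_iff₀ (by positivity), le_div_iff₀ (by positivity)] at hx
    exact pow_nonneg (div_nonneg (by nlinarith) (by positivity)) n

theorem quadConst_one : quadConst 1 = 1 / 6 := by
  have : ∫ u in (-1 : ℝ)..1, (1 - u ^ 2) ^ 1 = 4 / 3 := by norm_num [integral_pow]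
  rw [quadConst, this]; norm_num

theorem quadConst_three : quadConst 3 = 1 / 140 := by
  have : ∫ u in (-1 : ℝ)..1, (1 - u ^ 2) ^ 3 = 32 / 35 := by
    have h (u : ℝ) : (1 - u ^ 2) ^ 3 = 1 - 3 * u ^ 2 + 3 * u ^ 4 - u ^ 6 := by ring
    simp only [h]
    rw [intervalIntegral.integral_sub (Continuous.intervalIntegrable (by fun_prop) _ _)
      (Continuous.intervalIntegrable (by fun_prop) _ _), intervalIntegral.integral_add
      (Continuous.intervalIntegrable (by fun_prop) _ _)
      (Continuous.intervalIntegrable (by fun_prop) _ _), intervalIntegral.integral_sub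
      (Continuous.intervalIntegrable (by fun_prop) _ _)
      (Continuous.intervalIntegrable (by fun_prop) _ _)]
    norm_num [integral_pow]
  rw [quadConst, this]; norm_num

/-- The number of roots of `X ^ 2 + δ X - e` modulo `A` (and `0` for `A = 0`). -/
def rootCount (δ e : ℤ) (A : ℕ) : ℕ :=
  ((Finset.range A).filter fun r : ℕ => (A : ℤ) ∣ (r : ℤ) ^ 2 + δ * r - e).card

/-- With `a = -A`, the middle coefficient has the parity of `D` and is written `2β + δ`; then the
discriminant is `D` exactly when `A * (-c) = β ^ 2 + δ β - e`, so a form is a pair `(A, β)` subject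
to a divisibility. Completing the square gives the displayed value. -/
theorem quadSum_eq_tsum {D δ e : ℤ} (hδ : δ = 0 ∨ δ = 1) (hD : D = 4 * e + δ) {n : ℕ} (x : ℝ) :
    quadSum D n x = ∑' p : ℕ+ × ℤ, if ((p.1 : ℕ) : ℤ) ∣ p.2 ^ 2 + δ * p.2 - e then
      ENNReal.ofReal ((D - (2 * (p.1 : ℕ) * x - (2 * p.2 + δ)) ^ 2) / (4 * (p.1 : ℕ))) ^ n else 0 := by
  have hδ2 : δ ^ 2 = δ := by rcases hδ with rfl | rfl <;> norm_num
  let i : ℕ+ × ℤ → ℤ × ℤ × ℤ := fun p =>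
    (-((p.1 : ℕ) : ℤ), 2 * p.2 + δ, -((p.2 ^ 2 + δ * p.2 - e) / ((p.1 : ℕ) : ℤ)))
  have hi : Function.Injective i := by
    rintro ⟨a, b⟩ ⟨a', b'⟩ h
    simp only [i, Prod.mk.injEq, neg_inj, Nat.cast_inj, PNat.coe_inj] at h
    ext
    · rw [h.1]
    · change b = b'; linarith [h.2.1]
  rw [quadSum, ← hi.tsum_eq]
  · refine tsum_congr fun ⟨a, b⟩ => ?_
    have ha : (0 : ℤ) < (a : ℕ) := by exact_mod_cast a.pos
    by_cases hab : ((a : ℕ) : ℤ) ∣ b ^ 2 + δ * b - e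
    · obtain ⟨m, hm⟩ := hab
      have hdiv : (b ^ 2 + δ * b - e) / ((a : ℕ) : ℤ) = m := by
        rw [hm, Int.mul_ediv_cancel_left _ ha.ne']
      have hdisc : quadDisc (i (a, b)) = D := by
        simp only [quadDisc, i, hdiv]; linear_combination 4 * hm + hδ2 - hD
      rw [if_pos ⟨hdisc, by simp [i]⟩, if_pos ⟨m, hm⟩]
      congr 2
      have hm' : (b ^ 2 + δ * b - e : ℝ) = a * m := by exact_mod_cast hm
      have hδ2' : (δ ^ 2 : ℝ) = δ := by exact_mod_cast hδ2
      have hD' : (D : ℝ) = 4 * e + δ := by exact_mod_cast hD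
      have ha' : (a : ℝ) ≠ 0 := by exact_mod_cast ha.ne'
      simp only [quadValue, i, hdiv]
      push_cast
      field_simp
      linear_combination -hD' + 4 * hm' + hδ2'
    · rw [if_neg hab, if_neg]
      rintro ⟨h, -⟩
      refine hab ⟨(b ^ 2 + δ * b - e) / ((a : ℕ) : ℤ), ?_⟩
      simp only [quadDisc, i] at h
      linarith
  · rintro ⟨a, b, c⟩ h
    rw [Function.mem_support] at h
    have h' : quadDisc (a, b, c) = D ∧ a < 0 := by
      by_contra hne; exact h (if_neg hne)
    obtain ⟨h1, h2⟩ := h'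
    simp only [quadDisc] at h1
    have hb : b = 2 * ((b - δ) / 2) + δ := by
      have : (b ^ 2) % 2 = δ % 2 := by
        have : b ^ 2 = δ + 2 * (2 * e + 2 * a * c) := by linarith
        rw [this]; simp
      have hb2 : b % 2 = 0 ∨ b % 2 = 1 := by omega
      rcases hb2 with hb2 | hb2 <;> simp [pow_two, Int.mul_emod, hb2] at this <;> omega
    refine ⟨(⟨a.natAbs, by omega⟩, (b - δ) / 2), ?_⟩
    set β := (b - δ) / 2
    have ha : ((a.natAbs : ℕ) : ℤ) = -a := by omega
    have hm : β ^ 2 + δ * β - e = -a * -c := by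
      rw [hb, hD] at h1; linarith
    simp only [i, PNat.mk_coe, ha, hm]
    rw [Int.mul_ediv_cancel_left _ (by omega), neg_neg, neg_neg, ← hb]

/-- The constant `S` is its own integral over a period. For fixed `A` the admissible `β` form
`rootCount` residue classes modulo `A`, and replacing `β` by `β + mA` shifts `x` by `m`, so each
class unfolds to one integral over the real line. -/
theorem hasSum_rootCount {D δ e : ℤ} (hδ : δ = 0 ∨ δ = 1) (hD : D = 4 * e + δ) (hD0 : 0 < D)
    {n : ℕ} (hn : n ≠ 0) {S : ℝ} (hS : 0 ≤ S) (h : ∀ x, quadSum D n x = ENNReal.ofReal S) :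
    HasSum (fun A : ℕ => (rootCount δ e A : ℝ) *
      (quadConst n * √D ^ (2 * n + 1) / A ^ (n + 1))) S := by
  have hK : 0 ≤ quadConst n := by
    refine mul_nonneg (by positivity) (intervalIntegral.integral_nonneg (by norm_num) ?_)
    intro u hu
    exact pow_nonneg (by nlinarith [hu.1, hu.2]) n
  have hD' : (0 : ℝ) < D := by exact_mod_cast hD0
  have h1 : ENNReal.ofReal S = ∫⁻ x in Set.Ioc (0 : ℝ) 1, quadSum D n x := by simp [h]
  simp only [quadSum_eq_tsum hδ hD] at h1
  rw [lintegral_tsum, ENNReal.tsum_prod (f := fun (A : ℕ+) (b : ℤ) => ∫⁻ x in Set.Ioc (0 : ℝ) 1,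
    if ((A : ℕ) : ℤ) ∣ b ^ 2 + δ * b - e then
      ENNReal.ofReal ((D - (2 * (A : ℕ) * x - (2 * b + δ)) ^ 2) / (4 * (A : ℕ))) ^ n else 0)] at h1
  swap
  · intro p
    refine Measurable.aemeasurable ?_
    split_ifs
    · fun_prop
    · exact measurable_const
  have h2 (A : ℕ+) : (∑' b : ℤ, ∫⁻ x in Set.Ioc (0 : ℝ) 1,
      if ((A : ℕ) : ℤ) ∣ b ^ 2 + δ * b - e then
        ENNReal.ofReal ((D - (2 * (A : ℕ) * x - (2 * b + δ)) ^ 2) / (4 * (A : ℕ))) ^ n else 0) =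
      ENNReal.ofReal ((rootCount δ e A : ℝ) * (quadConst n * √D ^ (2 * n + 1) / A ^ (n + 1))) := by
    have hA : (0 : ℝ) < (A : ℕ) := by exact_mod_cast A.pos
    rw [← (Int.divModEquiv A).symm.tsum_eq, ← (Equiv.prodComm (Fin A) ℤ).tsum_eq]
    refine (ENNReal.tsum_prod (f := fun (r : Fin A) (m : ℤ) => ∫⁻ x in Set.Ioc (0 : ℝ) 1,
        if ((A : ℕ) : ℤ) ∣ (m * (A : ℕ) + (r : ℕ)) ^ 2 + δ * (m * (A : ℕ) + (r : ℕ)) - e then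
        ENNReal.ofReal ((D - (2 * (A : ℕ) * x - (2 * ((m * (A : ℕ) + (r : ℕ) : ℤ)) + δ)) ^ 2) /
          (4 * (A : ℕ))) ^ n else 0)).trans ?_
    rw [tsum_fintype]
    have h3 (r : Fin A) : (∑' m : ℤ, ∫⁻ x in Set.Ioc (0 : ℝ) 1,
        if ((A : ℕ) : ℤ) ∣ (m * (A : ℕ) + (r : ℕ)) ^ 2 + δ * (m * (A : ℕ) + (r : ℕ)) - e then
        ENNReal.ofReal ((D - (2 * (A : ℕ) * x - (2 * ((m * (A : ℕ) + (r : ℕ) : ℤ)) + δ)) ^ 2) /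
          (4 * (A : ℕ))) ^ n else 0) =
        if ((A : ℕ) : ℤ) ∣ ((r : ℕ) : ℤ) ^ 2 + δ * (r : ℕ) - e then
          ENNReal.ofReal (quadConst n * √D ^ (2 * n + 1) / A ^ (n + 1)) else 0 := by
      have h4 (m : ℤ) : ((A : ℕ) : ℤ) ∣ (m * (A : ℕ) + (r : ℕ)) ^ 2 + δ * (m * (A : ℕ) + (r : ℕ)) - e ↔
          ((A : ℕ) : ℤ) ∣ ((r : ℕ) : ℤ) ^ 2 + δ * (r : ℕ) - e := by
        rw [show (m * (A : ℕ) + (r : ℕ)) ^ 2 + δ * (m * (A : ℕ) + (r : ℕ)) - e =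
          (((r : ℕ) : ℤ) ^ 2 + δ * (r : ℕ) - e) +
            ((A : ℕ) : ℤ) * (m * (m * (A : ℕ) + 2 * (r : ℕ) + δ)) by ring]
        exact dvd_add_left (dvd_mul_right _ _)
      simp only [h4]
      split_ifs
      · rw [← lintegral_quad hD' hA (2 * (r : ℕ) + δ) hn, ← tsum_setLIntegral_Ioc_sub_intCast]
        refine tsum_congr fun m => lintegral_congr fun x => ?_
        congr 4
        push_cast
        ring
      · simp
    rw [Finset.sum_congr rfl fun r _ => h3 r, Finset.sum_fin_eq_sum_range, rootCount,
      ENNReal.ofReal_mul (by positivity), ENNReal.ofReal_natCast, ← nsmul_eq_mul,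
      ← Finset.sum_const, Finset.sum_filter]
    refine Finset.sum_congr rfl fun r hr => ?_
    rw [dif_pos (Finset.mem_range.mp hr)]
  rw [tsum_congr h2] at h1
  have hnn (A : ℕ+) : 0 ≤ (rootCount δ e A : ℝ) * (quadConst n * √D ^ (2 * n + 1) / A ^ (n + 1)) := by
    positivity
  have hne : ∑' A : ℕ+, ENNReal.ofReal ((rootCount δ e A : ℝ) *
      (quadConst n * √D ^ (2 * n + 1) / A ^ (n + 1))) ≠ ⊤ := by rw [← h1]; finiteness
  have hsum : Summable fun A : ℕ+ => (rootCount δ e A : ℝ) *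
      (quadConst n * √D ^ (2 * n + 1) / A ^ (n + 1)) := by
    simpa only [ENNReal.toReal_ofReal (hnn _)] using ENNReal.summable_toReal hne
  rw [← ENNReal.ofReal_tsum_of_nonneg hnn hsum] at h1
  have h5 := hsum.hasSum
  rw [← (ENNReal.ofReal_eq_ofReal_iff hS (tsum_nonneg hnn)).mp h1] at h5
  rw [← Function.Injective.hasSum_iff PNat.coe_injective]
  · exact h5
  · intro A hA
    -- The term at `A = 0` vanishes because `rootCount` is `0` there.
    have : A = 0 := by
      by_contra h0
      exact hA ⟨⟨A, Nat.pos_of_ne_zero h0⟩, rfl⟩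
    simp [this, rootCount]

/-! ### Roots of quadratic polynomials modulo prime powers, and the Euler product -/

theorem rootCount_eq_natCard (δ e : ℤ) (A : ℕ) [NeZero A] :
    rootCount δ e A = Nat.card {x : ZMod A // x ^ 2 + δ * x - e = 0} := by
  classical
  rw [Nat.card_eq_fintype_card, Fintype.card_subtype, rootCount]
  refine Finset.card_bij' (fun r _ => (r : ZMod A)) (fun x _ => x.val) ?_ ?_ ?_ ?_
  · intro r hr
    rw [Finset.mem_filter] at hr ⊢
    refine ⟨Finset.mem_univ _, ?_⟩
    have := (ZMod.intCast_zmod_eq_zero_iff_dvd _ A).mpr hr.2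
    simpa using this
  · intro x hx
    rw [Finset.mem_filter] at hx ⊢
    refine ⟨Finset.mem_range.mpr (ZMod.val_lt x), ?_⟩
    rw [← ZMod.intCast_zmod_eq_zero_iff_dvd]
    simpa using hx.2
  · intro r hr
    rw [Finset.mem_filter, Finset.mem_range] at hr
    exact ZMod.val_cast_of_lt hr.1
  · intro x _
    simp

theorem rootCount_mul (δ e : ℤ) {m n : ℕ} (h : m.Coprime n) :
    rootCount δ e (m * n) = rootCount δ e m * rootCount δ e n := by
  rcases eq_or_ne m 0 with rfl | hm
  · simp [rootCount]
  rcases eq_or_ne n 0 with rfl | hn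
  · simp [rootCount]
  have : NeZero m := ⟨hm⟩
  have : NeZero n := ⟨hn⟩
  rw [rootCount_eq_natCard, rootCount_eq_natCard, rootCount_eq_natCard, ← Nat.card_prod]
  let c := ZMod.chineseRemainder h
  refine Nat.card_congr ((c.toEquiv.subtypeEquiv (q := fun y : ZMod m × ZMod n =>
    (y.1 ^ 2 + δ * y.1 - e = 0) ∧ (y.2 ^ 2 + δ * y.2 - e = 0)) fun x => ?_).trans
    (Equiv.subtypeProdEquivProd (p := fun x : ZMod m => x ^ 2 + δ * x - e = 0)
      (q := fun x : ZMod n => x ^ 2 + δ * x - e = 0)))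
  rw [← map_eq_zero_iff c c.injective, Prod.ext_iff]
  simp


section PrimePowers

variable {D δ e : ℤ} (hδ : δ = 0 ∨ δ = 1) (hD : D = 4 * e + δ)
include hδ hD

theorem two_mul_add_sq_eq (r : ℤ) : (2 * r + δ) ^ 2 = 4 * (r ^ 2 + δ * r - e) + D := by
  rcases hδ with rfl | rfl <;> rw [hD] <;> ring

theorem prime_dvd_two_mul_add_iff {p : ℕ} (hp : p.Prime) {r : ℤ}
    (hr : (p : ℤ) ∣ r ^ 2 + δ * r - e) : (p : ℤ) ∣ 2 * r + δ ↔ (p : ℤ) ∣ D := by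
  have hp' : Prime (p : ℤ) := Nat.prime_iff_prime_int.mp hp
  rw [← hp'.dvd_pow_iff_dvd two_ne_zero, two_mul_add_sq_eq hδ hD]
  exact dvd_add_right (hr.mul_left 4)

/-- Hensel lifting: the derivative `2s + δ` at a root is prime to `p`, since its square is `D`
modulo `p`. -/
theorem exists_root_pow {p : ℕ} (hp : p.Prime) (hpD : ¬ (p : ℤ) ∣ D) {r : ℤ}
    (hr : (p : ℤ) ∣ r ^ 2 + δ * r - e) (j : ℕ) :
    ∃ s : ℤ, (p : ℤ) ^ (j + 1) ∣ s ^ 2 + δ * s - e := by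
  induction j with
  | zero => exact ⟨r, by simpa using hr⟩
  | succ j ih =>
    obtain ⟨s, u, hu⟩ := ih
    have hs : (p : ℤ) ∣ s ^ 2 + δ * s - e := (dvd_pow_self _ (by omega)).trans ⟨u, hu⟩
    have hco : IsCoprime (p : ℤ) (2 * s + δ) := by
      rw [(Nat.prime_iff_prime_int.mp hp).irreducible.coprime_iff_not_dvd,
        prime_dvd_two_mul_add_iff hδ hD hp hs]
      exact hpD
    obtain ⟨x, y, hxy⟩ := hco
    -- A Newton step: `y` is an inverse of the derivative `2s + δ` modulo `p`.
    refine ⟨s - (p : ℤ) ^ (j + 1) * (u * y), u * x + (p : ℤ) ^ j * (u * y) ^ 2, ?_⟩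
    linear_combination hu - (p : ℤ) ^ (j + 1) * u * hxy

/-- If `s` is a root, the polynomial at `x` is `(x - s)(x + δ + s)` modulo `p ^ j`. The two factors
differ by `2s + δ`, which is prime to `p`, so `p ^ j` divides one of them entirely. -/
theorem rootCount_prime_pow_of_root {p : ℕ} (hp : p.Prime) (hpD : ¬ (p : ℤ) ∣ D) {r : ℤ}
    (hr : (p : ℤ) ∣ r ^ 2 + δ * r - e) {j : ℕ} (hj : j ≠ 0) : rootCount δ e (p ^ j) = 2 := by
  classical
  obtain ⟨s, hs⟩ := exists_root_pow hδ hD hp hpD hr (j - 1)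
  rw [Nat.sub_add_cancel (Nat.one_le_iff_ne_zero.mpr hj)] at hs
  have hs1 : (p : ℤ) ∣ s ^ 2 + δ * s - e := (dvd_pow_self _ hj).trans hs
  have hnd : ¬ (p : ℤ) ∣ 2 * s + δ := (prime_dvd_two_mul_add_iff hδ hD hp hs1).not.mpr hpD
  have hp' : Prime (p : ℤ) := Nat.prime_iff_prime_int.mp hp
  have : NeZero (p ^ j) := ⟨pow_ne_zero j hp.ne_zero⟩
  have hcast (x : ℤ) : (x : ZMod (p ^ j)) = 0 ↔ (p : ℤ) ^ j ∣ x := by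
    rw [ZMod.intCast_zmod_eq_zero_iff_dvd]; push_cast; rfl
  have key (x : ZMod (p ^ j)) : x ^ 2 + δ * x - e = 0 ↔ x ∈ ({(s : ZMod (p ^ j)),
      ((-δ - s : ℤ) : ZMod (p ^ j))} : Finset (ZMod (p ^ j))) := by
    obtain ⟨x, rfl⟩ := ZMod.intCast_surjective x
    rw [Finset.mem_insert, Finset.mem_singleton, ← sub_eq_zero (a := (x : ZMod (p ^ j))),
      ← sub_eq_zero (a := (x : ZMod (p ^ j))) (b := ((-δ - s : ℤ) : ZMod (p ^ j)))]
    have h : (x : ZMod (p ^ j)) ^ 2 + δ * x - e = ((x ^ 2 + δ * x - e : ℤ) : ZMod (p ^ j)) := by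
      push_cast; ring
    rw [h, ← Int.cast_sub, ← Int.cast_sub, hcast, hcast, hcast,
      show x ^ 2 + δ * x - e = (x - s) * (x - (-δ - s)) + (s ^ 2 + δ * s - e) by ring,
      dvd_add_left hs]
    constructor
    · intro hd
      by_cases h1 : (p : ℤ) ∣ x - s
      · refine Or.inl (IsCoprime.dvd_of_dvd_mul_right ?_ hd)
        refine IsCoprime.pow_left (hp'.irreducible.coprime_iff_not_dvd.mpr fun h2 => hnd ?_)
        rw [show 2 * s + δ = x - (-δ - s) - (x - s) by ring]
        exact dvd_sub h2 h1
      · refine Or.inr (IsCoprime.dvd_of_dvd_mul_left ?_ hd)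
        exact IsCoprime.pow_left (hp'.irreducible.coprime_iff_not_dvd.mpr h1)
    · rintro (h | h)
      · exact h.mul_right _
      · exact h.mul_left _
  rw [rootCount_eq_natCard, Nat.card_eq_fintype_card, Fintype.card_of_subtype _ fun x => (key x).symm,
    Finset.card_pair]
  intro h
  rw [← sub_eq_zero, ← Int.cast_sub, hcast, show s - (-δ - s) = 2 * s + δ by ring] at h
  exact hnd ((dvd_pow_self _ hj).trans h)

theorem rootCount_prime_of_dvd {p : ℕ} (hp : p.Prime) (hpD : (p : ℤ) ∣ D) :
    rootCount δ e p = 1 := by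
  have : Fact p.Prime := ⟨hp⟩
  have hcast (x : ℤ) : (x : ZMod p) = 0 ↔ (p : ℤ) ∣ x := ZMod.intCast_zmod_eq_zero_iff_dvd _ _
  obtain ⟨r, hr⟩ : ∃ r : ℤ, (p : ℤ) ∣ r ^ 2 + δ * r - e := by
    rcases hp.eq_two_or_odd' with rfl | hodd
    · have hδ0 : δ = 0 := by push_cast at hpD; omega
      refine ⟨e, ?_⟩
      have := Int.even_mul_succ_self (e - 1)
      rw [even_iff_two_dvd] at this
      -- For `p = 2`, `D` even forces `δ = 0`, and `e` is a root because `e ^ 2 - e` is even.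
      rw [hδ0, show e ^ 2 + 0 * e - e = (e - 1) * (e - 1 + 1) by ring]
      exact_mod_cast this
    · have hco : IsCoprime (p : ℤ) 4 := by
        have : IsCoprime (p : ℤ) 2 := by exact_mod_cast hodd.coprime_two_right
        exact (this.mul_right this)
      have hco2 : IsCoprime (p : ℤ) 2 := by exact_mod_cast hodd.coprime_two_right
      obtain ⟨x, y, hxy⟩ := hco2
      -- Here `y` is an inverse of 2, so this is the double root `-δ / 2`.
      refine ⟨-δ * y, hco.dvd_of_dvd_mul_left ?_⟩
      have h1 : (p : ℤ) ∣ (2 * (-δ * y) + δ) ^ 2 :=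
        dvd_pow ⟨δ * x, by linear_combination -δ * hxy⟩ two_ne_zero
      rw [two_mul_add_sq_eq hδ hD] at h1
      exact (dvd_add_left hpD).mp h1
  rw [rootCount_eq_natCard, Nat.card_eq_one_iff_exists]
  refine ⟨⟨(r : ZMod p), ?_⟩, ?_⟩
  · rw [← hcast] at hr; push_cast at hr; exact hr
  · rintro ⟨x, hx⟩
    obtain ⟨x, rfl⟩ := ZMod.intCast_surjective x
    have hx' : (p : ℤ) ∣ x ^ 2 + δ * x - e := by rw [← hcast]; push_cast; exact hx
    have h1 := (prime_dvd_two_mul_add_iff hδ hD hp hr).mpr hpD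
    rw [Subtype.mk.injEq, ← sub_eq_zero, ← Int.cast_sub, hcast]
    have h2 : (p : ℤ) ∣ (x - r) * (x + r + δ) := by
      rw [show (x - r) * (x + r + δ) = x ^ 2 + δ * x - e - (r ^ 2 + δ * r - e) by ring]
      exact dvd_sub hx' hr
    rcases (Nat.prime_iff_prime_int.mp hp).dvd_or_dvd h2 with h | h
    · exact h
    · rw [show x - r = x + r + δ - (2 * r + δ) by ring]
      exact dvd_sub h h1

end PrimePowers

theorem rootCount_pow_eq_zero {δ e : ℤ} {p i j : ℕ} (hij : i ≤ j)
    (h : ∀ r : ℤ, ¬ (p : ℤ) ^ i ∣ r ^ 2 + δ * r - e) : rootCount δ e (p ^ j) = 0 := by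
  rw [rootCount, Finset.card_eq_zero, Finset.filter_eq_empty_iff]
  intro r _ hr
  refine h r ((pow_dvd_pow _ hij).trans ?_)
  exact_mod_cast hr

/-! ### Local factors and the Euler product for a fundamental discriminant -/

namespace IsFundamentalDiscriminant

variable {D : ℤ} (hD : IsFundamentalDiscriminant D)
include hD

theorem mod_four_eq_zero_or_one : D % 4 = 0 ∨ D % 4 = 1 := hD.mod_four

theorem kronecker_eq_zero_iff {p : ℕ} (hp : p.Prime) :
    kronecker D p = 0 ↔ (p : ℤ) ∣ D := by
  have hp1 : p.Coprime D.natAbs ↔ ¬ (p : ℤ) ∣ D := by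
    rw [hp.coprime_iff_not_dvd, Int.natCast_dvd]
  constructor
  · contrapose!
    intro h h0
    have hu : IsUnit (p : ZMod D.natAbs) := (ZMod.isUnit_iff_coprime _ _).mpr (hp1.mpr h)
    have := (hu.map (quadraticChar D hD)).ne_zero
    rw [quadraticChar_natCast, h0] at this
    simp at this
  · intro h
    exact kronecker_eq_zero hD.mod_four (mt hp1.mp (not_not.mpr h))

/-- For `p ∣ D`, a root modulo `p ^ 2` would give `p ^ 2 ∣ (2r + δ) ^ 2` and hence `p ^ 2 ∣ D`. Only
`p = 2` with `D = 4m` survives squarefreeness, and there `m` would be a square modulo 4, against `m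
≡ 2, 3`. -/
theorem not_sq_dvd {p : ℕ} (hp : p.Prime) (r : ℤ) :
    (p : ℤ) ∣ D → ¬ (p : ℤ) ^ 2 ∣ r ^ 2 + (D % 4) * r - D / 4 := by
  intro hpD h2
  have hD4 : D = 4 * (D / 4) + D % 4 := (Int.mul_ediv_add_emod D 4).symm
  have hp' : Prime (p : ℤ) := Nat.prime_iff_prime_int.mp hp
  have h1 := (prime_dvd_two_mul_add_iff hD.mod_four hD4 hp ((dvd_pow_self _ two_ne_zero).trans h2)).mpr hpD
  have h3 : (p : ℤ) ^ 2 ∣ D := by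
    have := pow_dvd_pow_of_dvd h1 2
    rw [two_mul_add_sq_eq hD.mod_four hD4] at this
    exact (dvd_add_right (h2.mul_left 4)).mp this
  rcases hD with ⟨h4, hsq⟩ | ⟨m, rfl, hm, hsq⟩
  · rw [pow_two] at h3
    exact hp'.not_isUnit (hsq _ h3)
  · rcases hp.eq_two_or_odd' with rfl | hodd
    · have hdiv : 4 * m / 4 = m := by omega
      have hmod : 4 * m % 4 = 0 := by omega
      rw [hdiv, hmod] at h2
      push_cast at h2
      obtain ⟨t, ht⟩ := h2
      unfold Int.ModEq at hm
      have : m % 4 = (r ^ 2) % 4 := by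
        rw [show m = r ^ 2 + 4 * (-t) by linarith]; omega
      have hr : r % 4 = 0 ∨ r % 4 = 1 ∨ r % 4 = 2 ∨ r % 4 = 3 := by omega
      rcases hr with hr | hr | hr | hr <;> simp [pow_two, Int.mul_emod, hr] at this <;> omega
    · have hco : IsCoprime (p : ℤ) 4 := by
        have : IsCoprime (p : ℤ) 2 := by exact_mod_cast hodd.coprime_two_right
        exact (this.mul_right this)
      have h5 : (p : ℤ) ^ 2 ∣ m := hco.pow_left.dvd_of_dvd_mul_left h3
      rw [pow_two] at h5
      exact hp'.not_isUnit (hsq _ h5)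

/-- For odd `p`, complete the square. For `p = 2`, `r (r + 1)` is even, so a root exists exactly
when `D / 4` is even, that is, `D ≡ 1` modulo 8. -/
theorem exists_root_iff {p : ℕ} (hp : p.Prime) (hpD : ¬ (p : ℤ) ∣ D) :
    (∃ r : ℤ, (p : ℤ) ∣ r ^ 2 + (D % 4) * r - D / 4) ↔ kronecker D p = 1 := by
  have hD4 : D = 4 * (D / 4) + D % 4 := (Int.mul_ediv_add_emod D 4).symm
  have : Fact p.Prime := ⟨hp⟩
  rcases hp.eq_two_or_odd' with rfl | hodd
  · have hmod : D % 4 = 1 := by have := hD.mod_four; push_cast at hpD; omega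
    have hk : kronecker D 2 = ZMod.χ₈ (D : ZMod 8) := by
      rw [kronecker, if_neg two_ne_zero, Nat.prime_two.factorization_self]
      simp
    rw [hk, ZMod.χ₈_int_eq_if_mod_eight, hmod]
    have hpar (r : ℤ) : (((2 : ℕ) : ℤ) ∣ r ^ 2 + 1 * r - D / 4) ↔ D % 8 = 1 := by
      have := Int.even_mul_succ_self r
      rw [even_iff_two_dvd] at this
      rw [show r ^ 2 + 1 * r - D / 4 = r * (r + 1) - D / 4 by ring]
      push_cast
      omega
    simp only [hpar, exists_const]
    have h2 : D % 2 = 1 := by omega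
    rcases (by omega : D % 8 = 1 ∨ D % 8 = 5) with h | h <;> simp [h, h2]
  · have hk : kronecker D p = legendreSym p D := by
      rw [kronecker, if_neg hp.ne_zero, Nat.factorization_eq_zero_of_not_dvd, pow_zero, pow_zero,
        one_mul, Nat.div_one, jacobiSym.legendreSym.to_jacobiSym]
      rw [← even_iff_two_dvd]; exact Nat.not_even_iff_odd.mpr hodd
    have hD0 : (D : ZMod p) ≠ 0 := by rwa [ne_eq, ZMod.intCast_zmod_eq_zero_iff_dvd]
    rw [hk, legendreSym.eq_one_iff p hD0]
    have hco2 : IsCoprime (p : ℤ) 2 := by exact_mod_cast hodd.coprime_two_right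
    constructor
    · rintro ⟨r, hr⟩
      refine ⟨((2 * r + D % 4 : ℤ) : ZMod p), ?_⟩
      rw [← Int.cast_mul, ← pow_two, two_mul_add_sq_eq hD.mod_four hD4 r, Int.cast_add, Int.cast_mul,
        (ZMod.intCast_zmod_eq_zero_iff_dvd _ p).mpr hr, mul_zero, zero_add]
    · rintro ⟨y, hy⟩
      obtain ⟨y, rfl⟩ := ZMod.intCast_surjective y
      obtain ⟨a, b, hab⟩ := hco2
      refine ⟨b * (y - D % 4), ?_⟩
      have h4 : IsCoprime (p : ℤ) 4 := by
        have : IsCoprime (p : ℤ) 2 := ⟨a, b, hab⟩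
        exact this.mul_right this
      refine h4.dvd_of_dvd_mul_left ?_
      rw [← dvd_add_left (c := D - y ^ 2), ← add_sub_assoc, ← two_mul_add_sq_eq hD.mod_four hD4]
      · refine ⟨-a * (y - D % 4) * (2 * (b * (y - D % 4)) + D % 4 + y), ?_⟩
        linear_combination (y - D % 4) * (2 * (b * (y - D % 4)) + D % 4 + y) * hab
      · rw [← ZMod.intCast_zmod_eq_zero_iff_dvd]
        push_cast
        rw [hy]; ring

/-- The local series is `1 + x` if `p` divides `D`, `1 + 2x + 2x ^ 2 + ⋯` if `χ_D(p) = 1`, and `1`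
if `χ_D(p) = -1`. -/
theorem hasSum_rootCount_prime_pow {p : ℕ} (hp : p.Prime) {x : ℂ} (hx : ‖x‖ < 1) :
    HasSum (fun j : ℕ => (rootCount (D % 4) (D / 4) (p ^ j) : ℂ) * x ^ j)
      ((1 - x)⁻¹ * (1 - kronecker D p * x)⁻¹ * (1 - x ^ 2)) := by
  have hD4 : D = 4 * (D / 4) + D % 4 := (Int.mul_ediv_add_emod D 4).symm
  have h1 : rootCount (D % 4) (D / 4) 1 = 1 := by simp [rootCount]
  have hx1 : 1 - x ≠ 0 := by
    intro h; rw [← sub_eq_zero.mp h] at hx; simp at hx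
  by_cases hpD : (p : ℤ) ∣ D
  · rw [(hD.kronecker_eq_zero_iff hp).mpr hpD]
    have : (1 - x)⁻¹ * (1 - ((0 : ℤ) : ℂ) * x)⁻¹ * (1 - x ^ 2) = ∑ j ∈ Finset.range 2,
        (rootCount (D % 4) (D / 4) (p ^ j) : ℂ) * x ^ j := by
      rw [Finset.sum_range_succ, Finset.sum_range_one, pow_zero, pow_one, h1,
        rootCount_prime_of_dvd hD.mod_four hD4 hp hpD]
      field_simp
      push_cast
      ring
    rw [this]
    refine hasSum_sum_of_ne_finset_zero fun j hj => ?_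
    rw [Finset.mem_range, not_lt] at hj
    rw [rootCount_pow_eq_zero hj fun r => hD.not_sq_dvd hp r hpD]
    simp
  · by_cases hr : ∃ r : ℤ, (p : ℤ) ∣ r ^ 2 + (D % 4) * r - D / 4
    · rw [(hD.exists_root_iff hp hpD).mp hr]
      obtain ⟨r, hr⟩ := hr
      have h2 : (1 - x)⁻¹ * (1 - ((1 : ℤ) : ℂ) * x)⁻¹ * (1 - x ^ 2) = 2 * (1 - x)⁻¹ - 1 := by
        push_cast; field_simp; ring
      rw [h2]
      convert! ((hasSum_geometric_of_norm_lt_one hx).mul_left 2).sub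
        (hasSum_ite_eq (0 : ℕ) (1 : ℂ)) using 1
      ext j
      rcases eq_or_ne j 0 with rfl | hj
      · rw [pow_zero, h1]; norm_num
      · rw [rootCount_prime_pow_of_root hD.mod_four hD4 hp hpD hr hj, if_neg hj]; norm_num
    · have hk : kronecker D p = -1 := by
        have h0 : kronecker D p ≠ 0 := (hD.kronecker_eq_zero_iff hp).not.mpr hpD
        have h1 : kronecker D p ≠ 1 := (hD.exists_root_iff hp hpD).not.mp hr
        have hsq : kronecker D p = 0 ∨ kronecker D p = 1 ∨ kronecker D p = -1 := by
          rw [kronecker, if_neg hp.ne_zero]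
          rcases jacobiSym.trichotomy D (p / 2 ^ p.factorization 2) with h | h | h <;>
          rcases ZMod.isQuadratic_χ₈ (D : ZMod 8) with h' | h' | h' <;> rw [h, h'] <;>
          rcases eq_or_ne (p.factorization 2) 0 with h'' | h'' <;>
          rcases neg_one_pow_eq_or ℤ (p.factorization 2) with h3 | h3 <;> simp [h'', h3]
        tauto
      have hx2 : 1 + x ≠ 0 := by
        intro h; rw [← neg_eq_iff_add_eq_zero.mpr h, norm_neg] at hx; simp at hx
      rw [hk]
      have h2 : (1 - x)⁻¹ * (1 - ((-1 : ℤ) : ℂ) * x)⁻¹ * (1 - x ^ 2) = 1 := by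
        push_cast
        rw [neg_one_mul, sub_neg_eq_add]
        field_simp; ring
      rw [h2]
      convert! hasSum_ite_eq (0 : ℕ) (1 : ℂ) using 1
      ext j
      rcases eq_or_ne j 0 with rfl | hj
      · rw [pow_zero, h1]; norm_num
      · rw [rootCount_pow_eq_zero (i := 1) (Nat.one_le_iff_ne_zero.mpr hj) fun r h => hr ⟨r, by simpa using h⟩,
          if_neg hj]
        norm_num

/-- The Euler products agree factor by factor, with `x = p ^ (-s)` in the local series; the factor
`1 - x ^ 2` is absorbed by `ζ(2s)`. -/
theorem tsum_rootCount_mul_zeta {s : ℕ} (hs : 2 ≤ s)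
    (hsum : Summable fun A : ℕ => (rootCount (D % 4) (D / 4) A : ℝ) / A ^ s) :
    ((∑' A : ℕ, (rootCount (D % 4) (D / 4) A : ℝ) / A ^ s : ℝ) : ℂ) * riemannZeta (2 * s) =
      riemannZeta s * quadraticL D hD s := by
  have : NeZero D.natAbs := ⟨hD.natAbs_ne_zero⟩
  have hs1 : 1 < (s : ℂ).re := by simp; omega
  have hs2 : 1 < (2 * s : ℂ).re := by simp; norm_cast; omega
  have hE := EulerProduct.eulerProduct_hasProd
    (f := fun A : ℕ => ((rootCount (D % 4) (D / 4) A : ℂ) / (A : ℂ) ^ s)) (by simp [rootCount])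
    (fun {m n} h => by
      rw [rootCount_mul _ _ h]; push_cast; rw [mul_pow, mul_div_mul_comm])
    (by simpa using hsum) (by simp [rootCount])
  have hZ2 := riemannZeta_eulerProduct_hasProd hs2
  have hZ := riemannZeta_eulerProduct_hasProd hs1
  have hL := DirichletCharacter.LSeries_eulerProduct_hasProd (quadraticChar D hD) hs1
  have hL' : quadraticL D hD s = LSeries (fun n : ℕ => quadraticChar D hD n) s :=
    DirichletCharacter.LFunction_eq_LSeries _ hs1
  rw [hL']
  have hsum' : ((∑' A : ℕ, (rootCount (D % 4) (D / 4) A : ℝ) / A ^ s : ℝ) : ℂ) =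
      ∑' A : ℕ, ((rootCount (D % 4) (D / 4) A : ℂ) / (A : ℂ) ^ s) := by
    push_cast; rfl
  rw [hsum']
  refine (hE.mul hZ2).unique ?_
  convert! hZ.mul hL using 1
  ext p
  have hp1 : (p.1 : ℂ) ≠ 0 := by exact_mod_cast p.2.ne_zero
  set x : ℂ := ((p.1 : ℂ) ^ s)⁻¹ with hx
  have e1 : (p.1 : ℂ) ^ (-(s : ℂ)) = x := by rw [Complex.cpow_neg, Complex.cpow_natCast]
  have e2 : (p.1 : ℂ) ^ (-(2 * s : ℂ)) = x ^ 2 := by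
    rw [Complex.cpow_neg, show (2 * s : ℂ) = ((s * 2 : ℕ) : ℂ) by push_cast; ring,
      Complex.cpow_natCast, pow_mul, hx, inv_pow]
  have hxn : ‖x‖ < 1 := by
    rw [hx, norm_inv, norm_pow, Complex.norm_natCast]
    exact inv_lt_one_of_one_lt₀ (one_lt_pow₀ (by exact_mod_cast p.2.one_lt) (by omega))
  have hx2 : 1 - x ^ 2 ≠ 0 := by
    intro h
    have : ‖x ^ 2‖ < 1 := by rw [norm_pow]; exact pow_lt_one₀ (norm_nonneg _) hxn two_ne_zero
    rw [← sub_eq_zero.mp h] at this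
    simp at this
  rw [e1, e2, quadraticChar_natCast]
  have hloc := (hD.hasSum_rootCount_prime_pow p.2 hxn).tsum_eq
  have : ∀ j : ℕ, ((rootCount (D % 4) (D / 4) (p.1 ^ j) : ℂ) / ((p.1 ^ j : ℕ) : ℂ) ^ s) =
      (rootCount (D % 4) (D / 4) (p.1 ^ j) : ℂ) * x ^ j := by
    intro j
    rw [hx, inv_pow, ← pow_mul, mul_comm s j, pow_mul, Nat.cast_pow, div_eq_mul_inv]
  simp only [this]
  rw [hloc, mul_assoc, mul_inv_cancel₀ hx2, mul_one]

end IsFundamentalDiscriminant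


/-! ### Reciprocity for quadratic Gauss sums -/

section Reciprocity

open Complex Filter Topology

theorem summable_exp_neg_mul_sq {δ : ℂ} (hδ : 0 < δ.re) :
    Summable fun n : ℤ => exp (-Real.pi * δ * n ^ 2) := by
  have h := (summable_jacobiTheta₂_term_iff 0 (I * δ)).mpr (by simpa using hδ)
  refine h.congr fun n => ?_
  rw [jacobiTheta₂_term]
  congr 1
  linear_combination (Real.pi * n ^ 2 * δ) * I_mul_I

/-- Dominated convergence: all terms except `n = 0` decay as the real part of `w` grows. -/
theorem tendsto_tsum_mul_exp {l : Filter ℝ} {w : ℝ → ℂ} (hw : Tendsto (fun t => (w t).re) l atTop)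
    {u : ℝ → ℤ → ℂ} (hu : ∀ t n, ‖u t n‖ = 1) (hu0 : ∀ t, u t 0 = 1) :
    Tendsto (fun t => ∑' n : ℤ, u t n * exp (-Real.pi * w t * n ^ 2)) l (𝓝 1) := by
  have hnorm (t : ℝ) (n : ℤ) : ‖u t n * exp (-Real.pi * w t * n ^ 2)‖ =
      Real.exp (-Real.pi * (w t).re * n ^ 2) := by
    rw [norm_mul, hu, one_mul, norm_exp]
    congr 1
    have : -Real.pi * w t * n ^ 2 = ((-Real.pi * n ^ 2 : ℝ) : ℂ) * w t := by push_cast; ring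
    rw [this, re_ofReal_mul]; ring
  have h := tendsto_tsum_of_dominated_convergence (𝓕 := l)
    (f := fun t (n : ℤ) => u t n * exp (-Real.pi * w t * n ^ 2))
    (g := fun n : ℤ => if n = 0 then 1 else 0)
    (bound := fun n : ℤ => Real.exp (-Real.pi * n ^ 2)) ?_ ?_ ?_
  · rwa [tsum_ite_eq] at h
  · have := (summable_exp_neg_mul_sq (δ := 1) (by simp)).norm
    refine this.congr fun n => ?_
    rw [norm_exp]
    congr 1
    have : -(Real.pi : ℂ) * 1 * n ^ 2 = ((-Real.pi * n ^ 2 : ℝ) : ℂ) := by push_cast; ring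
    rw [this, ofReal_re]
  · intro n
    split_ifs with hn
    · simpa [hn, hu0] using tendsto_const_nhds
    · rw [tendsto_zero_iff_norm_tendsto_zero]
      simp only [hnorm]
      refine Real.tendsto_exp_atBot.comp ?_
      have hc : -Real.pi * (n : ℝ) ^ 2 < 0 := by
        have : (0 : ℝ) < (n : ℝ) ^ 2 := by positivity
        nlinarith [Real.pi_pos]
      refine (hw.const_mul_atTop_of_neg hc).congr fun t => ?_
      ring
  · filter_upwards [hw.eventually_ge_atTop 1] with t ht n
    rw [hnorm]
    refine Real.exp_le_exp.mpr ?_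
    nlinarith [Real.pi_pos, mul_nonneg Real.pi_pos.le (sq_nonneg (n : ℝ))]

/-- Poisson summation on the residue class of `r` modulo `N`. -/
theorem tsum_exp_residue {δ : ℂ} (hδ : 0 < δ.re) {N : ℕ} (hN : N ≠ 0) (r : ℤ) :
    (δ * N ^ 2) ^ (1 / 2 : ℂ) * ∑' k : ℤ, exp (-Real.pi * δ * (k * N + r) ^ 2) =
      ∑' n : ℤ, exp (2 * Real.pi * I * (n * r / N)) *
        exp (-Real.pi * (1 / (δ * N ^ 2)) * n ^ 2) := by
  have hN' : (N : ℂ) ≠ 0 := by exact_mod_cast hN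
  have hδ0 : δ ≠ 0 := by rintro rfl; simp at hδ
  have hre : 0 < (δ * N ^ 2).re := by
    have : δ * N ^ 2 = ((N ^ 2 : ℝ) : ℂ) * δ := by push_cast; ring
    rw [this, re_ofReal_mul]; positivity
  have ha0 : δ * (N : ℂ) ^ 2 ≠ 0 := mul_ne_zero hδ0 (pow_ne_zero 2 hN')
  have h := tsum_exp_neg_quadratic hre (-δ * N * r)
  have h1 : ∀ k : ℤ, exp (-Real.pi * δ * (k * N + r) ^ 2) =
      exp (-Real.pi * δ * r ^ 2) *
        exp (-Real.pi * (δ * N ^ 2) * k ^ 2 + 2 * Real.pi * (-δ * N * r) * k) := by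
    intro k; rw [← exp_add]; congr 1; ring
  simp only [h1]
  rw [tsum_mul_left, h, mul_left_comm, ← mul_assoc (_ ^ (_ : ℂ)), mul_one_div_cancel, one_mul,
    ← tsum_mul_left]
  · refine tsum_congr fun n => ?_
    rw [← exp_add, ← exp_add]
    congr 1
    field_simp
    linear_combination (-(δ ^ 2) * N ^ 2 * r ^ 2) * I_sq
  · rw [ne_eq, cpow_eq_zero_iff]
    tauto

theorem tsum_eq_sum_tsum_residue {N : ℕ} (hN : N ≠ 0) {g : ℤ → ℂ} (hg : Summable g) :
    ∑' n, g n = ∑ r : Fin N, ∑' k : ℤ, g (k * N + (r : ℕ)) := by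
  have : NeZero N := ⟨hN⟩
  let e := (Equiv.prodComm (Fin N) ℤ).trans (Int.divModEquiv N).symm
  have hs : Summable fun p : Fin N × ℤ => g (e p) := (e.summable_iff).mpr hg
  calc ∑' n, g n = ∑' p, g (e p) := (e.tsum_eq g).symm
    _ = ∑' (r : Fin N) (k : ℤ), g (e (r, k)) := hs.tsum_prod
    _ = _ := tsum_fintype _

/-- Splitting into residue classes and applying Poisson summation to each, only the zero frequency
survives in the limit, with weight `f r`. The hypothesis on `Re (1/δ)` allows a limit in which `δ`
is not real. -/
theorem tendsto_tsum_periodic {N : ℕ} (hN : N ≠ 0) {f : ℤ → ℂ} (hf : ∀ k r, f (k * N + r) = f r)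
    {l : Filter ℝ} {δ : ℝ → ℂ} (h0 : ∀ᶠ t in l, 0 < (δ t).re)
    (h : Tendsto (fun t => (1 / δ t).re) l atTop) :
    Tendsto (fun t => (δ t * N ^ 2) ^ (1 / 2 : ℂ) * ∑' n : ℤ, f n * exp (-Real.pi * δ t * n ^ 2)) l
      (𝓝 (∑ r ∈ Finset.range N, f r)) := by
  have : NeZero N := ⟨hN⟩
  have hN' : (0 : ℝ) < N := by positivity
  have key : ∀ᶠ t in l, ∑ r : Fin N, f (r : ℕ) * ∑' n : ℤ, exp (2 * Real.pi * I * (n * (r : ℕ) / N)) *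
      exp (-Real.pi * (1 / (δ t * N ^ 2)) * n ^ 2) =
      (δ t * N ^ 2) ^ (1 / 2 : ℂ) * ∑' n : ℤ, f n * exp (-Real.pi * δ t * n ^ 2) := by
    filter_upwards [h0] with t ht
    have hb : ∃ C, ∀ n, ‖f n‖ ≤ C := by
      refine ⟨∑ r : Fin N, ‖f (r : ℕ)‖, fun n => ?_⟩
      have := (Int.divModEquiv N).symm_apply_apply n
      rw [← this]
      change ‖f (_ * (N : ℤ) + _)‖ ≤ _
      rw [hf]
      exact Finset.single_le_sum (f := fun r : Fin N => ‖f (r : ℕ)‖) (fun _ _ => norm_nonneg _)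
        (Finset.mem_univ _)
    obtain ⟨C, hC⟩ := hb
    obtain ⟨g, hg⟩ : ∃ g : ℤ → ℂ, ∀ n, g n = f n * exp (-Real.pi * δ t * n ^ 2) := ⟨_, fun _ => rfl⟩
    have hs : Summable g :=
      ((summable_exp_neg_mul_sq ht).norm.mul_left C).of_norm_bounded fun n => by
        rw [hg, norm_mul]; gcongr; exact hC n
    simp only [← hg]
    rw [tsum_eq_sum_tsum_residue hN hs, Finset.mul_sum]
    refine Finset.sum_congr rfl fun r _ => ?_
    have h1 := tsum_exp_residue ht hN (r : ℕ)
    simp only [hg, hf, tsum_mul_left]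
    rw [mul_left_comm]
    push_cast at h1 ⊢
    rw [h1]
  refine Tendsto.congr' key ?_
  rw [Finset.sum_range]
  refine tendsto_finsetSum _ fun r _ => ?_
  have := (tendsto_tsum_mul_exp (l := l) (w := fun t => 1 / (δ t * N ^ 2))
    (u := fun _ n => exp (2 * Real.pi * I * (n * (r : ℕ) / N))) ?_ ?_ ?_).const_mul (f (r : ℕ))
  · rwa [mul_one] at this
  · have hc : (0 : ℝ) < ((N : ℝ) ^ 2)⁻¹ := by positivity
    refine (h.const_mul_atTop hc).congr fun t => ?_
    rw [← re_ofReal_mul]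
    congr 1
    push_cast
    rw [one_div, one_div, mul_inv, mul_comm]
  · intro t n
    rw [show 2 * Real.pi * I * (n * (r : ℕ) / N) = ((2 * Real.pi * (n * (r : ℕ) / N) : ℝ) : ℂ) * I by
      push_cast; ring, norm_exp_ofReal_mul_I]
  · intro t; simp

/-- Principal square roots of numbers with positive real part have arguments in `(-π/4, π/4)`.
Positivity of the real part is what later fixes the sign of a square root known only through its
square. -/
theorem re_cpow_half_mul_cpow_half_pos {z w : ℂ} (hz : 0 < z.re) (hw : 0 < w.re) :
    0 < (z ^ (1 / 2 : ℂ) * w ^ (1 / 2 : ℂ)).re := by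
  have hz0 : z ≠ 0 := by rintro rfl; simp at hz
  have hw0 : w ≠ 0 := by rintro rfl; simp at hw
  rw [cpow_def_of_ne_zero hz0, cpow_def_of_ne_zero hw0, ← exp_add, exp_re]
  refine mul_pos (Real.exp_pos _) (Real.cos_pos_of_mem_Ioo ?_)
  have h1 := abs_lt.mp (abs_arg_lt_pi_div_two_iff.mpr (Or.inl hz))
  have h2 := abs_lt.mp (abs_arg_lt_pi_div_two_iff.mpr (Or.inl hw))
  have him : (log z * (1 / 2) + log w * (1 / 2)).im = (z.arg + w.arg) / 2 := by
    rw [show log z * (1 / 2) + log w * (1 / 2) = ((1 / 2 : ℝ) : ℂ) * (log z + log w) by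
      push_cast; ring, im_ofReal_mul, add_im, log_im, log_im]; ring
  rw [him]
  constructor <;> linarith [h1.1, h1.2, h2.1, h2.2]

/-- The Landsberg–Schaar reciprocity relation. -/
theorem landsberg_schaar {p q : ℕ} (hp : p ≠ 0) (hq : q ≠ 0) {ζ : ℂ} (hζ : 0 < ζ.re)
    (hζ2 : ζ ^ 2 = I * (p / (2 * q))) :
    ∑ n ∈ Finset.range p, exp (2 * Real.pi * I * (q * n ^ 2 / p)) =
      ζ * ∑ n ∈ Finset.range (2 * q), exp (-Real.pi * I * (p * n ^ 2 / (2 * q))) := by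
  have hp' : (p : ℂ) ≠ 0 := by exact_mod_cast hp
  have hq' : (q : ℂ) ≠ 0 := by exact_mod_cast hq
  have hpr : (0 : ℝ) < p := by positivity
  have hqr : (0 : ℝ) < q := by positivity
  set c : ℂ := p / (2 * q) with hc
  have hcr : c = ((p / (2 * q) : ℝ) : ℂ) := by rw [hc]; push_cast; rfl
  have hc0 : c ≠ 0 := by rw [hc]; exact div_ne_zero hp' (mul_ne_zero two_ne_zero hq')
  have hIc : (I * c).re = 0 := by rw [hcr, mul_comm, re_ofReal_mul, I_re, mul_zero]
  clear_value c
  let a : ℝ → ℂ := fun t => t + I * c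
  have hare (t : ℝ) : (a t).re = t := by simp only [a, add_re, ofReal_re, hIc, add_zero]
  -- The inversion formula for theta is compared on both sides as `a t = t + I c` tends to `I c`.
  -- Here `δ t = 1 / a t - 1 / (I c)` measures the approach of the inverted point to its limit, and
  -- the rational parts `I c` and `1 / (I c)` produce the periodic factors of the two Gauss sums.
  let δ : ℝ → ℂ := fun t => I * t / (c * a t)
  have hpos : ∀ᶠ t : ℝ in 𝓝[>] 0, 0 < t := eventually_mem_nhdsWithin
  have hδinv {t : ℝ} (ht : 0 < t) : 1 / δ t = ((p / (2 * q)) ^ 2 / t : ℝ) - I * c := by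
    have ht' : (t : ℂ) ≠ 0 := by exact_mod_cast ht.ne'
    have : (((p / (2 * q)) ^ 2 / t : ℝ) : ℂ) = c ^ 2 / t := by rw [hc]; push_cast; rfl
    rw [this]
    simp only [δ, a, one_div_div]
    field_simp
    linear_combination t * I_sq
  have hδinvre {t : ℝ} (ht : 0 < t) : (1 / δ t).re = (p / (2 * q)) ^ 2 / t := by
    rw [hδinv ht, sub_re, ofReal_re, hIc, sub_zero]
  have hδre {t : ℝ} (ht : 0 < t) : 0 < (δ t).re := by
    have h1 : 0 < (1 / δ t).re := by rw [hδinvre ht]; positivity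
    rw [one_div, inv_re] at h1
    by_contra! h
    exact absurd h1 (not_lt.mpr (div_nonpos_of_nonpos_of_nonneg h (normSq_nonneg _)))
  have htinv : Tendsto (fun t : ℝ => 1 / t) (𝓝[>] 0) atTop := by
    simpa using tendsto_inv_nhdsGT_zero (𝕜 := ℝ)
  have hL := tendsto_tsum_periodic (l := 𝓝[>] 0) (δ := δ) hp
    (f := fun n : ℤ => exp (2 * Real.pi * I * (q * n ^ 2 / p))) ?_ ?_ ?_
  rotate_left
  · intro k r
    rw [← exp_periodic.int_mul (q * (k ^ 2 * p + 2 * k * r)) (2 * Real.pi * I * (q * r ^ 2 / p))]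
    congr 1
    push_cast
    field_simp
    ring
  · exact hpos.mono fun t ht => hδre ht
  · have hcc : (0 : ℝ) < (p / (2 * q)) ^ 2 := by positivity
    refine (htinv.const_mul_atTop hcc).congr' (hpos.mono fun t ht => ?_)
    simp only [hδinvre ht]; ring
  have hR := tendsto_tsum_periodic (l := 𝓝[>] 0) (δ := fun t : ℝ => (t : ℂ)) (N := 2 * q) (by omega)
    (f := fun n : ℤ => exp (-Real.pi * I * (p * n ^ 2 / (2 * q)))) ?_ ?_ ?_
  rotate_left
  · intro k r
    rw [← exp_periodic.int_mul (-(p * (k ^ 2 * q + k * r))) (-Real.pi * I * (p * r ^ 2 / (2 * q)))]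
    congr 1
    push_cast
    field_simp
    ring
  · exact hpos.mono fun t ht => by simpa using ht
  · refine htinv.congr' (hpos.mono fun t ht => ?_)
    change 1 / t = (1 / (t : ℂ)).re
    rw [← ofReal_one, ← ofReal_div, ofReal_re]
  have heq : ∀ᶠ t : ℝ in 𝓝[>] 0,
      ζ * ((t * (2 * q : ℕ) ^ 2 : ℂ) ^ (1 / 2 : ℂ) * ∑' n : ℤ,
        exp (-Real.pi * I * (p * n ^ 2 / (2 * q))) * exp (-Real.pi * t * n ^ 2)) =
      (δ t * p ^ 2) ^ (1 / 2 : ℂ) * ∑' n : ℤ,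
        exp (2 * Real.pi * I * (q * n ^ 2 / p)) * exp (-Real.pi * δ t * n ^ 2) := by
    filter_upwards [hpos] with t ht
    have ht' : (t : ℂ) ≠ 0 := by exact_mod_cast ht.ne'
    have ha : 0 < (a t).re := by rwa [hare]
    have ha0 : a t ≠ 0 := by intro h; rw [h] at ha; simp at ha
    have hδ := hδre ht
    have hδ0 : δ t ≠ 0 := by intro h; rw [h] at hδ; simp at hδ
    have e1 : ∑' n : ℤ, exp (-Real.pi * I * (p * n ^ 2 / (2 * q))) * exp (-Real.pi * t * n ^ 2) =
        ∑' n : ℤ, exp (-Real.pi * a t * n ^ 2) := by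
      refine tsum_congr fun n => ?_
      rw [← exp_add]; congr 1; simp only [a, hc]; ring
    have e2 : ∑' n : ℤ, exp (2 * Real.pi * I * (q * n ^ 2 / p)) * exp (-Real.pi * δ t * n ^ 2) =
        ∑' n : ℤ, exp (-Real.pi / a t * n ^ 2) := by
      refine tsum_congr fun n => ?_
      rw [← exp_add]; congr 1
      have h1 : (q : ℂ) / p = 1 / (2 * c) := by rw [hc]; field_simp
      have h2 : (2 : ℂ) * Real.pi * I * (q * n ^ 2 / p) = Real.pi * I * n ^ 2 / c := by
        rw [mul_div_right_comm, h1]; field_simp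
      rw [h2]
      simp only [δ]
      field_simp
      simp only [a]
      linear_combination (c * n ^ 2) * I_sq
    rw [e1, e2, tsum_exp_neg_mul_int_sq ha, ← mul_assoc, ← mul_assoc]
    congr 1
    have hs : (t * (2 * q : ℕ) ^ 2 : ℂ) ^ (1 / 2 : ℂ) = ((t * (2 * q) ^ 2) ^ (1 / 2 : ℝ) : ℝ) := by
      rw [ofReal_cpow (by positivity)]
      push_cast
      rfl
    have hspos : 0 < (t * (2 * q) ^ 2 : ℝ) ^ (1 / 2 : ℝ) := by positivity
    have hsq (z : ℂ) : (z ^ (1 / 2 : ℂ)) ^ 2 = z := by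
      rw [← cpow_nat_mul]; norm_num
    have hacp : (a t) ^ (1 / 2 : ℂ) ≠ 0 := by rw [ne_eq, cpow_eq_zero_iff]; tauto
    set s : ℝ := (t * (2 * q) ^ 2 : ℝ) ^ (1 / 2 : ℝ)
    have hs0 : (s : ℂ) ≠ 0 := by exact_mod_cast hspos.ne'
    have hs2 : (s : ℂ) ^ 2 = t * (2 * q : ℕ) ^ 2 := by rw [← hs, hsq]
    rw [hs, mul_one_div, div_eq_iff hacp]
    have hre2 : 0 < (δ t * p ^ 2).re := by
      rw [show δ t * p ^ 2 = ((p ^ 2 : ℝ) : ℂ) * δ t by push_cast; ring, re_ofReal_mul]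
      positivity
    have hX := re_cpow_half_mul_cpow_half_pos hre2 ha
    have hY : 0 < (ζ * s).re := by rw [mul_comm, re_ofReal_mul]; positivity
    -- The two normalising factors have equal squares and both have positive real part, hence they
    -- agree.
    have hsqeq : (ζ * s) ^ 2 = ((δ t * p ^ 2) ^ (1 / 2 : ℂ) * (a t) ^ (1 / 2 : ℂ)) ^ 2 := by
      rw [mul_pow, mul_pow, hsq, hsq, hζ2, hs2]
      have h1 : δ t * a t = I * t / c := by simp only [δ]; field_simp
      rw [show δ t * p ^ 2 * a t = δ t * a t * p ^ 2 by ring, h1, hc]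
      push_cast
      field_simp
    rcases sq_eq_sq_iff_eq_or_eq_neg.mp hsqeq with h | h
    · exact h
    · rw [h, neg_re] at hY; linarith
  have hfin := tendsto_nhds_unique ((hR.const_mul ζ).congr' heq) hL
  push_cast at hfin ⊢
  exact hfin.symm

end Reciprocity

/-! ### The Gauss sum of a real quadratic character -/

section GaussSum

open Complex

/-- The quadratic Gauss sum `∑_{x mod N} exp (2 π i a x ^ 2 / N)`. -/
noncomputable def quadGauss (N : ℕ) [NeZero N] (a : ZMod N) : ℂ :=
  ∑ x : ZMod N, ZMod.stdAddChar (a * x ^ 2)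

theorem sum_zmod_eq_sum_range {N : ℕ} [NeZero N] (f : ZMod N → ℂ) :
    ∑ x : ZMod N, f x = ∑ n ∈ Finset.range N, f n := by
  rw [Finset.sum_range]
  refine Fintype.sum_equiv (ZMod.finEquiv N).symm.toEquiv _ _ fun x => ?_
  congr 1
  obtain ⟨N, rfl⟩ := Nat.exists_eq_succ_of_ne_zero (NeZero.ne N)
  exact (ZMod.natCast_zmod_val x).symm

theorem quadGauss_intCast (N : ℕ) [NeZero N] (a : ℤ) :
    quadGauss N (a : ZMod N) = ∑ n ∈ Finset.range N, exp (2 * Real.pi * I * (a * n ^ 2 / N)) := by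
  rw [quadGauss, sum_zmod_eq_sum_range]
  refine Finset.sum_congr rfl fun n _ => ?_
  have := ZMod.stdAddChar_coe (N := N) (a * n ^ 2)
  push_cast at this
  rw [this]
  congr 1
  ring

theorem conj_quadGauss (N : ℕ) [NeZero N] (a : ZMod N) :
    (starRingEnd ℂ) (quadGauss N a) = quadGauss N (-a) := by
  rw [quadGauss, quadGauss, map_sum]
  refine Finset.sum_congr rfl fun x _ => ?_
  rw [neg_mul, AddChar.map_neg_eq_inv, ZMod.stdAddChar_apply, ← Circle.coe_inv_eq_conj,
    Circle.coe_inv]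

/-- The number of square roots of `y` is `1 + (y / p)`, and the `1` sums to zero against a
nontrivial additive character; the rest is a character sum in which `y` can be rescaled by `m`. -/
theorem quadGauss_prime {p : ℕ} [Fact p.Prime] (hp : p ≠ 2) (m : ℤ) (hm : (m : ZMod p) ≠ 0) :
    quadGauss p m = J(m | p) * quadGauss p 1 := by
  have key (m : ℤ) (hm : (m : ZMod p) ≠ 0) : quadGauss p m =
      ∑ y : ZMod p, (_root_.quadraticChar (ZMod p) y : ℂ) * ZMod.stdAddChar ((m : ZMod p) * y) := by
    have h0 : ∑ y : ZMod p, (ZMod.stdAddChar ((m : ZMod p) * y) : ℂ) = 0 := by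
      have := AddChar.sum_mulShift (R := ZMod p) (R' := ℂ) (m : ZMod p)
        (ZMod.isPrimitive_stdAddChar p)
      rw [if_neg hm] at this
      simp only [mul_comm (m : ZMod p)]
      exact_mod_cast this
    rw [quadGauss, ← Finset.sum_fiberwise (s := Finset.univ) (g := fun x : ZMod p => x ^ 2)]
    rw [← add_zero (∑ y : ZMod p, _ * _), ← h0, ← Finset.sum_add_distrib]
    refine Finset.sum_congr rfl fun y _ => ?_
    rw [Finset.sum_congr rfl (g := fun _ => (ZMod.stdAddChar ((m : ZMod p) * y) : ℂ)),
      Finset.sum_const, nsmul_eq_mul, ← add_one_mul]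
    · congr 1
      have h := quadraticChar_card_sqrts (F := ZMod p) ((ZMod.ringChar_zmod_n p).substr hp) y
      have h' : ((Finset.univ.filter fun x : ZMod p => x ^ 2 = y).card : ℤ) =
          _root_.quadraticChar (ZMod p) y + 1 := by
        rw [← h]; congr 2; ext x; simp
      exact_mod_cast h'
    · intro x hx
      rw [(Finset.mem_filter.mp hx).2]
  have h1 := key 1 (by simp)
  rw [Int.cast_one] at h1
  rw [key m hm, h1, Finset.mul_sum, ← jacobiSym.legendreSym.to_jacobiSym, legendreSym]
  have hsq : (_root_.quadraticChar (ZMod p) (m : ZMod p) : ℂ) * _root_.quadraticChar (ZMod p) (m : ZMod p) = 1 := by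
    have := quadraticChar_sq_one hm
    rw [pow_two] at this
    exact_mod_cast this
  refine Fintype.sum_equiv (Equiv.mulLeft₀ (m : ZMod p) hm) _ _ fun y => ?_
  rw [show Equiv.mulLeft₀ (m : ZMod p) hm y = m * y from rfl, map_mul (_root_.quadraticChar (ZMod p)), one_mul, Int.cast_mul, ← mul_assoc, ← mul_assoc, hsq, one_mul]

theorem exp_neg_pi_I_half_mul_odd {p : ℕ} (hp : p % 2 = 1) :
    exp (-Real.pi * I * (p / 2)) = if p % 4 = 1 then -I else I := by
  have hq : exp (-Real.pi * I / 2) = -I := by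
    rw [show -(Real.pi : ℂ) * I / 2 = -(Real.pi / 2 * I) by ring, exp_neg, exp_pi_div_two_mul_I, inv_I]
  have : exp (-Real.pi * I * (p / 2)) = (-I) ^ p := by
    rw [← hq, ← exp_nat_mul]; congr 1; ring
  rw [this]
  have h4 : (-I) ^ 4 = 1 := by rw [neg_pow, I_pow_four]; norm_num
  conv_lhs => rw [← Nat.div_add_mod p 4, pow_add, pow_mul, h4, one_pow, one_mul]
  split_ifs with h
  · rw [h, pow_one]
  · rw [show p % 4 = 3 by omega]
    rw [neg_pow, I_pow_three]; norm_num

theorem landsberg_schaar' {p q : ℕ} (hp : p ≠ 0) (hq : q ≠ 0) :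
    ∑ n ∈ Finset.range p, exp (2 * Real.pi * I * (q * n ^ 2 / p)) =
      (√(p / q) : ℝ) * (1 + I) / 2 *
        ∑ n ∈ Finset.range (2 * q), exp (-Real.pi * I * (p * n ^ 2 / (2 * q))) := by
  have hq' : (q : ℂ) ≠ 0 := by exact_mod_cast hq
  refine landsberg_schaar hp hq ?_ ?_
  · rw [mul_div_assoc, re_ofReal_mul]
    have : (0 : ℝ) < √(p / q) := Real.sqrt_pos.mpr (by positivity)
    have h2 : ((1 + I) / 2).re = 1 / 2 := by
      rw [show ((1 + I) / 2 : ℂ) = ((1 / 2 : ℝ) : ℂ) * (1 + I) by push_cast; ring, re_ofReal_mul]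
      simp
    rw [h2]; positivity
  · rw [div_pow, mul_pow, ← ofReal_pow, Real.sq_sqrt (by positivity)]
    push_cast
    field_simp
    linear_combination I_sq

/-- Reciprocity with `q = 1` leaves a dual sum of two terms, which determines the sign of the Gauss
sum. -/
theorem quadGauss_prime_one {p : ℕ} [NeZero p] (hp : p % 2 = 1) :
    quadGauss p 1 = √p * (if p % 4 = 1 then 1 else I) := by
  have h := quadGauss_intCast p 1
  have hLS := landsberg_schaar' (NeZero.ne p) one_ne_zero
  push_cast at h hLS
  rw [h, hLS]
  have : ∑ n ∈ Finset.range (2 * 1), exp (-Real.pi * I * (p * n ^ 2 / (2 * 1))) =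
      1 + exp (-Real.pi * I * (p / 2)) := by
    simp [Finset.sum_range_succ]
  rw [this, exp_neg_pi_I_half_mul_odd hp, div_one]
  split_ifs
  · linear_combination (-(√p : ℂ) / 2) * I_sq
  · linear_combination ((√p : ℂ) / 2) * I_sq

variable {D : ℤ}

theorem sum_range_two_mul (h : ℕ → ℂ) (p : ℕ) :
    ∑ n ∈ Finset.range (2 * p), h n = ∑ j ∈ Finset.range p, (h (2 * j) + h (2 * j + 1)) := by
  induction p with
  | zero => simp
  | succ p ih =>
    rw [mul_add, mul_one, Finset.sum_range_succ, Finset.sum_range_succ, Finset.sum_range_succ, ih]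
    ring

/-- This is the dual side of reciprocity for a Gauss sum modulo `D`. Even `n = 2j` give a Gauss sum
modulo `p`; odd `n` give the same sum times a fourth root of unity. -/
theorem sum_exp_odd_prime {D : ℕ} {p : ℕ} [Fact p.Prime] (hp : p ≠ 2) (hD : D % 4 = 0 ∨ D % 4 = 1) :
    ∑ n ∈ Finset.range (2 * p), exp (-Real.pi * I * (D * n ^ 2 / (2 * p))) =
      (1 + (if D % 4 = 0 then 1 else if p % 4 = 1 then -I else I)) *
        quadGauss p ((-D : ℤ) : ZMod p) := by
  have hodd := (Fact.out : p.Prime).eq_two_or_odd.resolve_left hp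
  have hp0 : (p : ℂ) ≠ 0 := by exact_mod_cast (Fact.out : p.Prime).ne_zero
  obtain ⟨r, hr⟩ : ∃ r : ℕ, p = 2 * r + 1 := ⟨p / 2, by omega⟩
  rw [sum_range_two_mul, Finset.sum_add_distrib, add_mul, one_mul]
  congr 1
  · rw [quadGauss_intCast]
    refine Finset.sum_congr rfl fun j _ => ?_
    congr 1
    push_cast
    field_simp
  · have hshift : quadGauss p ((-D : ℤ) : ZMod p) =
        ∑ x : ZMod p, ZMod.stdAddChar (((-D : ℤ) : ZMod p) * (x - (r : ZMod p)) ^ 2) :=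
      (Fintype.sum_equiv (Equiv.subRight (r : ZMod p)) _ _ fun x => rfl).symm
    rw [hshift, sum_zmod_eq_sum_range, Finset.mul_sum]
    refine Finset.sum_congr rfl fun j _ => ?_
    have h1 := ZMod.stdAddChar_coe (N := p) (-D * (j - r) ^ 2)
    push_cast at h1 ⊢
    rw [h1]
    -- With `p = 2r + 1`, `2j + 1 = 2(j - r) + p`; expanding the square, the cross term is an
    -- integer multiple of `2πi`.
    have h2 : exp (-Real.pi * I * (D * (2 * j + 1) ^ 2 / (2 * p))) =
        exp (-Real.pi * I * (p / 2)) ^ D *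
          exp (2 * Real.pi * I * (-D * (j - r) ^ 2) / p) := by
      rw [← exp_nat_mul, ← exp_add,
        ← exp_periodic.int_mul (-(D * (j - r))) (_ + _)]
      congr 1
      have hrc : (r : ℂ) = (p - 1) / 2 := by rw [hr]; push_cast; ring
      push_cast
      rw [hrc]
      field_simp
      ring
    rw [h2, exp_neg_pi_I_half_mul_odd hodd]
    congr 1
    have h4 : (if p % 4 = 1 then -I else I) ^ 4 = 1 := by
      split_ifs
      · rw [neg_pow, I_pow_four]; norm_num
      · exact I_pow_four
    conv_lhs => rw [← Nat.div_add_mod D 4, pow_add, pow_mul, h4, one_pow, one_mul]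
    rcases hD with h | h
    · rw [h, pow_zero, if_pos rfl]
    · rw [h, pow_one, if_neg one_ne_zero]

/-- Reciprocity turns the sum modulo `D` into one modulo `p`, whose value, including its sign, is
known. -/
theorem quadGauss_natCast_prime {D : ℕ} [NeZero D] (hD : D % 4 = 0 ∨ D % 4 = 1) {p : ℕ}
    [Fact p.Prime] (hp : p ≠ 2) (hpD : ¬ p ∣ D) :
    quadGauss D (p : ZMod D) =
      √D * J(D | p) * (if D % 4 = 0 then (if p % 4 = 1 then 1 + I else 1 - I) else 1) := by
  have hodd := (Fact.out : p.Prime).eq_two_or_odd.resolve_left hp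
  have hp0 := (Fact.out : p.Prime).ne_zero
  have h := quadGauss_intCast D p
  have hLS := landsberg_schaar' (NeZero.ne D) hp0
  have hm : ((-D : ℤ) : ZMod p) ≠ 0 := by
    rw [ne_eq, ZMod.intCast_zmod_eq_zero_iff_dvd, dvd_neg]
    exact_mod_cast hpD
  have hJ : J(-D | p) = (if p % 4 = 1 then 1 else -1) * J(D | p) := by
    rw [jacobiSym.neg _ (Nat.odd_iff.mpr hodd)]
    split_ifs with h4
    · rw [ZMod.χ₄_nat_one_mod_four h4]
    · rw [ZMod.χ₄_nat_three_mod_four (by omega)]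
  push_cast at h
  rw [h, hLS, sum_exp_odd_prime hp hD, quadGauss_prime hp _ hm, hJ, quadGauss_prime_one hodd]
  have hs : ((√(D / p : ℝ) : ℝ) : ℂ) * (√(p : ℝ) : ℝ) = (√(D : ℝ) : ℝ) := by
    rw [← ofReal_mul, ← Real.sqrt_mul (by positivity), div_mul_cancel₀]
    exact_mod_cast hp0
  rw [← hs]
  push_cast
  generalize (J(D | p) : ℂ) = j
  generalize ((√(D / p : ℝ) : ℝ) : ℂ) = u
  generalize ((√(p : ℝ) : ℝ) : ℂ) = v
  split_ifs
  · ring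
  · linear_combination (-u * v * j) * I_sq
  · linear_combination (-u * v * j / 2) * I_sq
  · linear_combination (-u * v * j - u * v * j * I / 2) * I_sq

/-- By Dirichlet's theorem the unit `a` is the class of a large prime `p`. The symbol `(D / p)` then
appears squared, and the remaining factor `1` or `1 ± I` has real part 1. Taking real parts treats
odd and even `D` uniformly. -/
theorem re_quadraticChar_mul_quadGauss (hD : IsFundamentalDiscriminant D) (hD0 : 0 < D)
    [NeZero D.natAbs] {a : ZMod D.natAbs} (ha : IsUnit a) :
    (quadraticChar D hD a * quadGauss D.natAbs a).re = √D := by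
  obtain ⟨p, hpgt, hp, rfl⟩ := Nat.forall_exists_prime_gt_and_eq_mod ha (D.natAbs + 2)
  have : Fact p.Prime := ⟨hp⟩
  have hp2 : p ≠ 2 := by omega
  have hpD : ¬ p ∣ D.natAbs := fun h => absurd (Nat.le_of_dvd (by omega) h) (by omega)
  have hodd := hp.eq_two_or_odd.resolve_left hp2
  obtain ⟨N, rfl⟩ := Int.eq_ofNat_of_zero_le hD0.le
  have : NeZero N := ⟨by rintro rfl; simp at hD0⟩
  rw [quadraticChar_natCast, Int.cast_natCast]
  change ((kronecker N p : ℂ) * quadGauss N p).re = √(N : ℝ)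
  rw [Int.natAbs_natCast] at hpD
  have hmod := hD.mod_four
  have hk : kronecker N p = J(N | p) := by
    rw [kronecker, if_neg hp.ne_zero, Nat.factorization_eq_zero_of_not_dvd (by omega)]
    simp
  have hsq : (J(N | p) : ℂ) * J(N | p) = 1 := by
    have : J(N | p) ^ 2 = 1 := jacobiSym.sq_one (by
      rw [Int.gcd_natCast_natCast]
      exact ((Nat.Prime.coprime_iff_not_dvd hp).mpr hpD).symm)
    rw [pow_two] at this
    exact_mod_cast this
  rw [quadGauss_natCast_prime (by omega) hp2 hpD, hk,
    show ∀ x s k : ℂ, x * (s * x * k) = s * (x * x * k) by intros; ring, hsq, one_mul, re_ofReal_mul]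
  split_ifs <;> simp

end GaussSum

/-! ### Primitivity of `χ_D`, the sign of its Gauss sum, and the functional equation -/

section GaussSum

open Complex

variable {D : ℤ}

theorem exists_jacobiSym_eq_neg_one {p m : ℕ} (hp : p.Prime) (hp2 : p ≠ 2) (hpm : p.Coprime m) :
    ∃ u : ℕ, u ≡ 1 [MOD m] ∧ J(u | p) = -1 := by
  have : Fact p.Prime := ⟨hp⟩
  obtain ⟨a, ha⟩ := quadraticChar_exists_neg_one (F := ZMod p) ((ZMod.ringChar_zmod_n p).substr hp2)
  obtain ⟨u, hu1, hu2⟩ := Nat.chineseRemainder hpm a.val 1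
  refine ⟨u, hu2, ?_⟩
  rw [← jacobiSym.legendreSym.to_jacobiSym, legendreSym, Int.cast_natCast,
    (ZMod.natCast_eq_natCast_iff _ _ _).mpr hu1, ZMod.natCast_zmod_val, ha]

/-- This is primitivity at each prime: `χ_D` does not factor through `D / p`. For odd `p`, take a
nonresidue modulo `p` that is 1 modulo the rest of `D`, and use reciprocity. -/
theorem exists_kronecker_eq_neg_one (hD : IsFundamentalDiscriminant D) (hD0 : 0 < D) {p : ℕ}
    (hp : p.Prime) (hpD : p ∣ D.natAbs) :
    ∃ u : ℕ, u ≡ 1 [MOD D.natAbs / p] ∧ kronecker D u = -1 := by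
  obtain ⟨N, rfl⟩ := Int.eq_ofNat_of_zero_le hD0.le
  rw [Int.natAbs_natCast] at *
  have hcop {M k : ℕ} (hM : Squarefree M) (h : M = p * k) : p.Coprime k :=
    Nat.coprime_of_squarefree_mul (h ▸ hM)
  rcases hD with ⟨h4, hsq⟩ | ⟨m, hm, hm4, hsq⟩
  · unfold Int.ModEq at h4
    obtain ⟨k, hk⟩ := hpD
    have hp2 : p ≠ 2 := by rintro rfl; omega
    obtain ⟨u, hu1, hu2⟩ := exists_jacobiSym_eq_neg_one hp hp2
      (hcop (Int.squarefree_natCast.mp hsq) hk)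
    have hkd : N / p = k := by rw [hk, Nat.mul_div_cancel_left _ hp.pos]
    refine ⟨u, by rwa [hkd], ?_⟩
    have hN : N ≠ 0 := by omega
    have hk0 : k ≠ 0 := by rintro rfl; omega
    rw [kronecker_of_one_mod_four (by omega), Int.natAbs_natCast, hk,
      jacobiSym.mul_right' _ hp.ne_zero hk0, hu2]
    have : J(u | k) = 1 := by
      rw [jacobiSym.mod_left, (Int.natCast_modEq_iff.mpr hu1 : (u : ℤ) % k = (1 : ℕ) % k),
        ← jacobiSym.mod_left, Nat.cast_one, jacobiSym.one_left]
    rw [this]; rfl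
  · obtain ⟨m, rfl⟩ := Int.eq_ofNat_of_zero_le (show 0 ≤ m by omega)
    have hsq' : Squarefree m := Int.squarefree_natCast.mp hsq
    have hm' : N = 4 * m := by exact_mod_cast hm
    unfold Int.ModEq at hm4
    have key {u : ℕ} (hu : Odd u) : kronecker N u = J(m | u) := by
      rw [kronecker_of_four_mul hm, if_pos hu]
    rcases eq_or_ne p 2 with rfl | hp2
    -- For `p = 2` the witness is `1 + D / 2`. If `m = 2k` with `k` odd it is `5` modulo 8, and the
    -- symbol `(2 / ·)` contributes `-1`; if `m ≡ 3` modulo 4 it is `3` modulo 4, and the sign comes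
    -- from reciprocity.
    · refine ⟨1 + 2 * m, ?_, ?_⟩
      · rw [show N / 2 = 2 * m by omega]
        simp [Nat.ModEq]
      · rw [key ⟨m, by ring⟩]
        rcases hm4 with h | h
        · obtain ⟨k, rfl⟩ : ∃ k, m = 2 * k := ⟨m / 2, by omega⟩
          have hodd : Odd (1 + 2 * (2 * k)) := ⟨2 * k, by ring⟩
          have hk : Odd k := Nat.odd_iff.mpr (by omega)
          have h1 : J(k | 1 + 2 * (2 * k)) = 1 := by
            rw [← jacobiSym.quadratic_reciprocity_one_mod_four (a := 1 + 2 * (2 * k)) (by omega) hk,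
              jacobiSym.mod_left]
            have : ((1 + 2 * (2 * k) : ℕ) : ℤ) % k = 1 % k := by
              push_cast
              rw [show (1 + 2 * (2 * k) : ℤ) = 1 + k * 4 by ring, Int.add_mul_emod_self_left]
            rw [this, ← jacobiSym.mod_left, jacobiSym.one_left]
          push_cast
          rw [jacobiSym.mul_left, h1, mul_one, jacobiSym.at_two hodd]
          obtain ⟨j, hj⟩ := hk
          have : ((1 + 2 * (2 * k) : ℕ) : ZMod 8) = 5 := by
            have : 1 + 2 * (2 * k) = 8 * j + 5 := by omega
            rw [this]; push_cast
            rw [show (8 : ZMod 8) = 0 from rfl]; ring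
          rw [this]; decide
        · rw [jacobiSym.quadratic_reciprocity_three_mod_four (by omega) (by omega),
            jacobiSym.mod_left]
          have : ((1 + 2 * m : ℕ) : ℤ) % m = 1 % m := by
            push_cast
            rw [show (1 + 2 * m : ℤ) = 1 + m * 2 by ring, Int.add_mul_emod_self_left]
          rw [this, ← jacobiSym.mod_left, jacobiSym.one_left]
    · have hpodd := hp.eq_two_or_odd.resolve_left hp2
      have hpm : p ∣ m := by
        rw [hm'] at hpD
        refine (Nat.Coprime.dvd_mul_left ?_).mp hpD
        exact Nat.Coprime.pow_right 2 ((Nat.coprime_primes hp Nat.prime_two).mpr hp2)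
      obtain ⟨k, hk⟩ := hpm
      have hk0 : k ≠ 0 := by rintro rfl; omega
      have hc8 : p.Coprime 8 := Nat.Coprime.pow_right 3 ((Nat.coprime_primes hp Nat.prime_two).mpr hp2)
      obtain ⟨u, hu1, hu2⟩ := exists_jacobiSym_eq_neg_one hp hp2 (hc8.mul_right (hcop hsq' hk))
      have hkd : N / p = 4 * k := by
        rw [hm', hk, show 4 * (p * k) = p * (4 * k) by ring, Nat.mul_div_cancel_left _ hp.pos]
      have hu8 : u ≡ 1 [MOD 8] := hu1.of_dvd (Dvd.intro _ rfl)
      have hu4k : u ≡ 1 [MOD 4 * k] := hu1.of_dvd ⟨2, by ring⟩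
      have hodd : Odd u := Nat.odd_iff.mpr (by unfold Nat.ModEq at hu8; omega)
      refine ⟨u, by rwa [hkd], ?_⟩
      have hJ1 : J((k : ℤ) | u) = 1 := by
        have h1 := jacobiSym.mod_right k odd_one
        rw [Int.natAbs_natCast, jacobiSym.one_right] at h1
        rw [jacobiSym.mod_right _ hodd, Int.natAbs_natCast, hu4k, ← h1]
      rw [key hodd, hk]
      push_cast
      rw [jacobiSym.mul_left, ← jacobiSym.quadratic_reciprocity_one_mod_four
        (by unfold Nat.ModEq at hu8; omega) (Nat.odd_iff.mpr hpodd), hu2,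
        hJ1]
      rfl

/-- A proper conductor divides `D / p` for some prime `p`; the character would then be trivial on
residues that are `1` modulo `D / p`. -/
theorem quadraticChar_isPrimitive (hD : IsFundamentalDiscriminant D) (hD0 : 0 < D) :
    (quadraticChar D hD).IsPrimitive := by
  have : NeZero D.natAbs := ⟨hD.natAbs_ne_zero⟩
  by_contra h
  rw [DirichletCharacter.isPrimitive_def] at h
  set c := (quadraticChar D hD).conductor
  obtain ⟨k, hk⟩ : c ∣ D.natAbs := DirichletCharacter.conductor_dvd_level _
  have hk1 : k ≠ 1 := by rintro rfl; rw [mul_one] at hk; exact h hk.symm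
  obtain ⟨p, hp, j, rfl⟩ := Nat.exists_prime_and_dvd hk1
  obtain ⟨u, hu, hk⟩ := exists_kronecker_eq_neg_one hD hD0 hp ⟨c * j, by rw [hk]; ring⟩
  have hval : quadraticChar D hD (u : ZMod D.natAbs) = -1 := by
    rw [quadraticChar_natCast, hk]; norm_num
  have hunit : IsUnit (u : ZMod D.natAbs) := by
    by_contra hn
    rw [MulChar.map_nonunit _ hn] at hval
    norm_num at hval
  have hcd : c ∣ D.natAbs := ⟨_, by assumption⟩
  have hf := (DirichletCharacter.factorsThrough_iff_ker_unitsMap hcd).mp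
    (DirichletCharacter.factorsThrough_conductor _)
  have hker : hunit.unit ∈ (ZMod.unitsMap hcd).ker := by
    rw [MonoidHom.mem_ker]
    ext
    rw [ZMod.unitsMap_val, IsUnit.unit_spec, ZMod.cast_natCast hcd, Units.val_one]
    have : u ≡ 1 [MOD c] := hu.of_dvd (Nat.dvd_div_of_mul_dvd ⟨j, by rw [‹D.natAbs = _›]; ring⟩)
    have := (ZMod.natCast_eq_natCast_iff _ _ _).mpr this
    rwa [Nat.cast_one] at this
  have h1 := hf hker
  rw [MonoidHom.mem_ker] at h1
  have h2 := congrArg Units.val h1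
  rw [MulChar.coe_toUnitHom, IsUnit.unit_spec, hval, Units.val_one] at h2
  norm_num at h2

theorem quadraticChar_sq (hD : IsFundamentalDiscriminant D) {a : ZMod D.natAbs} (ha : IsUnit a) :
    quadraticChar D hD a ^ 2 = 1 := by
  have h0 : quadraticChar D hD a ≠ 0 := (ha.map (quadraticChar D hD)).ne_zero
  have : NeZero D.natAbs := ⟨hD.natAbs_ne_zero⟩
  rw [← ZMod.natCast_zmod_val a, quadraticChar_natCast] at h0 ⊢
  have hJ : ∀ (m : ℤ) (n : ℕ), J(m | n) = 0 ∨ J(m | n) ^ 2 = 1 := fun m n => by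
    rcases jacobiSym.trichotomy m n with h | h | h <;> simp [h]
  have hk : kronecker D a.val ^ 2 = 1 := by
    have h0' : kronecker D a.val ≠ 0 := by exact_mod_cast h0
    rcases hD.mod_four with h | h
    · obtain ⟨m, hm⟩ := Int.dvd_of_emod_eq_zero h
      rw [kronecker_of_four_mul hm] at h0' ⊢
      split_ifs at h0' ⊢ with h
      · exact (hJ _ _).resolve_left h0'
      · exact absurd rfl h0'
    · rw [kronecker_of_one_mod_four h] at h0' ⊢
      exact (hJ _ _).resolve_left h0'
  exact_mod_cast hk

theorem quadraticChar_inv (hD : IsFundamentalDiscriminant D) :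
    (quadraticChar D hD)⁻¹ = quadraticChar D hD := by
  rw [inv_eq_iff_mul_eq_one]
  ext a
  rw [MulChar.mul_apply, ← pow_two, quadraticChar_sq hD a.isUnit, MulChar.one_apply a.isUnit]

/-- The quadratic Gauss sums at `1` and `-1` are conjugate and so have the same real part; `χ_D(-1)
= -1` would give `√D = -√D`. -/
theorem quadraticChar_neg_one (hD : IsFundamentalDiscriminant D) (hD0 : 0 < D) :
    quadraticChar D hD (-1) = 1 := by
  have : NeZero D.natAbs := ⟨hD.natAbs_ne_zero⟩
  have h1 := re_quadraticChar_mul_quadGauss hD hD0 isUnit_one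
  have h2 := re_quadraticChar_mul_quadGauss hD hD0 isUnit_one.neg
  rw [map_one, one_mul] at h1
  rcases mul_self_eq_one_iff.mp ((pow_two _).symm.trans (quadraticChar_sq hD (a := -1) isUnit_one.neg)) with h | h
  · exact h
  · rw [h, neg_one_mul, neg_re, ← conj_quadGauss, conj_re, h1] at h2
    have : 0 < √(D : ℝ) := Real.sqrt_pos.mpr (by exact_mod_cast hD0)
    linarith

/-- The Gauss sum `τ` is real because `χ_D` is real and even. Summing `χ_D(a)` times the quadratic
Gauss sum at `a` over all `a` gives `φ(D) τ` when the inner sum is over `a`, and has real part `φ(D)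
√D` by the evaluation at units. -/
theorem gaussSum_quadraticChar (hD : IsFundamentalDiscriminant D) (hD0 : 0 < D)
    [NeZero D.natAbs] :
    gaussSum (quadraticChar D hD) ZMod.stdAddChar = √D := by
  set χ := quadraticChar D hD with hχ
  set τ := gaussSum χ ZMod.stdAddChar with hτ
  have hinv : χ⁻¹ = χ := quadraticChar_inv hD
  have hprim : χ.IsPrimitive := quadraticChar_isPrimitive hD hD0
  have hreal : (starRingEnd ℂ) τ = τ := by
    have h1 := gaussSum_mulShift_of_isPrimitive (ZMod.stdAddChar (N := D.natAbs)) hprim (-1)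
    rw [hinv, hχ, quadraticChar_neg_one hD hD0, one_mul] at h1
    refine Eq.trans ?_ h1
    simp only [hτ, gaussSum, map_sum]
    refine Finset.sum_congr rfl fun a _ => ?_
    rw [map_mul, AddChar.mulShift_apply, neg_one_mul, AddChar.map_neg_eq_inv, ZMod.stdAddChar_apply,
      ← Circle.coe_inv_eq_conj, Circle.coe_inv, ← ZMod.natCast_zmod_val a, hχ,
      quadraticChar_natCast, map_intCast]
  set n := (Finset.univ.filter fun a : ZMod D.natAbs => IsUnit a).card with hn
  have hn0 : (n : ℝ) ≠ 0 := by
    have : 0 < n := Finset.card_pos.mpr ⟨1, by simp⟩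
    positivity
  have hsum : ∑ a : ZMod D.natAbs, χ a * quadGauss D.natAbs a = n * τ := by
    have h1 (x : ZMod D.natAbs) : ∑ a : ZMod D.natAbs, χ a * ZMod.stdAddChar (a * x ^ 2) =
        if IsUnit x then τ else 0 := by
      have h2 := gaussSum_mulShift_of_isPrimitive (ZMod.stdAddChar (N := D.natAbs)) hprim (x ^ 2)
      rw [hinv, map_pow, ← hτ] at h2
      simp only [gaussSum, AddChar.mulShift_apply] at h2
      simp only [mul_comm _ (x ^ 2)]
      rw [h2]
      split_ifs with hx
      · rw [hχ, quadraticChar_sq hD hx, one_mul]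
      · rw [MulChar.map_nonunit _ hx]; ring
    simp only [quadGauss, Finset.mul_sum]
    rw [Finset.sum_comm, Finset.sum_congr rfl fun x _ => h1 x, ← Finset.sum_filter,
      Finset.sum_const, nsmul_eq_mul]
  have hre : (∑ a : ZMod D.natAbs, χ a * quadGauss D.natAbs a).re = n * √D := by
    rw [re_sum, ← nsmul_eq_mul, hn, ← Finset.sum_const, Finset.sum_filter]
    refine Finset.sum_congr rfl fun a _ => ?_
    split_ifs with ha
    · exact re_quadraticChar_mul_quadGauss hD hD0 ha
    · rw [MulChar.map_nonunit _ ha, zero_mul, zero_re]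
  rw [hsum, ← ofReal_natCast, re_ofReal_mul] at hre
  rw [← conj_eq_iff_re.mp hreal, mul_left_cancel₀ hn0 hre]

/-- `χ_D` is `√D` times-eigenvector of the discrete Fourier transform, so the general functional
equation relates its L-function to itself. The two exponential terms coincide because `k` is even.
-/
theorem quadraticL_one_sub (hD : IsFundamentalDiscriminant D) (hD0 : 0 < D) {k : ℕ} (hk : 2 ≤ k)
    (hk2 : Even k) :
    quadraticL D hD (1 - k) = (-1) ^ (k / 2) * D ^ (k - 1) * √D * 2 * (k - 1).factorial /
      (2 * Real.pi) ^ k * quadraticL D hD k := by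
  have : NeZero D.natAbs := ⟨hD.natAbs_ne_zero⟩
  have hN : (D.natAbs : ℂ) = D := by
    rw [← Int.cast_natCast, Int.natAbs_of_nonneg hD0.le]
  set χ := quadraticChar D hD with hχ
  have hneg (x : ZMod D.natAbs) : χ (-x) = χ x := by
    rw [← neg_one_mul, map_mul, hχ, quadraticChar_neg_one hD hD0, one_mul]
  have hdft : ZMod.dft χ = fun x => (√D : ℂ) * χ x := by
    ext x
    rw [(quadraticChar_isPrimitive hD hD0).fourierTransform_eq_inv_mul_gaussSum,
      gaussSum_quadraticChar hD hD0, quadraticChar_inv, ← hχ, hneg, mul_comm]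
  have hk1 : (k : ℂ) ≠ 1 := by exact_mod_cast (show k ≠ 1 by omega)
  have h := ZMod.LFunction_one_sub χ (s := k) (fun n h => by
    have : ((k + n : ℕ) : ℂ) = 0 := by push_cast; rw [h]; ring
    have := Nat.cast_eq_zero.mp this
    omega) (Or.inr hk1)
  simp only [hneg] at h
  have hL : ZMod.LFunction (fun x => (√D : ℂ) * χ x) k = √D * ZMod.LFunction χ k := by
    rw [ZMod.LFunction_eq_LSeries _ (by simp; omega), ZMod.LFunction_eq_LSeries _ (by simp; omega)]
    exact LSeries_smul _ _ _
  obtain ⟨j, rfl⟩ := hk2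
  change ZMod.LFunction χ (1 - _) = _ * ZMod.LFunction χ _
  have he1 : exp (Real.pi * I * ((j + j : ℕ) : ℂ) / 2) = (-1) ^ j := by
    rw [← exp_pi_mul_I, ← exp_nat_mul]; congr 1; push_cast; ring
  have he2 : exp (-Real.pi * I * ((j + j : ℕ) : ℂ) / 2) = (-1) ^ j := by
    rw [show -(Real.pi : ℂ) * I * ((j + j : ℕ) : ℂ) / 2 = -(Real.pi * I * ((j + j : ℕ) : ℂ) / 2) by
      ring, exp_neg, he1, ← inv_pow]; norm_num
  have hG : Gamma ((j + j : ℕ) : ℂ) = (j + j - 1).factorial := by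
    rw [← Gamma_nat_eq_factorial]
    congr 1
    rw [Nat.cast_sub (by omega)]; push_cast; ring
  have hp : (D : ℂ) ^ (((j + j : ℕ) : ℂ) - 1) = D ^ (j + j - 1) := by
    rw [← cpow_natCast, Nat.cast_sub (by omega), Nat.cast_one]
  rw [h, hdft, hL, he1, he2, hG, hN, hp, cpow_neg, cpow_natCast, show (j + j) / 2 = j by omega]
  ring

end GaussSum

/-! ### The values `L(χ_D, -1)` and `L(χ_D, -3)` -/

section LValues

open Complex

variable {D : ℤ}

theorem IsFundamentalDiscriminant.not_isSquare (hD : IsFundamentalDiscriminant D) (hD1 : 1 < D) :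
    ¬ IsSquare D := by
  rintro ⟨r, rfl⟩
  rcases hD with ⟨-, hsq⟩ | ⟨m, hm, hm4, -⟩
  · have hu := hsq r dvd_rfl
    rcases Int.isUnit_iff.mp hu with rfl | rfl <;> norm_num at hD1
  · unfold Int.ModEq at hm4
    have hr : r % 2 = 0 := by
      have h : (r * r) % 2 = 0 := by omega
      rcases Int.emod_two_eq_zero_or_one r with h' | h'
      · exact h'
      · rw [Int.mul_emod, h'] at h; norm_num at h
    obtain ⟨s, rfl⟩ := Int.dvd_of_emod_eq_zero hr
    have : m = s * s := by linarith
    have h4 : (s * s) % 4 = 0 ∨ (s * s) % 4 = 1 := by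
      have : s % 4 = 0 ∨ s % 4 = 1 ∨ s % 4 = 2 ∨ s % 4 = 3 := by omega
      rcases this with h | h | h | h <;> rw [Int.mul_emod, h] <;> norm_num
    omega

theorem sigmaSum_mul_zeta (hD : IsFundamentalDiscriminant D) (hD0 : 0 < D) {n : ℕ} (hn : 1 ≤ n)
    (hq : quadConst n ≠ 0)
    (h : ∀ x, quadSum D n x = ENNReal.ofReal (sigmaSum n D 4 : ℝ)) :
    (sigmaSum n D 4 : ℂ) * riemannZeta (2 * (n + 1 : ℕ)) =
      (quadConst n : ℂ) * (√D : ℂ) ^ (2 * n + 1) *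
        (riemannZeta (n + 1 : ℕ) * quadraticL D hD (n + 1 : ℕ)) := by
  have hs := hasSum_rootCount (δ := D % 4) (e := D / 4) (hD.mod_four_eq_zero_or_one)
    (by omega) hD0 (by omega : n ≠ 0) (by positivity : (0 : ℝ) ≤ sigmaSum n D 4) h
  have hc : (quadConst n * √D ^ (2 * n + 1) : ℝ) ≠ 0 :=
    mul_ne_zero hq (pow_ne_zero _ (Real.sqrt_pos.mpr (by exact_mod_cast hD0)).ne')
  have hs' := hs.div_const (quadConst n * √D ^ (2 * n + 1))
  have hsum : HasSum (fun A : ℕ => (rootCount (D % 4) (D / 4) A : ℝ) / A ^ (n + 1))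
      (sigmaSum n D 4 / (quadConst n * √D ^ (2 * n + 1))) := by
    have hfun : (fun A : ℕ => (rootCount (D % 4) (D / 4) A : ℝ) / A ^ (n + 1)) = fun A : ℕ =>
        (rootCount (D % 4) (D / 4) A : ℝ) * (quadConst n * √D ^ (2 * n + 1) / A ^ (n + 1)) /
          (quadConst n * √D ^ (2 * n + 1)) := by
      ext A
      rw [← mul_div_assoc, div_div, mul_comm ((A : ℝ) ^ (n + 1)) (_ * _),
        mul_comm (_ : ℝ) (quadConst n * _), mul_div_mul_left _ _ hc]
    rw [hfun]
    exact hs'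
  rw [← hD.tsum_rootCount_mul_zeta (by omega) hsum.summable, hsum.tsum_eq, ← mul_assoc]
  congr 1
  push_cast
  rw [mul_div_cancel₀]
  exact_mod_cast hc

theorem riemannZeta_eight : riemannZeta 8 = Real.pi ^ 8 / 9450 := by
  have h := riemannZeta_two_mul_nat (k := 4) (by norm_num)
  have h5 : bernoulli' 5 = 0 := bernoulli'_eq_zero_of_odd (by decide) (by norm_num)
  have h7 : bernoulli' 7 = 0 := bernoulli'_eq_zero_of_odd (by decide) (by norm_num)
  have h6 : bernoulli' 6 = 1 / 42 := by
    rw [bernoulli'_def]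
    norm_num [Finset.sum_range_succ, Nat.choose, h5]
  have h8 : bernoulli 8 = -1 / 30 := by
    rw [bernoulli_eq_bernoulli'_of_ne_one (by norm_num), bernoulli'_def]
    norm_num [Finset.sum_range_succ, Nat.choose, h5, h6, h7]
  norm_num [h8, Nat.factorial] at h
  rw [h]; ring

/-- Elimination of `L(χ_D, 2)` between `S_1 ζ(4) = D ^ (3/2) ζ(2) L(χ_D, 2) / 6` and the functional
equation `L(χ_D, -1) = -D ^ (3/2) L(χ_D, 2) / (2π ^ 2)`. -/
theorem quadraticL_neg_one (hD : IsFundamentalDiscriminant D) (hD1 : 1 < D) :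
    quadraticL D hD (-1) = -(1 / 5) * (sigmaSum 1 D 4 : ℂ) := by
  have hD0 : 0 < D := by omega
  have h := sigmaSum_mul_zeta hD hD0 le_rfl (by rw [quadConst_one]; norm_num) fun x => by
    rw [quadSum_one (hD.not_isSquare hD1), sum_simpleForms_eq_sigmaSum hD0]
  have hL := quadraticL_one_sub hD hD0 (k := 2) le_rfl even_two
  have hsq : (√(D : ℝ) : ℂ) ^ 2 = D := by
    rw [← ofReal_pow, Real.sq_sqrt (by exact_mod_cast hD0.le), ofReal_intCast]
  have hpi : (Real.pi : ℂ) ≠ 0 := by exact_mod_cast Real.pi_ne_zero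
  rw [quadConst_one] at h
  norm_num [riemannZeta_two, riemannZeta_four, Nat.factorial] at h hL
  rw [show (√(D : ℝ) : ℂ) ^ 3 = D * √(D : ℝ) by rw [← hsq]; ring] at h
  rw [hL]
  field_simp at h ⊢
  linear_combination (1 / 18) * h

theorem quadraticL_neg_three (hD : IsFundamentalDiscriminant D) (hD1 : 1 < D) :
    quadraticL D hD (-3) = (sigmaSum 3 D 4 : ℂ) := by
  have hD0 : 0 < D := by omega
  have h := sigmaSum_mul_zeta hD hD0 (by norm_num : 1 ≤ 3) (by rw [quadConst_three]; norm_num) fun x => by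
    rw [quadSum_three (hD.not_isSquare hD1), sum_simpleForms_eq_sigmaSum hD0]
  have hL := quadraticL_one_sub hD hD0 (k := 4) (by norm_num) (by decide)
  have hsq : (√(D : ℝ) : ℂ) ^ 2 = D := by
    rw [← ofReal_pow, Real.sq_sqrt (by exact_mod_cast hD0.le), ofReal_intCast]
  have hpi : (Real.pi : ℂ) ≠ 0 := by exact_mod_cast Real.pi_ne_zero
  rw [quadConst_three] at h
  norm_num [riemannZeta_eight, riemannZeta_four, Nat.factorial] at h hL
  rw [show (√(D : ℝ) : ℂ) ^ 7 = D ^ 3 * √(D : ℝ) by rw [← hsq]; ring] at h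
  rw [hL]
  field_simp at h ⊢
  linear_combination (-1 / 1575) * h

end LValues

/-! ### Modular forms of level one from functions on `ℂ` -/

section LevelOne

open Complex UpperHalfPlane ModularForm

theorem mdifferentiable_of_differentiableAt {F : ℂ → ℂ}
    (h : ∀ z : ℂ, 0 < z.im → DifferentiableAt ℂ F z) : MDiff (fun τ : ℍ => F τ) := by
  rw [UpperHalfPlane.mdifferentiable_iff]
  refine DifferentiableOn.congr (fun z hz => (h z hz).differentiableWithinAt) fun z hz => ?_
  rw [Function.comp_apply, ofComplex_apply_of_im_pos hz]

/-- The generators `S` and `T` suffice for modularity, and boundedness at infinity for all cusps,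
since every slash of the function is the function itself. -/
theorem exists_modularForm_levelOne {F : ℂ → ℂ} {k : ℤ}
    (hd : ∀ z : ℂ, 0 < z.im → DifferentiableAt ℂ F z)
    (hT : ∀ z : ℂ, 0 < z.im → F (z + 1) = F z)
    (hS : ∀ z : ℂ, 0 < z.im → F (-1 / z) = z ^ k * F z)
    (hb : IsBoundedAtImInfty fun τ : ℍ => F τ) :
    ∃ M : ModularForm 𝒮ℒ k, ∀ τ : ℍ, M τ = F τ := by
  have hS' : (fun τ : ℍ => F τ) ∣[k] ModularGroup.S = fun τ : ℍ => F τ := by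
    ext z
    have h := hS z z.im_pos
    rw [SL_slash_apply, UpperHalfPlane.modular_S_smul]
    have hz : (z : ℂ) ^ k ≠ 0 := zpow_ne_zero _ z.ne_zero
    rw [ModularGroup.denom_apply]
    suffices F (-(z : ℂ)⁻¹) * ((z : ℂ) ^ k)⁻¹ = F z by simpa [ModularGroup.S]
    rw [show -(z : ℂ)⁻¹ = -1 / z by rw [neg_div, one_div], h]
    field_simp
  have hT' : (fun τ : ℍ => F τ) ∣[k] ModularGroup.T = fun τ : ℍ => F τ := by
    ext z
    rw [SL_slash_apply, ModularGroup.denom_apply, modular_T_smul, ModularGroup.T]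
    have := hT z z.im_pos
    simpa [add_comm] using this
  have hγ := SlashInvariantForm.slash_action_generators_SL2Z hS' hT'
  refine ⟨{ toFun := fun τ => F τ, slash_action_eq' := ?_, holo' := ?_, bdd_at_cusps' := ?_ },
    fun τ => rfl⟩
  · rintro A ⟨A, rfl⟩
    exact hγ A
  · exact mdifferentiable_of_differentiableAt hd
  · intro c hc
    rw [Subgroup.IsArithmetic.isCusp_iff_isCusp_SL2Z] at hc
    rw [OnePoint.isBoundedAt_iff_forall_SL2Z hc]
    intro γ _
    rw [hγ]
    exact hb

end LevelOne

/-! ### Transformation formulas and nonvanishing of Jacobi's theta function -/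

section JacobiTheta

open Complex Filter Topology

theorem im_neg_one_div {z : ℂ} (hz : 0 < z.im) : 0 < (-1 / z).im := by
  have h := (ModularGroup.S • (⟨z, hz⟩ : ℍ)).im_pos
  rw [UpperHalfPlane.modular_S_smul] at h
  have h' : 0 < ((-z)⁻¹).im := h
  rwa [neg_div, one_div, ← inv_neg]

theorem re_neg_I_mul (z : ℂ) : (-I * z).re = z.im := by simp

theorem jacobiTheta_neg_one_div {z : ℂ} (hz : 0 < z.im) :
    jacobiTheta (-1 / z) = (-I * z) ^ (1 / 2 : ℂ) * jacobiTheta z := by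
  have h := jacobiTheta_S_smul ⟨z, hz⟩
  rw [UpperHalfPlane.modular_S_smul] at h
  have h' : jacobiTheta ((-z)⁻¹) = (-I * z) ^ (1 / 2 : ℂ) * jacobiTheta z := h
  rwa [neg_div, one_div, ← inv_neg]

theorem jacobiTheta_add_two_mul (z : ℂ) (n : ℤ) : jacobiTheta (z + 2 * n) = jacobiTheta z := by
  have hper : Function.Periodic jacobiTheta (2 : ℂ) := fun z => by
    rw [add_comm]; exact jacobiTheta_two_add z
  have := hper.int_mul n z
  rwa [mul_comm] at this

theorem cpow_half_sq (z : ℂ) : (z ^ (1 / 2 : ℂ)) ^ 2 = z := by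
  rw [← cpow_nat_mul]; norm_num

/-- The map is translation by `-2m` conjugated by `z ↦ -1/z`. The multiplier is a product of two
principal square roots, so `0 < c.re` selects it among the roots of its square. -/
theorem exists_jacobiTheta_lower {z : ℂ} (hz : 0 < z.im) (m : ℤ) :
    ∃ c : ℂ, 0 < c.re ∧ c ^ 2 = 2 * m * z + 1 ∧
      jacobiTheta (z / (2 * m * z + 1)) = c * jacobiTheta z := by
  have hz0 : z ≠ 0 := by rintro rfl; simp at hz
  set u : ℂ := -1 / z + 2 * (-m : ℤ) with hu
  have him := im_neg_one_div hz
  have hum : 0 < u.im := by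
    rw [hu, add_im]
    simpa using him
  refine ⟨(-I * u) ^ (1 / 2 : ℂ) * (-I * z) ^ (1 / 2 : ℂ), ?_, ?_, ?_⟩
  · exact re_cpow_half_mul_cpow_half_pos (by rwa [re_neg_I_mul]) (by rwa [re_neg_I_mul])
  · rw [mul_pow, cpow_half_sq, cpow_half_sq, hu]
    push_cast
    field_simp
    linear_combination (-1 - 2 * z * m) * I_sq
  · have h0 : u ≠ 0 := by intro h; rw [h] at hum; simp at hum
    have h1 : z / (2 * m * z + 1) = -1 / u := by
      have h2 : 2 * m * z + 1 = -(z * u) := by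
        rw [hu]; push_cast; field_simp; ring
      rw [h2]; field_simp
    rw [h1, jacobiTheta_neg_one_div hum, hu, jacobiTheta_add_two_mul, jacobiTheta_neg_one_div hz]
    ring

/-- The exact ratio `I` between the multipliers of `θ(z)` and `θ(z + 1)` is needed: a sign error
here would change the multiplier of the determinant `thetaDet`. -/
theorem exists_jacobiTheta_lower_add_one {z : ℂ} (hz : 0 < z.im) :
    ∃ c : ℂ, c ^ 2 = 1 - 2 * z ∧ jacobiTheta (z / (1 - 2 * z)) = c * jacobiTheta z ∧
      jacobiTheta (z / (1 - 2 * z) + 1) = I * c * jacobiTheta (z + 1) := by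
  obtain ⟨c, hc, hc2, hc3⟩ := exists_jacobiTheta_lower hz (-1)
  have e : 2 * ((-1 : ℤ) : ℂ) * z + 1 = 1 - 2 * z := by push_cast; ring
  rw [e] at hc2 hc3
  refine ⟨c, hc2, hc3, ?_⟩
  have hv : 0 < (z - 1).im := by simpa using hz
  have hv0 : z - 1 ≠ 0 := by intro h; rw [h] at hv; simp at hv
  set u : ℂ := -1 / (z - 1) + 2 * (-1 : ℤ) with hu
  have hum : 0 < u.im := by
    rw [hu, add_im]
    have := im_neg_one_div hv
    simpa using this
  have h0 : u ≠ 0 := by intro h; rw [h] at hum; simp at hum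
  set d : ℂ := (-I * u) ^ (1 / 2 : ℂ) * (-I * (z - 1)) ^ (1 / 2 : ℂ) with hd
  have hdre : 0 < d.re :=
    re_cpow_half_mul_cpow_half_pos (by rwa [re_neg_I_mul]) (by rwa [re_neg_I_mul])
  have hd2 : d ^ 2 = 2 * z - 1 := by
    rw [hd, mul_pow, cpow_half_sq, cpow_half_sq, hu]
    push_cast
    field_simp
    linear_combination (1 - 2 * z) * I_sq
  have hz2 : 1 - 2 * z ≠ 0 := by
    intro h
    have := congrArg Complex.im h
    simp at this
    exact hz.ne' this
  have h1 : z / (1 - 2 * z) + 1 = -1 / u := by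
    have h2 : 1 - 2 * z = (z - 1) * u := by rw [hu]; push_cast; field_simp; ring
    have h3 : z / (1 - 2 * z) + 1 = -(z - 1) / (1 - 2 * z) := by
      rw [div_add_one hz2]; congr 1; ring
    rw [h3, h2]; field_simp
  -- Equal squares leave a sign. If `d = -I c`, then `c` would have positive real and imaginary
  -- parts, against `Im (c ^ 2) = -2 Im z < 0`.
  have hdc : d = I * c := by
    have hsq : d ^ 2 = (I * c) ^ 2 := by rw [hd2, mul_pow, hc2, I_sq]; ring
    rcases sq_eq_sq_iff_eq_or_eq_neg.mp hsq with h | h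
    · exact h
    · rw [h] at hdre
      have hcim : 2 * (c.re * c.im) = -2 * z.im := by
        have := congrArg Complex.im hc2
        rw [pow_two, mul_im] at this
        simp at this
        linarith
      have : 0 < c.im := by simpa using hdre
      nlinarith [mul_pos hc this]
  rw [h1, jacobiTheta_neg_one_div hum, hu, jacobiTheta_add_two_mul, jacobiTheta_neg_one_div hv,
    ← jacobiTheta_add_two_mul (z - 1) 1, ← mul_assoc]
  rw [show z - 1 + 2 * ((1 : ℤ) : ℂ) = z + 1 by push_cast; ring, ← hdc]

theorem jacobiTheta₂_half {z : ℂ} : jacobiTheta₂ (1 / 2) z = jacobiTheta (z + 1) := by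
  rw [jacobiTheta, jacobiTheta₂]
  refine tsum_congr fun n => ?_
  rw [jacobiTheta₂_term, ← exp_periodic.int_mul ((n ^ 2 - n) / 2) ]
  congr 1
  have : 2 * ((n ^ 2 - n) / 2) = n ^ 2 - n := Int.mul_ediv_cancel' (by
    rw [show n ^ 2 - n = n * (n - 1) by ring]; exact (Int.even_mul_pred_self n).two_dvd)
  have h : (2 : ℂ) * (((n ^ 2 - n) / 2 : ℤ) : ℂ) = n ^ 2 - n := by exact_mod_cast this
  linear_combination (Real.pi * I) * h

/-- The theta constant `∑_{n ∈ ℤ} exp (π i (n + 1 / 2) ^ 2 z)`. -/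
noncomputable def thetaConst (z : ℂ) : ℂ := exp (Real.pi * I * z / 4) * jacobiTheta₂ (z / 2) z

theorem jacobiTheta_neg_one_div_add_one {z : ℂ} (hz : 0 < z.im) :
    jacobiTheta (-1 / z + 1) = (-I * z) ^ (1 / 2 : ℂ) * thetaConst z := by
  have hz0 : z ≠ 0 := by rintro rfl; simp at hz
  have h := jacobiTheta₂_functional_equation (z / 2) z
  rw [show z / 2 / z = 1 / 2 by field_simp, jacobiTheta₂_half] at h
  have h0 : (-I * z) ^ (1 / 2 : ℂ) ≠ 0 := by
    rw [ne_eq, cpow_eq_zero_iff]; simp [hz0]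
  rw [thetaConst, h, show -(Real.pi : ℂ) * I * (z / 2) ^ 2 / z = -(Real.pi * I * z / 4) by
    field_simp; ring, exp_neg]
  field_simp

theorem thetaConst_neg_one_div {z : ℂ} (hz : 0 < z.im) :
    thetaConst (-1 / z) = (-I * z) ^ (1 / 2 : ℂ) * jacobiTheta (z + 1) := by
  have hz0 : z ≠ 0 := by rintro rfl; simp at hz
  have h := jacobiTheta_neg_one_div_add_one (im_neg_one_div hz)
  rw [show -1 / (-1 / z) = z by field_simp] at h
  rw [h, ← mul_assoc]
  have h1 : ((-I * z) ^ (1 / 2 : ℂ) * (-I * (-1 / z)) ^ (1 / 2 : ℂ)) = 1 := by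
    have hpos := re_cpow_half_mul_cpow_half_pos (z := -I * z) (w := -I * (-1 / z))
      (by rwa [re_neg_I_mul]) (by rw [re_neg_I_mul]; exact im_neg_one_div hz)
    have hsq : ((-I * z) ^ (1 / 2 : ℂ) * (-I * (-1 / z)) ^ (1 / 2 : ℂ)) ^ 2 = 1 ^ 2 := by
      rw [mul_pow, cpow_half_sq, cpow_half_sq]
      field_simp
      linear_combination -I_sq
    rcases sq_eq_sq_iff_eq_or_eq_neg.mp hsq with h | h
    · exact h
    · rw [h] at hpos; norm_num at hpos
  rw [h1, one_mul]

theorem thetaConst_add_one (z : ℂ) : thetaConst (z + 1) = exp (Real.pi * I / 4) * thetaConst z := by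
  rw [thetaConst, thetaConst, ← mul_assoc, ← exp_add]
  congr 1
  · congr 1; ring
  · refine tsum_congr fun n => ?_
    rw [jacobiTheta₂_term, jacobiTheta₂_term,
      ← exp_periodic.int_mul ((n ^ 2 + n) / 2) (2 * Real.pi * I * n * (z / 2) + _)]
    congr 1
    have : 2 * ((n ^ 2 + n) / 2) = n ^ 2 + n := Int.mul_ediv_cancel' (by
      rw [show n ^ 2 + n = n * (n + 1) by ring]; exact (Int.even_mul_succ_self n).two_dvd)
    have h : (2 : ℂ) * (((n ^ 2 + n) / 2 : ℤ) : ℂ) = n ^ 2 + n := by exact_mod_cast this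
    linear_combination -(Real.pi * I) * h

theorem norm_jacobiTheta_sub_one_le_two_thirds {z : ℂ} (hz : 1 ≤ z.im) :
    ‖jacobiTheta z - 1‖ ≤ 2 / 3 := by
  refine (norm_jacobiTheta_sub_one_le (by linarith)).trans ?_
  have he : Real.exp (-Real.pi * z.im) < 1 / 4 := by
    rw [neg_mul, Real.exp_neg, inv_eq_one_div, one_div_lt_one_div (Real.exp_pos _) (by norm_num)]
    nlinarith [Real.add_one_le_exp (Real.pi * z.im), Real.pi_gt_three]
  have hpos := Real.exp_pos (-Real.pi * z.im)
  rw [div_mul_eq_mul_div, div_le_div_iff₀ (by linarith) (by norm_num)]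
  linarith

theorem norm_jacobiTheta_le {z : ℂ} (hz : 1 ≤ z.im) : ‖jacobiTheta z‖ ≤ 2 := by
  have h := norm_jacobiTheta_sub_one_le_two_thirds hz
  have h1 := norm_sub_norm_le (jacobiTheta z) 1
  rw [norm_one] at h1
  linarith

theorem one_third_le_norm_jacobiTheta {z : ℂ} (hz : 1 ≤ z.im) : 1 / 3 ≤ ‖jacobiTheta z‖ := by
  have h := norm_jacobiTheta_sub_one_le_two_thirds hz
  have h1 := norm_sub_norm_le 1 (jacobiTheta z)
  rw [norm_one, norm_sub_rev] at h1
  linarith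

theorem exists_norm_thetaConst_le : ∃ C : ℝ, ∀ z : ℂ, 1 ≤ z.im →
    ‖thetaConst z‖ ≤ C * Real.exp (-Real.pi * z.im / 4) := by
  have hs : Summable fun n : ℤ => ‖jacobiTheta₂_term n (I / 2) I‖ :=
    ((summable_jacobiTheta₂_term_iff (I / 2) I).mpr (by simp)).norm
  refine ⟨∑' n : ℤ, ‖jacobiTheta₂_term n (I / 2) I‖, fun z hz => ?_⟩
  rw [thetaConst, norm_mul, mul_comm]
  have h1 : ‖exp (Real.pi * I * z / 4)‖ = Real.exp (-Real.pi * z.im / 4) := by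
    rw [norm_exp, show Real.pi * I * z / 4 = ((Real.pi / 4 : ℝ) : ℂ) * (I * z) by push_cast; ring,
      re_ofReal_mul]
    congr 1
    simp; ring
  rw [h1]
  refine mul_le_mul_of_nonneg_right ?_ (Real.exp_pos _).le
  refine tsum_of_norm_bounded hs.hasSum fun n => ?_
  rw [norm_jacobiTheta₂_term, norm_jacobiTheta₂_term]
  refine Real.exp_le_exp.mpr ?_
  have hn : (0 : ℝ) ≤ n ^ 2 + n := by
    have : (0 : ℤ) ≤ n * (n + 1) := by
      rcases le_or_gt 0 n with h | h
      · positivity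
      · exact mul_nonneg_of_nonpos_of_nonpos h.le (by omega)
    have h' : (0 : ℝ) ≤ ((n * (n + 1) : ℤ) : ℝ) := by exact_mod_cast this
    push_cast at h'; linarith
  have e1 : (z / 2).im = z.im / 2 := by
    rw [show z / 2 = ((1 / 2 : ℝ) : ℂ) * z by push_cast; ring, im_ofReal_mul]; ring
  have e2 : (I / 2).im = 1 / 2 := by
    rw [show I / 2 = ((1 / 2 : ℝ) : ℂ) * I by push_cast; ring, im_ofReal_mul]; simp
  rw [e1, e2, I_im]
  nlinarith [mul_nonneg (mul_nonneg Real.pi_pos.le hn) (sub_nonneg.mpr hz)]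

/-- `η ^ 6` has multiplier `I` under both generators and weight 3, exactly what is divided out of
`thetaDet`. -/
theorem eta_pow_six_add_one (z : ℂ) :
    ModularForm.eta (z + 1) ^ 6 = I * ModularForm.eta z ^ 6 := by
  have h1 (n : ℕ) : ModularForm.eta_q n (z + 1) = ModularForm.eta_q n z := by
    rw [ModularForm.eta_q_eq_pow, ModularForm.eta_q_eq_pow, mul_add, mul_one, exp_add,
      exp_two_pi_mul_I, mul_one]
  have h2 : Function.Periodic.qParam 24 (z + 1) ^ 6 = I * Function.Periodic.qParam 24 z ^ 6 := by
    rw [Function.Periodic.qParam, Function.Periodic.qParam, ← exp_nat_mul, ← exp_nat_mul,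
      show ((6 : ℕ) : ℂ) * (2 * Real.pi * I * (z + 1) / (24 : ℝ)) =
        Real.pi / 2 * I + (6 : ℕ) * (2 * Real.pi * I * z / (24 : ℝ)) by push_cast; ring,
      exp_add, exp_pi_div_two_mul_I]
  simp only [ModularForm.eta, h1]
  rw [mul_pow, h2, mul_pow, mul_assoc]

theorem eta_pow_six_neg_one_div {z : ℂ} (hz : 0 < z.im) :
    ModularForm.eta (-1 / z) ^ 6 = I * z ^ 3 * ModularForm.eta z ^ 6 := by
  have h := ModularForm.eta_comp_eq_csqrt_I_inv hz
  simp only [Function.comp_apply, Pi.smul_apply, Pi.mul_apply, smul_eq_mul] at h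
  have hsq (w : ℂ) : Complex.sqrt w ^ 6 = w ^ 3 := by
    rw [show 6 = 2 * 3 by norm_num, pow_mul, Complex.sqrt, ← cpow_nat_mul]; norm_num
  rw [h, mul_pow, mul_pow, inv_pow, hsq, hsq, I_pow_three, inv_neg, inv_I]
  ring

theorem exp_isBigO_eta_pow_six : (fun τ : ℍ => Real.exp (-Real.pi * τ.im / 2))
    =O[UpperHalfPlane.atImInfty] fun τ : ℍ => ModularForm.eta τ ^ 6 := by
  obtain ⟨C, hC0, hC⟩ := ModularForm.exp_isBigO_discriminant.exists_nonneg
  rw [Asymptotics.isBigOWith_iff] at hC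
  refine Asymptotics.IsBigO.of_bound (C + 1) ?_
  filter_upwards [hC] with τ h
  rw [ModularForm.discriminant, show 24 = 6 * 4 by norm_num, pow_mul, norm_pow,
    Real.norm_of_nonneg (Real.exp_pos _).le] at h
  rw [Real.norm_of_nonneg (Real.exp_pos _).le]
  refine le_of_pow_le_pow_left₀ (n := 4) (by norm_num) (by positivity) ?_
  rw [← Real.exp_nat_mul, mul_pow]
  calc Real.exp (((4 : ℕ) : ℝ) * (-Real.pi * τ.im / 2)) = Real.exp (-2 * Real.pi * τ.im) := by
        congr 1; push_cast; ring
    _ ≤ C * ‖ModularForm.eta τ ^ 6‖ ^ 4 := h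
    _ ≤ (C + 1) ^ 4 * ‖ModularForm.eta τ ^ 6‖ ^ 4 := by
        gcongr
        calc C ≤ C + 1 := by linarith
          _ ≤ (C + 1) ^ 4 := le_self_pow₀ (by linarith) (by norm_num)

theorem differentiableAt_thetaConst {z : ℂ} (hz : 0 < z.im) : DifferentiableAt ℂ thetaConst z := by
  have h1 : DifferentiableAt ℂ (fun z : ℂ => (z / 2, z)) z := by fun_prop
  have h2 := (hasFDerivAt_jacobiTheta₂ (z / 2) hz).differentiableAt
  have h3 : DifferentiableAt ℂ (fun z : ℂ => jacobiTheta₂ (z / 2) z) z :=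
    DifferentiableAt.comp (f := fun z : ℂ => (z / 2, z)) z
      (g := fun p : ℂ × ℂ => jacobiTheta₂ p.1 p.2) h2 h1
  unfold thetaConst
  fun_prop

/-- The generators permute the three theta constants up to factors whose eighth powers are `1` or `z
^ 4`. The eighth power of their product therefore has weight 12 and level one; it decays like `η ^
24`, so it is a constant multiple of `η ^ 24`, which has no zeros. -/
theorem jacobiTheta_ne_zero {z : ℂ} (hz : 0 < z.im) : jacobiTheta z ≠ 0 := by
  let P : ℂ → ℂ := fun z => (jacobiTheta z * jacobiTheta (z + 1) * thetaConst z) ^ 8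
  have hη (z : ℂ) (hz : 0 < z.im) : ModularForm.eta z ≠ 0 := ModularForm.eta_ne_zero hz
  have hd8 (z : ℂ) : ((-I * z) ^ (1 / 2 : ℂ)) ^ 8 = z ^ 4 := by
    rw [show 8 = 2 * 4 by norm_num, pow_mul, cpow_half_sq, mul_pow, neg_pow, I_pow_four]; norm_num
  have hΔ : ∃ M : ModularForm 𝒮ℒ 0, ∀ τ : ℍ, M τ = P τ / ModularForm.eta τ ^ 24 := by
    refine exists_modularForm_levelOne (F := fun z => P z / ModularForm.eta z ^ 24) ?_ ?_ ?_ ?_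
    · intro z hz
      have h1 : DifferentiableAt ℂ jacobiTheta z := differentiableAt_jacobiTheta hz
      have h2 : DifferentiableAt ℂ (fun z => jacobiTheta (z + 1)) z :=
        DifferentiableAt.comp z (f := fun z => z + 1)
          (differentiableAt_jacobiTheta (by simpa using hz)) (by fun_prop)
      have h3 := differentiableAt_thetaConst hz
      have h4 := ModularForm.differentiableAt_eta_of_mem_upperHalfPlaneSet hz
      exact (((h1.mul h2).mul h3).pow 8).div (h4.pow 24) (pow_ne_zero _ (hη z hz))
    · intro z hz
      have hz1 := jacobiTheta_add_two_mul z 1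
      rw [show z + 2 * ((1 : ℤ) : ℂ) = z + 1 + 1 by push_cast; ring] at hz1
      have h8 : exp (Real.pi * I / 4) ^ 8 = 1 := by
        rw [← exp_nat_mul, ← exp_two_pi_mul_I]; congr 1; push_cast; ring
      simp only [P]
      rw [hz1, thetaConst_add_one, show 24 = 6 * 4 by norm_num, pow_mul, pow_mul,
        eta_pow_six_add_one, mul_pow I, I_pow_four, one_mul]
      congr 1
      linear_combination ((jacobiTheta z * jacobiTheta (z + 1) * thetaConst z) ^ 8) * h8
    · intro z hz
      have hz0 : z ≠ 0 := by rintro rfl; simp at hz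
      simp only [P]
      rw [jacobiTheta_neg_one_div hz, jacobiTheta_neg_one_div_add_one hz, thetaConst_neg_one_div hz,
        show 24 = 6 * 4 by norm_num, pow_mul, pow_mul, eta_pow_six_neg_one_div hz, zpow_zero, one_mul]
      simp only [mul_pow, hd8, I_pow_four]
      have := hη z hz
      field_simp
    · obtain ⟨C, hC⟩ := exists_norm_thetaConst_le
      have hO : (fun τ : ℍ => P τ) =O[UpperHalfPlane.atImInfty]
          fun τ : ℍ => Real.exp (-2 * Real.pi * τ.im) := by
        refine Asymptotics.IsBigO.of_bound ((2 * 2 * C) ^ 8) ?_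
        rw [UpperHalfPlane.atImInfty, Filter.eventually_comap]
        filter_upwards [eventually_ge_atTop 1] with y hy τ hτ
        have h1 : 1 ≤ (τ : ℂ).im := by rw [UpperHalfPlane.coe_im, hτ]; exact hy
        have h2 : 1 ≤ ((τ : ℂ) + 1).im := by simpa using h1
        simp only [P]
        rw [Real.norm_of_nonneg (Real.exp_pos _).le, norm_pow, norm_mul, norm_mul]
        calc _ ≤ (2 * 2 * (C * Real.exp (-Real.pi * (τ : ℂ).im / 4))) ^ 8 := by
              gcongr
              · exact norm_jacobiTheta_le h1
              · exact norm_jacobiTheta_le h2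
              · exact hC _ h1
          _ = _ := by
              rw [← mul_assoc, mul_pow, ← Real.exp_nat_mul, UpperHalfPlane.coe_im]
              congr 2; push_cast; ring
      have hO2 := (hO.trans ModularForm.exp_isBigO_discriminant).norm_norm
      obtain ⟨K, hK⟩ := hO2.bound
      refine Asymptotics.IsBigO.of_bound K ?_
      filter_upwards [hK] with τ hτ
      rw [norm_norm, norm_norm, ModularForm.discriminant] at hτ
      rw [norm_div, Pi.one_apply, norm_one, mul_one,
        div_le_iff₀ (norm_pos_iff.mpr (pow_ne_zero _ (hη τ τ.im_pos)))]
      exact hτ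
  obtain ⟨M, hM⟩ := hΔ
  obtain ⟨c, hc⟩ := ModularFormClass.levelOne_weight_zero_const M
  have hP (z : ℂ) (hz : 0 < z.im) : P z = c * ModularForm.eta z ^ 24 := by
    have h := hM ⟨z, hz⟩
    rw [hc, Function.const_apply] at h
    rw [h]
    exact (div_mul_cancel₀ _ (pow_ne_zero _ (hη z hz))).symm
  -- At `I` two of the theta constants are within `2/3` of 1, and the third is proportional to one
  -- of these by inversion.
  have hc0 : c ≠ 0 := by
    rintro rfl
    have h := hP I (by simp)
    rw [zero_mul] at h
    have h1 : jacobiTheta I ≠ 0 := norm_pos_iff.mp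
      (lt_of_lt_of_le (by norm_num) (one_third_le_norm_jacobiTheta (z := I) (by simp)))
    have h2 : jacobiTheta (I + 1) ≠ 0 := norm_pos_iff.mp
      (lt_of_lt_of_le (by norm_num) (one_third_le_norm_jacobiTheta (z := I + 1) (by simp)))
    have h3 := jacobiTheta_neg_one_div_add_one (z := I) (by simp)
    have h4 : -1 / I = I := by rw [div_I]; ring
    rw [h4] at h3
    have h5 : thetaConst I ≠ 0 := by
      intro h; rw [h, mul_zero] at h3; exact h2 h3
    exact pow_ne_zero 8 (mul_ne_zero (mul_ne_zero h1 h2) h5) h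
  intro h
  have := hP z hz
  simp only [P, h, zero_mul] at this
  rw [zero_pow (by norm_num)] at this
  exact mul_ne_zero hc0 (pow_ne_zero _ (hη z hz)) this.symm

end JacobiTheta

/-! ### Fourier expansions supported on `n ≡ 0, 1 (mod 4)` -/

section Expansion

open Complex
open UpperHalfPlane hiding I I_im

/-- `f` has the Fourier expansion `∑ a(n) q ^ n`, with `a(n) = 0` unless `n ≡ 0, 1 (mod 4)`. -/
def HasPlusExpansion (f : ℍ → ℂ) (a : ℕ → ℂ) : Prop :=
  (∀ τ : ℍ, HasSum (fun n => a n * q τ ^ n) (f τ)) ∧ ∀ n, n % 4 ≠ 0 → n % 4 ≠ 1 → a n = 0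

theorem mem_plusSpace_iff {m : ℕ} {f : ℍ → ℂ} : f ∈ plusSpace (2 * m) ↔
    f ∈ modularForms (2 * (2 * m) + 1) ∧ ∃ a, HasPlusExpansion f a := by
  have key (n : ℕ) : ¬ ((-1) ^ (2 * m) * (n : ℤ) ≡ 0 [ZMOD 4] ∨
      (-1) ^ (2 * m) * (n : ℤ) ≡ 1 [ZMOD 4]) ↔ n % 4 ≠ 0 ∧ n % 4 ≠ 1 := by
    rw [pow_mul, neg_one_sq, one_pow, one_mul]
    unfold Int.ModEq
    omega
  constructor
  · rintro ⟨h, a, ha, ha'⟩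
    exact ⟨h, a, ha, fun n h0 h1 => ha' n ((key n).mpr ⟨h0, h1⟩)⟩
  · rintro ⟨h, a, ha, ha'⟩
    exact ⟨h, a, ha, fun n hn => ha' n ((key n).mp hn).1 ((key n).mp hn).2⟩

/-- The function `z ↦ f(z / 4)`, extended to `ℂ`. -/
noncomputable def quarter (f : ℍ → ℂ) (z : ℂ) : ℂ := f (ofComplex (z / 4))

theorem im_div_four {z : ℂ} : (z / 4).im = z.im / 4 := by
  rw [show z / 4 = ((1 / 4 : ℝ) : ℂ) * z by push_cast; ring, im_ofReal_mul]; ring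

theorem coe_ofComplex_div_four {z : ℂ} (hz : 0 < z.im) : (ofComplex (z / 4) : ℂ) = z / 4 := by
  rw [ofComplex_apply_of_im_pos (by rw [im_div_four]; positivity)]

theorem quarter_four_mul (f : ℍ → ℂ) (τ : ℍ) : quarter f (4 * τ) = f τ := by
  rw [quarter, mul_div_cancel_left₀ _ (by norm_num), ofComplex_apply]

theorem differentiableAt_quarter {f : ℍ → ℂ} (hf : MDiff f) {z : ℂ} (hz : 0 < z.im) :
    DifferentiableAt ℂ (quarter f) z := by
  have h4 : 0 < (z / 4).im := by rw [im_div_four]; positivity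
  have h := ((UpperHalfPlane.mdifferentiable_iff.mp hf) (z / 4) h4).differentiableAt
    (isOpen_upperHalfPlaneSet.mem_nhds h4)
  exact DifferentiableAt.comp z (f := fun z => z / 4) h (by fun_prop)

variable {f : ℍ → ℂ} {a : ℕ → ℂ}

theorem HasPlusExpansion.hasSum_quarter (hf : HasPlusExpansion f a) {z : ℂ} (hz : 0 < z.im) :
    HasSum (fun n => a n * exp (Real.pi * I * z / 2) ^ n) (quarter f z) := by
  have h := hf.1 (ofComplex (z / 4))
  rw [q, coe_ofComplex_div_four hz, show 2 * Real.pi * I * (z / 4) = Real.pi * I * z / 2 by ring] at h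
  exact h

theorem exp_add_one (z : ℂ) : exp (Real.pi * I * (z + 1) / 2) = I * exp (Real.pi * I * z / 2) := by
  rw [show Real.pi * I * (z + 1) / 2 = Real.pi / 2 * I + Real.pi * I * z / 2 by ring, exp_add,
    exp_pi_div_two_mul_I]

theorem exp_add_two (z : ℂ) : exp (Real.pi * I * (z + 2) / 2) = -exp (Real.pi * I * z / 2) := by
  rw [show z + 2 = z + 1 + 1 by ring, exp_add_one, exp_add_one, ← mul_assoc, I_mul_I, neg_one_mul]

/-- Translation by 1 multiplies the `n`-th term by `I ^ n`, which is `1` or `I` on the support;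
these are the roots of `X ^ 2 - (1 + I) X + I`. -/
theorem HasPlusExpansion.quarter_add_two (hf : HasPlusExpansion f a) {z : ℂ} (hz : 0 < z.im) :
    quarter f (z + 2) = (1 + I) * quarter f (z + 1) - I * quarter f z := by
  have h2 := hf.hasSum_quarter (z := z + 2) (by simpa using hz)
  have h1 := hf.hasSum_quarter (z := z + 1) (by simpa using hz)
  have h0 := hf.hasSum_quarter hz
  refine h2.unique ?_
  convert! (h1.mul_left (1 + I)).sub (h0.mul_left I) using 1
  ext n
  rw [exp_add_one, exp_add_two, neg_pow, mul_pow]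
  have hn : n % 4 = 0 ∨ n % 4 = 1 ∨ a n = 0 := by
    by_contra! h
    exact h.2.2 (hf.2 n h.1 h.2.1)
  have hI : I ^ n = I ^ (n % 4) := by
    conv_lhs => rw [← Nat.div_add_mod n 4, pow_add, pow_mul, I_pow_four, one_pow, one_mul]
  have h1 : (-1 : ℂ) ^ n = (I ^ n) ^ 2 := by rw [← pow_mul, mul_comm, pow_mul, I_sq]
  rw [h1, hI]
  rcases hn with h | h | h
  · rw [h]; ring
  · rw [h]; linear_combination 0 * I_sq
  · rw [h]; ring

theorem norm_exp_pi_mul (z : ℂ) : ‖exp (Real.pi * I * z / 2)‖ = Real.exp (-Real.pi * z.im / 2) := by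
  rw [norm_exp, show Real.pi * I * z / 2 = ((Real.pi / 2 : ℝ) : ℂ) * (I * z) by push_cast; ring,
    re_ofReal_mul]
  congr 1
  simp; ring

/-- Comparison with the absolutely convergent series at `I`. In the last two estimates the constant
term cancels, leaving the decay of the first power. -/
theorem HasPlusExpansion.exists_bound (hf : HasPlusExpansion f a) : ∃ C : ℝ, ∀ z : ℂ, 1 ≤ z.im →
    ‖quarter f z‖ ≤ C ∧ ‖quarter f z - a 0‖ ≤ C * Real.exp (-Real.pi * z.im / 2) ∧
    ‖quarter f z - quarter f (z + 2)‖ ≤ C * Real.exp (-Real.pi * z.im / 2) := by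
  set r₀ := Real.exp (-Real.pi / 2) with hr₀
  have hr₀pos : 0 < r₀ := Real.exp_pos _
  have hr₀1 : r₀ ≤ 1 := Real.exp_le_one_iff.mpr (by linarith [Real.pi_pos])
  have hs : Summable fun n => ‖a n‖ * r₀ ^ n := by
    have h := (hf.hasSum_quarter (z := I) (by simp)).summable.norm
    refine h.congr fun n => ?_
    rw [norm_mul, norm_pow, norm_exp_pi_mul, I_im, mul_one]
  set S := ∑' n, ‖a n‖ * r₀ ^ n with hS
  have hS0 : 0 ≤ S := tsum_nonneg fun n => by positivity
  have hSle : S ≤ S / r₀ := by rw [le_div_iff₀ hr₀pos]; nlinarith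
  refine ⟨2 * (S / r₀), fun z hz => ?_⟩
  set r := Real.exp (-Real.pi * z.im / 2) with hr
  have hrpos : 0 < r := Real.exp_pos _
  have hrle : r ≤ r₀ := Real.exp_le_exp.mpr (by nlinarith [Real.pi_pos])
  have hsum := hf.hasSum_quarter (z := z) (by linarith)
  have hsum2 := hf.hasSum_quarter (z := z + 2) (by simp; linarith)
  have hnorm (n : ℕ) : ‖a n * exp (Real.pi * I * z / 2) ^ n‖ = ‖a n‖ * r ^ n := by
    rw [norm_mul, norm_pow, norm_exp_pi_mul]
  have hle (n : ℕ) (hn : n ≠ 0) : ‖a n‖ * r ^ n ≤ ‖a n‖ * r₀ ^ n * (r / r₀) := by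
    obtain ⟨n, rfl⟩ := Nat.exists_eq_succ_of_ne_zero hn
    have : r₀ ^ (n + 1) * (r / r₀) = r₀ ^ n * r := by rw [pow_succ]; field_simp
    rw [mul_assoc, this, pow_succ]
    gcongr
  have key {t : ℕ → ℂ} {x : ℂ} (ht : HasSum t x)
      (h : ∀ n, ‖t n‖ ≤ ‖a n‖ * r₀ ^ n * (2 * (r / r₀))) : ‖x‖ ≤ 2 * (S / r₀) * r := by
    have h1 := tsum_of_norm_bounded (hs.hasSum.mul_right (2 * (r / r₀))) h
    rw [ht.tsum_eq] at h1
    refine h1.trans_eq ?_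
    rw [hS]; ring
  refine ⟨?_, ?_, ?_⟩
  · have h1 := tsum_of_norm_bounded hs.hasSum fun n => by
      rw [hnorm]
      gcongr
    rw [hsum.tsum_eq] at h1
    exact h1.trans (by linarith)
  · refine key (hsum.sub (hasSum_ite_eq 0 (a 0))) fun n => ?_
    split_ifs with hn
    · subst hn
      rw [pow_zero, mul_one, sub_self, norm_zero]; positivity
    · rw [sub_zero, hnorm]
      refine (hle n hn).trans ?_
      gcongr
      linarith [div_pos hrpos hr₀pos]
  · refine key (hsum.sub hsum2) fun n => ?_
    rw [exp_add_two]
    rcases eq_or_ne n 0 with rfl | hn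
    · rw [pow_zero, pow_zero, sub_self, norm_zero]; positivity
    · refine (norm_sub_le _ _).trans ?_
      rw [neg_pow, mul_left_comm, norm_mul ((-1) ^ n), norm_pow, norm_neg, norm_one, one_pow,
        one_mul, hnorm]
      linarith [hle n hn]

end Expansion

/-! ### The plus space and modular forms of level one -/

section PlusSpace

open Complex
open UpperHalfPlane hiding I I_im

theorem theta_ne_zero (τ : ℍ) : theta τ ≠ 0 := by
  rw [theta_eq_jacobiTheta]
  exact jacobiTheta_ne_zero (by simpa using τ.im_pos)

theorem mdifferentiable_theta : MDiff theta := by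
  have h : MDiff fun τ : ℍ => (fun z => jacobiTheta (2 * z)) τ :=
    mdifferentiable_of_differentiableAt fun z hz =>
      DifferentiableAt.comp z (f := fun z => 2 * z)
        (differentiableAt_jacobiTheta (by simpa using hz)) (by fun_prop)
  convert! h using 1
  ext τ
  exact theta_eq_jacobiTheta τ

theorem quarter_theta {z : ℂ} (hz : 0 < z.im) : quarter theta z = jacobiTheta (z / 2) := by
  rw [quarter, theta_eq_jacobiTheta, coe_ofComplex_div_four hz]
  congr 1; ring

/-- The number of integers whose square is `n`. -/
noncomputable def squareCount (n : ℕ) : ℕ := Nat.card ((fun s : ℤ => s.natAbs ^ 2) ⁻¹' {n})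

theorem squareCount_zero : squareCount 0 = 1 := by
  have : (fun s : ℤ => s.natAbs ^ 2) ⁻¹' {0} = {0} := by
    ext s; simp
  rw [squareCount, this]; simp

theorem squareCount_eq_zero {n : ℕ} (h0 : n % 4 ≠ 0) (h1 : n % 4 ≠ 1) : squareCount n = 0 := by
  have : (fun s : ℤ => s.natAbs ^ 2) ⁻¹' {n} = ∅ := by
    ext s
    simp only [Set.mem_preimage, Set.mem_singleton_iff, Set.mem_empty_iff_false, iff_false]
    rintro rfl
    rw [pow_two, Nat.mul_mod] at h0 h1
    have : s.natAbs % 4 = 0 ∨ s.natAbs % 4 = 1 ∨ s.natAbs % 4 = 2 ∨ s.natAbs % 4 = 3 := by omega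
    rcases this with h | h | h | h <;> rw [h] at h0 h1 <;> omega
  rw [squareCount, this]; simp

theorem hasPlusExpansion_theta : HasPlusExpansion theta fun n => (squareCount n : ℂ) := by
  refine ⟨fun τ => ?_, fun n h0 h1 => by simp only [squareCount_eq_zero h0 h1, Nat.cast_zero]⟩
  have h := hasSum_theta τ
  rw [← theta_eq_jacobiTheta] at h
  convert! h.tsum_fiberwise (fun s : ℤ => s.natAbs ^ 2) using 1
  ext n
  have : ∀ s : (fun s : ℤ => s.natAbs ^ 2) ⁻¹' {n}, q τ ^ ((s : ℤ) ^ 2) = q τ ^ n := fun s => by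
    have hs : (s : ℤ).natAbs ^ 2 = n := s.2
    have hs' : (s : ℤ) ^ 2 = (n : ℤ) := by rw [← Int.natAbs_sq]; exact_mod_cast hs
    rw [hs', zpow_natCast]
  simp only [this]
  rw [tsum_const, nsmul_eq_mul, squareCount]

theorem apply_smul_of_theta_smul {κ : ℕ} {f : ℍ → ℂ} (hf : f ∈ modularForms κ) {γ : SL(2, ℤ)}
    (hγ : γ ∈ CongruenceSubgroup.Gamma0 4) {τ : ℍ} {c : ℂ} (h : theta (γ • τ) = c * theta τ) :
    f (γ • τ) = c ^ κ * f τ := by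
  have h1 := hf.2.1 γ hγ τ
  rw [h, mul_pow, mul_right_comm] at h1
  exact mul_right_cancel₀ (pow_ne_zero _ (theta_ne_zero τ)) h1

theorem im_div_one_sub {z : ℂ} (hz : 0 < z.im) : 0 < (z / (1 - z)).im := by
  let γ : SL(2, ℤ) := ⟨!![1, 0; -1, 1], by simp [Matrix.det_fin_two]⟩
  have h := (γ • (⟨z, hz⟩ : ℍ)).im_pos
  rw [← coe_im, coe_specialLinearGroup_apply] at h
  simpa [γ, sub_eq_add_neg, add_comm] using h

theorem one_sub_ne_zero {z : ℂ} (hz : 0 < z.im) : 1 - z ≠ 0 := by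
  intro h
  have := congrArg Complex.im h
  simp at this
  exact hz.ne' this

/-- In the variable `z = 4τ`, the map `z ↦ z / (1 - z)` comes from `Γ₀(4)`, and so does its
conjugate by translation by 2; the intermediate translate by 1 has no such law, hence the use of `z
+ 2` in `thetaDet`. All multipliers are read off from `θ`. -/
theorem exists_quarter_lower {m : ℕ} {f : ℍ → ℂ} (hf : f ∈ modularForms (2 * (2 * m) + 1)) {z : ℂ}
    (hz : 0 < z.im) : ∃ c : ℂ, c ^ 2 = 1 - z ∧
      quarter theta (z / (1 - z)) = c * quarter theta z ∧
      quarter theta (z / (1 - z) + 2) = I * c * quarter theta (z + 2) ∧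
      quarter f (z / (1 - z)) = c * (1 - z) ^ (2 * m) * quarter f z ∧
      quarter f (z / (1 - z) + 2) = I * c * (1 - z) ^ (2 * m) * quarter f (z + 2) := by
  have hz2 : 0 < (z / 2).im := by
    rw [show z / 2 = ((1 / 2 : ℝ) : ℂ) * z by push_cast; ring, im_ofReal_mul]; positivity
  have hz2' : 0 < (z + 2).im := by simpa using hz
  have hV := im_div_one_sub hz
  have hV2 : 0 < (z / (1 - z) + 2).im := by simpa using hV
  have h1z := one_sub_ne_zero hz
  obtain ⟨c, hc, h1, h2⟩ := exists_jacobiTheta_lower_add_one hz2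
  rw [mul_div_cancel₀ z two_ne_zero] at hc h1 h2
  have e1 : quarter theta (z / (1 - z)) = c * quarter theta z := by
    rw [quarter_theta hV, quarter_theta hz, ← h1]; congr 1; ring
  have e2 : quarter theta (z / (1 - z) + 2) = I * c * quarter theta (z + 2) := by
    rw [quarter_theta hV2, quarter_theta hz2', show (z + 2) / 2 = z / 2 + 1 by ring, ← h2]
    congr 1; ring
  refine ⟨c, hc, e1, e2, ?_, ?_⟩
  · let γ : SL(2, ℤ) := ⟨!![1, 0; -4, 1], by simp [Matrix.det_fin_two]⟩
    have hγ : γ ∈ CongruenceSubgroup.Gamma0 4 := by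
      rw [CongruenceSubgroup.Gamma0_mem]; simp [γ]; rfl
    have hact : γ • ofComplex (z / 4) = ofComplex (z / (1 - z) / 4) := by
      ext1
      rw [coe_specialLinearGroup_apply, coe_ofComplex_div_four hz, coe_ofComplex_div_four hV]
      simp only [γ]
      suffices (z / 4) / (-4 * (z / 4) + 1) = z / (1 - z) / 4 by simpa using this
      rw [show -4 * (z / 4) + 1 = 1 - z by ring]
      ring
    have := apply_smul_of_theta_smul hf hγ (τ := ofComplex (z / 4)) (c := c) (by rw [hact]; exact e1)
    rw [hact] at this
    rw [quarter, this, quarter]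
    rw [pow_succ, pow_mul, hc]; ring
  · let γ : SL(2, ℤ) := ⟨!![-1, 1; -4, 3], by simp [Matrix.det_fin_two]⟩
    have hγ : γ ∈ CongruenceSubgroup.Gamma0 4 := by
      rw [CongruenceSubgroup.Gamma0_mem]; simp [γ]; rfl
    have hact : γ • ofComplex ((z + 2) / 4) = ofComplex ((z / (1 - z) + 2) / 4) := by
      ext1
      rw [coe_specialLinearGroup_apply, coe_ofComplex_div_four hz2', coe_ofComplex_div_four hV2]
      simp only [γ]
      have h3 : -4 * ((z + 2) / 4) + 3 = 1 - z := by ring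
      have h4 : -1 * ((z + 2) / 4) + 1 = (2 - z) / 4 := by ring
      suffices (-1 * ((z + 2) / 4) + 1) / (-4 * ((z + 2) / 4) + 3) = (z / (1 - z) + 2) / 4 by
        simpa using this
      rw [h3, h4]
      field_simp
      ring
    have := apply_smul_of_theta_smul hf hγ (τ := ofComplex ((z + 2) / 4)) (c := I * c)
      (by rw [hact]; exact e2)
    rw [hact] at this
    rw [quarter, this, quarter]
    rw [pow_succ, pow_mul, mul_pow, I_sq, hc, mul_pow, pow_mul, neg_one_sq, one_pow]; ring

/-- A determinant measuring the failure of `f` to be a multiple of `θ`. -/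
noncomputable def thetaDet (f : ℍ → ℂ) (z : ℂ) : ℂ :=
  quarter f z * quarter theta (z + 2) - quarter f (z + 2) * quarter theta z

variable {m : ℕ} {f : ℍ → ℂ} {a : ℕ → ℂ}

/-- By the recursion, `thetaDet` is `1 + I` times the Casoratian of two solutions; a shift
multiplies it by `I`, the product of the eigenvalues `1` and `I`. -/
theorem HasPlusExpansion.thetaDet_add_one (ha : HasPlusExpansion f a) {z : ℂ} (hz : 0 < z.im) :
    thetaDet f (z + 1) = I * thetaDet f z := by
  have hz1 : 0 < (z + 1).im := by simpa using hz
  have h0 := ha.quarter_add_two hz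
  have h1 := ha.quarter_add_two hz1
  have t0 := hasPlusExpansion_theta.quarter_add_two hz
  have t1 := hasPlusExpansion_theta.quarter_add_two hz1
  rw [show z + 1 + 1 = z + 2 by ring] at h1 t1
  rw [thetaDet, thetaDet, h1, t1, h0, t0]
  linear_combination 0 * I_sq

/-- `S = T L T` with `L : z ↦ z / (1 - z)`, so the laws under `T` and `L` give the one under `S`. -/
theorem neg_one_div_eq {z : ℂ} (hz : 0 < z.im) : -1 / z = (z + 1) / (1 - (z + 1)) + 1 := by
  have hz0 : z ≠ 0 := by rintro rfl; simp at hz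
  rw [show 1 - (z + 1) = -z by ring]
  field_simp
  ring

theorem thetaDet_lower (hf : f ∈ modularForms (2 * (2 * m) + 1)) {z : ℂ} (hz : 0 < z.im) :
    thetaDet f (z / (1 - z)) = I * (1 - z) ^ (2 * m + 1) * thetaDet f z := by
  obtain ⟨c, hc, h1, h2, h3, h4⟩ := exists_quarter_lower hf hz
  rw [thetaDet, h1, h2, h3, h4, thetaDet, pow_succ, ← hc]
  ring

theorem HasPlusExpansion.thetaDet_neg_one_div (ha : HasPlusExpansion f a)
    (hf : f ∈ modularForms (2 * (2 * m) + 1)) {z : ℂ} (hz : 0 < z.im) :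
    thetaDet f (-1 / z) = I * z ^ (2 * m + 1) * thetaDet f z := by
  have hz1 : 0 < (z + 1).im := by simpa using hz
  rw [neg_one_div_eq hz, ha.thetaDet_add_one (im_div_one_sub hz1), thetaDet_lower hf hz1,
    ha.thetaDet_add_one hz, show 1 - (z + 1) = -z by ring, neg_pow,
    Odd.neg_one_pow (odd_two_mul_add_one m)]
  linear_combination (-I * z ^ (2 * m + 1) * thetaDet f z) * I_sq

theorem differentiableAt_thetaDet (hf : MDiff f) {z : ℂ} (hz : 0 < z.im) :
    DifferentiableAt ℂ (thetaDet f) z := by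
  have hz2 : 0 < (z + 2).im := by simpa using hz
  have h (g : ℍ → ℂ) (hg : MDiff g) : DifferentiableAt ℂ (fun z => quarter g (z + 2)) z :=
    DifferentiableAt.comp z (f := fun z => z + 2) (differentiableAt_quarter hg hz2) (by fun_prop)
  exact ((differentiableAt_quarter hf hz).mul (h _ mdifferentiable_theta)).sub
    ((h _ hf).mul (differentiableAt_quarter mdifferentiable_theta hz))

theorem HasPlusExpansion.thetaDet_isBigO (ha : HasPlusExpansion f a) :
    (fun τ : ℍ => thetaDet f τ) =O[atImInfty] fun τ : ℍ => Real.exp (-Real.pi * τ.im / 2) := by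
  obtain ⟨C, hC⟩ := ha.exists_bound
  obtain ⟨K, hK⟩ := hasPlusExpansion_theta.exists_bound
  refine Asymptotics.IsBigO.of_bound (C * K + C * K) ?_
  rw [atImInfty, Filter.eventually_comap]
  filter_upwards [Filter.eventually_ge_atTop 1] with y hy τ hτ
  have h1 : 1 ≤ (τ : ℂ).im := by rw [coe_im, hτ]; exact hy
  obtain ⟨c1, -, c2⟩ := hC τ h1
  obtain ⟨k1, -, k2⟩ := hK τ h1
  rw [Real.norm_of_nonneg (Real.exp_pos _).le, ← coe_im]
  have e : thetaDet f τ = (quarter f τ - quarter f (τ + 2)) * quarter theta τ -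
      quarter f τ * (quarter theta τ - quarter theta (τ + 2)) := by rw [thetaDet]; ring
  have hC0 : 0 ≤ C := (norm_nonneg _).trans c1
  have hK0 : 0 ≤ K := (norm_nonneg _).trans k1
  rw [e]
  refine (norm_sub_le _ _).trans ?_
  rw [norm_mul, norm_mul]
  calc _ ≤ C * Real.exp (-Real.pi * (τ : ℂ).im / 2) * K +
        C * (K * Real.exp (-Real.pi * (τ : ℂ).im / 2)) := by gcongr
    _ = _ := by ring

/-- `thetaDet` behaves as weight `2m + 1`, has the multipliers of `η ^ 6` and decays at least as
fast, so the quotient is holomorphic, bounded and of weight `2m - 2`. -/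
theorem HasPlusExpansion.exists_thetaDet_eq (ha : HasPlusExpansion f a)
    (hf : f ∈ modularForms (2 * (2 * m) + 1)) :
    ∃ M : ModularForm 𝒮ℒ (2 * m - 2 : ℤ), ∀ τ : ℍ, thetaDet f τ = M τ * ModularForm.eta τ ^ 6 := by
  have hη (z : ℂ) (hz : 0 < z.im) : ModularForm.eta z ^ 6 ≠ 0 :=
    pow_ne_zero _ (ModularForm.eta_ne_zero hz)
  have : ∃ M : ModularForm 𝒮ℒ (2 * m - 2 : ℤ), ∀ τ : ℍ, M τ = thetaDet f τ / ModularForm.eta τ ^ 6 := by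
    refine exists_modularForm_levelOne (F := fun z => thetaDet f z / ModularForm.eta z ^ 6)
      (fun z hz => ?_) (fun z hz => ?_) (fun z hz => ?_) ?_
    · exact (differentiableAt_thetaDet hf.1 hz).div
        ((ModularForm.differentiableAt_eta_of_mem_upperHalfPlaneSet hz).pow 6) (hη z hz)
    · rw [ha.thetaDet_add_one hz, eta_pow_six_add_one, mul_div_mul_left _ _ I_ne_zero]
    · have hz0 : z ≠ 0 := by rintro rfl; simp at hz
      have := hη z hz
      rw [ha.thetaDet_neg_one_div hf hz, eta_pow_six_neg_one_div hz]
      have : z ^ (2 * m + 1) = z ^ (2 * m - 2 : ℤ) * z ^ 3 := by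
        rw [← zpow_natCast, ← zpow_natCast, ← zpow_add₀ hz0]; congr 1; push_cast; ring
      rw [this]
      field_simp
    · have h := ha.thetaDet_isBigO.trans exp_isBigO_eta_pow_six
      obtain ⟨K, hK⟩ := h.bound
      refine Asymptotics.IsBigO.of_bound K ?_
      filter_upwards [hK] with τ hτ
      rw [norm_div, Pi.one_apply, norm_one, mul_one, div_le_iff₀ (norm_pos_iff.mpr (hη τ τ.im_pos))]
      exact hτ
  obtain ⟨M, hM⟩ := this
  exact ⟨M, fun τ => by rw [hM, div_mul_cancel₀ _ (hη τ τ.im_pos)]⟩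

/-- If the determinant vanishes, `g / Θ` is invariant under translation by 1; the multiplier `c`
cancels in the quotient under `L`, leaving weight `2m`. -/
theorem HasPlusExpansion.exists_eq_theta_mul (ha : HasPlusExpansion f a)
    (hf : f ∈ modularForms (2 * (2 * m) + 1)) (h0 : ∀ τ : ℍ, thetaDet f τ = 0) :
    ∃ M : ModularForm 𝒮ℒ (2 * m : ℤ), f = theta * levelRaise M 4 := by
  have h0' (z : ℂ) (hz : 0 < z.im) : thetaDet f z = 0 := h0 ⟨z, hz⟩
  have hΘ (z : ℂ) : quarter theta z ≠ 0 := theta_ne_zero _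
  have : ∃ M : ModularForm 𝒮ℒ (2 * m : ℤ), ∀ τ : ℍ, M τ = quarter f τ / quarter theta τ := by
    have hT (z : ℂ) (hz : 0 < z.im) : quarter f (z + 1) / quarter theta (z + 1) =
        quarter f z / quarter theta z := by
      have h := ha.quarter_add_two hz
      have t := hasPlusExpansion_theta.quarter_add_two hz
      have hd := h0' z hz
      rw [thetaDet, h, t] at hd
      rw [div_eq_div_iff (hΘ _) (hΘ _)]
      have h2 : (1 + I) ≠ 0 := by
        intro h
        have := congrArg Complex.re h
        norm_num at this
      refine mul_left_cancel₀ h2 ?_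
      linear_combination -hd
    refine exists_modularForm_levelOne (F := fun z => quarter f z / quarter theta z)
      (fun z hz => ?_) hT (fun z hz => ?_) ?_
    · exact (differentiableAt_quarter hf.1 hz).div
        (differentiableAt_quarter mdifferentiable_theta hz) (hΘ z)
    · have hz1 : 0 < (z + 1).im := by simpa using hz
      rw [neg_one_div_eq hz, hT _ (im_div_one_sub hz1)]
      obtain ⟨c, hc, h1, -, h3, -⟩ := exists_quarter_lower hf hz1
      have hc0 : c ≠ 0 := by
        rintro rfl
        have := hΘ ((z + 1) / (1 - (z + 1)))
        rw [h1, zero_mul] at this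
        exact this rfl
      rw [h1, h3, mul_assoc c, mul_div_mul_left _ _ hc0, mul_div_assoc, hT z hz,
        show 1 - (z + 1) = -z by ring, Even.neg_pow (even_two_mul m)]
      norm_cast
    · obtain ⟨C, hC⟩ := ha.exists_bound
      refine Asymptotics.IsBigO.of_bound (C * 3) ?_
      rw [atImInfty, Filter.eventually_comap]
      filter_upwards [Filter.eventually_ge_atTop 2] with y hy τ hτ
      have h1 : 2 ≤ (τ : ℂ).im := by rw [coe_im, hτ]; exact hy
      have h2 : 1 ≤ ((τ : ℂ) / 2).im := by
        rw [show (τ : ℂ) / 2 = ((1 / 2 : ℝ) : ℂ) * τ by push_cast; ring, im_ofReal_mul]; linarith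
      have h3 := one_third_le_norm_jacobiTheta h2
      rw [← quarter_theta τ.im_pos] at h3
      have h4 := (hC τ (by linarith)).1
      rw [norm_div, Pi.one_apply, norm_one, mul_one, div_le_iff₀ (by linarith)]
      nlinarith [(norm_nonneg _).trans h4]
  obtain ⟨M, hM⟩ := this
  refine ⟨M, funext fun τ => ?_⟩
  rw [Pi.mul_apply, levelRaise, hM]
  have hd : (dilate 4 τ : ℂ) = 4 * τ := rfl
  rw [hd, quarter_four_mul, quarter_four_mul, mul_div_cancel₀ _ (theta_ne_zero τ)]

end PlusSpace

/-! ### Dimension of the plus spaces of weights `5/2` and `9/2` -/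

section PlusSpace

open Complex
open UpperHalfPlane hiding I I_im

theorem modularForm_weight_two_eq_zero (M : ModularForm 𝒮ℒ 2) : M = 0 :=
  rank_zero_iff_forall_zero.mp ModularForm.levelOne_weight_two_rank_zero M

/-- `thetaDet f` is `η ^ 6` times a form of weight 0, a constant. This constant depends linearly on
`f` and vanishes only for `f = 0`, since otherwise `f / θ` would come from a nonzero form of weight
2. -/
theorem exists_eq_smul_of_mem_plusSpace_two {f g : ℍ → ℂ} (hg : g ∈ plusSpace 2) (hg0 : g ≠ 0)
    (hf : f ∈ plusSpace 2) : ∃ c : ℂ, f = c • g := by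
  have h2 : (2 : ℕ) = 2 * 1 := rfl
  have key {f : ℍ → ℂ} (hf : f ∈ plusSpace 2) (h0 : ∀ τ : ℍ, thetaDet f τ = 0) : f = 0 := by
    rw [h2, mem_plusSpace_iff] at hf
    obtain ⟨hf, a, ha⟩ := hf
    obtain ⟨M, hM⟩ := ha.exists_eq_theta_mul hf h0
    have : M = 0 := modularForm_weight_two_eq_zero M
    rw [hM, this]
    ext τ
    simp [levelRaise]
  have hconst {f : ℍ → ℂ} (hf : f ∈ plusSpace 2) :
      ∃ c : ℂ, ∀ τ : ℍ, thetaDet f τ = c * ModularForm.eta τ ^ 6 := by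
    rw [h2, mem_plusSpace_iff] at hf
    obtain ⟨hf, a, ha⟩ := hf
    obtain ⟨M, hM⟩ := ha.exists_thetaDet_eq hf
    obtain ⟨c, hc⟩ := ModularFormClass.levelOne_weight_zero_const (F := ModularForm 𝒮ℒ 0) M
    refine ⟨c, fun τ => ?_⟩
    have : M τ = c := congrFun hc τ
    rw [hM, this]
  obtain ⟨c, hc⟩ := hconst hf
  obtain ⟨d, hd⟩ := hconst hg
  have hd0 : d ≠ 0 := by
    rintro rfl
    exact hg0 (key hg fun τ => by rw [hd, zero_mul])
  refine ⟨c / d, ?_⟩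
  have hsub : f - (c / d) • g ∈ plusSpace 2 :=
    Submodule.sub_mem _ hf (Submodule.smul_mem _ _ hg)
  refine sub_eq_zero.mp (key hsub fun τ => ?_)
  have : thetaDet (f - (c / d) • g) τ = thetaDet f τ - c / d * thetaDet g τ := by
    simp only [thetaDet, quarter, Pi.sub_apply, Pi.smul_apply, smul_eq_mul]; ring
  rw [this, hc, hd]
  field_simp
  ring

/-- Here `thetaDet f / η ^ 6` has weight 2, so it is zero, and `f = θ N[4]` with `N` in the line of
level one forms of weight 4. -/
theorem exists_eq_smul_of_mem_plusSpace_four {f : ℍ → ℂ} (hf : f ∈ plusSpace 4) :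
    ∃ c : ℂ, f = c • (theta * levelRaise ModularForm.E₄ 4) := by
  rw [show (4 : ℕ) = 2 * 2 from rfl, mem_plusSpace_iff] at hf
  obtain ⟨hf, a, ha⟩ := hf
  obtain ⟨M, hM⟩ := ha.exists_thetaDet_eq hf
  have h0 (τ : ℍ) : thetaDet f τ = 0 := by
    have : M = 0 := modularForm_weight_two_eq_zero M
    rw [hM, this]; simp
  obtain ⟨N, hN⟩ := ha.exists_eq_theta_mul hf h0
  have hE : (ModularForm.E₄ : ModularForm 𝒮ℒ 4) ≠ 0 := EisensteinSeries.E_ne_zero _ ⟨2, rfl⟩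
  obtain ⟨c, hc⟩ := exists_smul_eq_of_finrank_eq_one
    (Module.rank_eq_one_iff_finrank_eq_one.mp ModularForm.levelOne_weight_four_rank_one) hE N
  refine ⟨c, ?_⟩
  rw [hN]
  ext τ
  have : N (dilate 4 τ) = c * ModularForm.E₄ (dilate 4 τ) := by
    rw [← hc]; rfl
  simp only [Pi.mul_apply, Pi.smul_apply, levelRaise, smul_eq_mul]
  rw [this]; ring

/-- A one-dimensional submodule has the expected basis. -/
theorem exists_basis_of_forall_smul {V : Submodule ℂ (ℍ → ℂ)} {g : ℍ → ℂ} (hg : g ∈ V) (hg0 : g ≠ 0)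
    (h : ∀ f ∈ V, ∃ c : ℂ, f = c • g) : ∃ b : Module.Basis Unit ℂ V, (b () : ℍ → ℂ) = g := by
  let v : Unit → V := fun _ => ⟨g, hg⟩
  have hli : LinearIndependent ℂ v := LinearIndependent.of_subsingleton () (by
    simpa [v, Subtype.ext_iff] using hg0)
  have hsp : ⊤ ≤ Submodule.span ℂ (Set.range v) := by
    rintro ⟨f, hf⟩ -
    obtain ⟨c, hc⟩ := h f hf
    have : (⟨f, hf⟩ : V) = c • v () := Subtype.ext hc
    rw [this]
    exact Submodule.smul_mem _ _ (Submodule.subset_span ⟨(), rfl⟩)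
  exact ⟨Module.Basis.mk hli hsp, by rw [Module.Basis.mk_apply]⟩

end PlusSpace

/-! ### The weight of `θ ^ 4` -/

section ThetaPowFour

open Complex
open scoped ModularForm
open UpperHalfPlane hiding I I_im

theorem theta_smul_of_one_zero {γ : SL(2, ℤ)} (h : γ 1 0 = 0) (τ : ℍ) : theta (γ • τ) = theta τ := by
  have hdet := γ.det_coe
  rw [Matrix.det_fin_two, h, mul_zero, sub_zero] at hdet
  have h1 : (γ 0 0) * (γ 1 1) = 1 := hdet
  have hsq : (γ 0 0 = 1 ∧ γ 1 1 = 1) ∨ (γ 0 0 = -1 ∧ γ 1 1 = -1) := by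
    rcases Int.mul_eq_one_iff_eq_one_or_neg_one.mp h1 with h | h <;> simp [h]
  rw [theta_eq_jacobiTheta, theta_eq_jacobiTheta, coe_specialLinearGroup_apply]
  rcases hsq with ⟨h2, h3⟩ | ⟨h2, h3⟩
  · rw [← jacobiTheta_add_two_mul (2 * (τ : ℂ)) (γ 0 1)]
    congr 1
    simp [h, h2, h3]
    ring
  · rw [← jacobiTheta_add_two_mul (2 * (τ : ℂ)) (-γ 0 1)]
    congr 1
    simp [h, h2, h3]
    ring

/-- The lower triangular unipotent element of `Γ₀(4)` with entry `4 m`. -/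
def lowerMatrix (m : ℤ) : SL(2, ℤ) := ⟨!![1, 0; 4 * m, 1], by simp [Matrix.det_fin_two]⟩

theorem coe_lowerMatrix (m : ℤ) :
    (lowerMatrix m : Matrix (Fin 2) (Fin 2) ℤ) = !![1, 0; 4 * m, 1] := rfl

theorem theta_pow_four_lower (m : ℤ) (τ : ℍ) :
    theta (lowerMatrix m • τ) ^ 4 = (4 * m * τ + 1) ^ 2 * theta τ ^ 4 := by
  obtain ⟨c, -, hc, h⟩ := exists_jacobiTheta_lower (z := 2 * τ) (by simpa using τ.im_pos) m
  have e : 2 * (m : ℂ) * (2 * τ) + 1 = 4 * m * τ + 1 := by ring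
  rw [e] at hc h
  rw [theta_eq_jacobiTheta, theta_eq_jacobiTheta, ← hc, ← pow_mul, ← mul_pow, ← h,
    coe_specialLinearGroup_apply]
  congr 2
  simp [lowerMatrix]
  ring

theorem slash_two_eq_iff {F : ℍ → ℂ} {γ : SL(2, ℤ)} :
    F ∣[(2 : ℤ)] γ = F ↔ ∀ τ : ℍ, F (γ • τ) = denom γ τ ^ 2 * F τ := by
  rw [funext_iff]
  refine forall_congr' fun τ => ?_
  have := denom_ne_zero γ τ
  rw [ModularForm.SL_slash_apply, zpow_neg, mul_inv_eq_iff_eq_mul₀ (zpow_ne_zero _ this),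
    mul_comm (F τ)]
  rfl

theorem slash_mul_eq_self {F : ℍ → ℂ} {k : ℤ} {γ δ : SL(2, ℤ)} (hγ : F ∣[k] γ = F) (hδ : F ∣[k] δ = F) :
    F ∣[k] (γ * δ) = F := by
  rw [SlashAction.slash_mul, hγ, hδ]

theorem slash_eq_self_of_mul {F : ℍ → ℂ} {k : ℤ} {γ δ : SL(2, ℤ)} (h : F ∣[k] (γ * δ) = F)
    (hδ : F ∣[k] δ = F) : F ∣[k] γ = F := by
  have h1 : F ∣[k] δ⁻¹ = F := by
    conv_lhs => rw [← hδ]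
    rw [← SlashAction.slash_mul, mul_inv_cancel, SlashAction.slash_one]
  rw [← mul_inv_cancel_right γ δ]
  exact slash_mul_eq_self h h1

theorem theta_pow_four_slash_of_one_zero {γ : SL(2, ℤ)} (h : γ 1 0 = 0) :
    (theta ^ 4) ∣[(2 : ℤ)] γ = theta ^ 4 := by
  have hdet := γ.det_coe
  rw [Matrix.det_fin_two, h, mul_zero, sub_zero] at hdet
  have h1 : ((γ 1 1 : ℤ) : ℂ) ^ 2 = 1 := by
    rcases Int.mul_eq_one_iff_eq_one_or_neg_one.mp hdet with ⟨-, h⟩ | ⟨-, h⟩ <;> simp [h]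
  rw [slash_two_eq_iff]
  intro τ
  rw [Pi.pow_apply, Pi.pow_apply, theta_smul_of_one_zero h, ModularGroup.denom_apply, h]
  simp [h1]

theorem exists_two_mul_abs_add_mul_le (a : ℤ) {c : ℤ} (hc : c ≠ 0) : ∃ n : ℤ, 2 * |a + n * c| ≤ |c| := by
  refine ⟨-round ((a : ℚ) / c), ?_⟩
  have h := abs_sub_round ((a : ℚ) / c)
  have hc' : (c : ℚ) ≠ 0 := by exact_mod_cast hc
  have hpos : 0 < |(c : ℚ)| := abs_pos.mpr hc'
  have h1 : |(a : ℚ) - round ((a : ℚ) / c) * c| ≤ 1 / 2 * |(c : ℚ)| := by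
    have : (a : ℚ) - round ((a : ℚ) / c) * c = (a / c - round ((a : ℚ) / c)) * c := by
      field_simp
    rw [this, abs_mul]
    gcongr
  have h2 : (2 : ℚ) * |(a : ℚ) + (-round ((a : ℚ) / c) : ℤ) * c| ≤ |(c : ℚ)| := by
    push_cast
    rw [neg_mul, ← sub_eq_add_neg]
    linarith
  exact_mod_cast h2

/-- Descent on the lower left entry: `Γ₀(4)` is reduced to upper triangular elements by powers of
`T` and of the lower unipotent with entry 4. -/
theorem theta_pow_four_slash {γ : SL(2, ℤ)} (hγ : γ ∈ CongruenceSubgroup.Gamma0 4) :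
    (theta ^ 4) ∣[(2 : ℤ)] γ = theta ^ 4 := by
  generalize hN : (γ 1 0).natAbs = N
  induction N using Nat.strong_induction_on generalizing γ with
  | _ N ih =>
    by_cases hc : γ 1 0 = 0
    · exact theta_pow_four_slash_of_one_zero hc
    have h4 : (4 : ℤ) ∣ γ 1 0 := by
      rw [CongruenceSubgroup.Gamma0_mem] at hγ
      exact (ZMod.intCast_zmod_eq_zero_iff_dvd _ 4).mp hγ
    have hdet := γ.det_coe
    rw [Matrix.det_fin_two] at hdet
    obtain ⟨n, hn⟩ := exists_two_mul_abs_add_mul_le (γ 1 1) hc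
    set d := γ 1 1 + n * γ 1 0 with hd
    have hodd : d % 2 = 1 := by
      have h2 : (γ 0 0 * d) % 2 = 1 := by
        obtain ⟨e, he⟩ := h4
        have : γ 0 0 * d = 1 + 2 * (2 * e * (γ 0 1 + n * γ 0 0)) := by
          rw [hd]
          linear_combination hdet + (γ 0 1 + n * γ 0 0) * he
        omega
      rcases Int.emod_two_eq_zero_or_one d with h | h
      · rw [Int.mul_emod, h] at h2
        simp at h2
      · exact h
    have hd0 : 4 * d ≠ 0 := by omega
    obtain ⟨m, hm⟩ := exists_two_mul_abs_add_mul_le (γ 1 0) hd0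
    have e1 : (γ * (ModularGroup.T ^ n * lowerMatrix m)) 1 0 = γ 1 0 + m * (4 * d) := by
      rw [Matrix.SpecialLinearGroup.coe_mul, Matrix.SpecialLinearGroup.coe_mul,
        ModularGroup.coe_T_zpow, coe_lowerMatrix, Matrix.mul_apply, Fin.sum_univ_two]
      simp [hd]
      ring
    have hmem : γ * (ModularGroup.T ^ n * lowerMatrix m) ∈ CongruenceSubgroup.Gamma0 4 := by
      rw [CongruenceSubgroup.Gamma0_mem, e1]
      refine (ZMod.intCast_zmod_eq_zero_iff_dvd _ 4).mpr ?_
      exact dvd_add h4 ⟨m * d, by ring⟩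
    refine slash_eq_self_of_mul (ih _ ?_ hmem rfl) (slash_mul_eq_self
      (theta_pow_four_slash_of_one_zero (by simp [ModularGroup.coe_T_zpow])) ?_)
    -- Nearest-integer division gives `2|d| ≤ |c|` and a new entry of size at most `2|d|`. As `4 ∣
    -- c` and `d` is odd, `2|d| ≠ |c|`, so the entry strictly decreases.
    · rw [e1]
      generalize γ 1 0 + m * (4 * d) = x at *
      simp only [Int.abs_eq_natAbs] at hm hn
      omega
    · rw [slash_two_eq_iff]
      intro τ
      rw [Pi.pow_apply, Pi.pow_apply, theta_pow_four_lower, ModularGroup.denom_apply]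
      simp [lowerMatrix]

theorem theta_pow_four_smul {γ : SL(2, ℤ)} (hγ : γ ∈ CongruenceSubgroup.Gamma0 4) (τ : ℍ) :
    theta (γ • τ) ^ 4 = denom γ τ ^ 2 * theta τ ^ 4 :=
  slash_two_eq_iff.mp (theta_pow_four_slash hγ) τ

end ThetaPowFour

/-! ### Transformation laws under `Γ₀(4)` -/

section Transformation

open Complex
open scoped ModularForm
open UpperHalfPlane hiding I I_im

theorem coe_dilate (d : ℕ+) (τ : ℍ) : (dilate d τ : ℂ) = d * τ := rfl

theorem exists_SL_two_eq {a b c d : ℤ} (h : a * d - b * c = 1) :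
    ∃ δ : SL(2, ℤ), δ 0 0 = a ∧ δ 0 1 = b ∧ δ 1 0 = c ∧ δ 1 1 = d :=
  ⟨⟨!![a, b; c, d], by rwa [Matrix.det_fin_two_of]⟩, rfl, rfl, rfl, rfl⟩

/-- `δ` is `γ` conjugated by `diag(4, 1)`; it is integral because `4` divides the lower left entry.
-/
theorem exists_dilate_four_smul_of_mem_Gamma0 {γ : SL(2, ℤ)} (hγ : γ ∈ CongruenceSubgroup.Gamma0 4) :
    ∃ δ : SL(2, ℤ), 4 * δ 1 0 = γ 1 0 ∧ ∀ τ : ℍ, dilate 4 (γ • τ) = δ • dilate 4 τ ∧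
      denom δ (dilate 4 τ) = denom γ τ := by
  rw [CongruenceSubgroup.Gamma0_mem] at hγ
  obtain ⟨c, hc⟩ : (4 : ℤ) ∣ γ 1 0 := (ZMod.intCast_zmod_eq_zero_iff_dvd _ 4).mp hγ
  have hdet := γ.det_coe
  rw [Matrix.det_fin_two] at hdet
  obtain ⟨δ, h00, h01, h10, h11⟩ := exists_SL_two_eq (a := γ 0 0) (b := 4 * γ 0 1) (c := c)
    (d := γ 1 1) (by linear_combination hdet + γ 0 1 * hc)
  refine ⟨δ, by rw [h10, hc], fun τ => ⟨?_, ?_⟩⟩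
  · ext1
    rw [coe_specialLinearGroup_apply, coe_dilate, coe_dilate, coe_specialLinearGroup_apply]
    simp only [h00, h01, h10, h11, hc]
    push_cast
    simp
    ring
  · rw [ModularGroup.denom_apply, ModularGroup.denom_apply, h10, h11, hc, coe_dilate]
    push_cast
    simp
    ring

theorem theta_pow_eight_smul {γ : SL(2, ℤ)} (hγ : γ ∈ CongruenceSubgroup.Gamma0 4) (τ : ℍ) :
    theta (γ • τ) ^ 8 = denom γ τ ^ 4 * theta τ ^ 8 := by
  have := theta_pow_four_smul hγ τ
  linear_combination (theta (γ • τ) ^ 4 + denom γ τ ^ 2 * theta τ ^ 4) * this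

theorem E2_smul (γ : SL(2, ℤ)) (τ : ℍ) : EisensteinSeries.E2 (γ • τ) =
    denom γ τ ^ 2 * EisensteinSeries.E2 τ - 6 * I / Real.pi * γ 1 0 * denom γ τ := by
  have h := congrFun (EisensteinSeries.E2_slash_action γ) τ
  have h0 : denom γ τ ≠ 0 := denom_ne_zero γ τ
  have hpi : (Real.pi : ℂ) ≠ 0 := by exact_mod_cast Real.pi_ne_zero
  rw [ModularForm.SL_slash_apply, zpow_neg, mul_inv_eq_iff_eq_mul₀ (zpow_ne_zero _ h0)] at h
  rw [h]
  simp only [Pi.sub_apply, Pi.smul_apply, EisensteinSeries.D2, riemannZeta_two, smul_eq_mul]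
  field_simp

theorem E₄_smul (γ : SL(2, ℤ)) (τ : ℍ) :
    ModularForm.E₄ (γ • τ) = denom γ τ ^ 4 * ModularForm.E₄ τ := by
  have h := congrFun (SlashInvariantFormClass.slash_action_eq ModularForm.E₄ (γ : GL (Fin 2) ℝ)
    ⟨γ, rfl⟩) τ
  have h0 : denom γ τ ≠ 0 := denom_ne_zero γ τ
  rw [← ModularForm.SL_slash, ModularForm.SL_slash_apply, zpow_neg,
    mul_inv_eq_iff_eq_mul₀ (zpow_ne_zero _ h0), mul_comm] at h
  exact h

theorem theta_mul_E₄_transform {γ : SL(2, ℤ)} (hγ : γ ∈ CongruenceSubgroup.Gamma0 4) (τ : ℍ) :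
    (theta * levelRaise ModularForm.E₄ 4) (γ • τ) * theta τ ^ 9 =
      theta (γ • τ) ^ 9 * (theta * levelRaise ModularForm.E₄ 4) τ := by
  obtain ⟨δ, -, hδ⟩ := exists_dilate_four_smul_of_mem_Gamma0 hγ
  obtain ⟨h1, h2⟩ := hδ τ
  simp only [Pi.mul_apply, levelRaise]
  rw [h1, E₄_smul, h2]
  linear_combination (-theta (γ • τ) * theta τ * ModularForm.E₄ (dilate 4 τ)) *
    theta_pow_eight_smul hγ τ

/-- Obtained by differentiating the weight 2 law of `θ ^ 4`, which avoids any choice of the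
half-integral automorphy factor. -/
theorem normalizedDeriv_theta_smul {γ : SL(2, ℤ)} (hγ : γ ∈ CongruenceSubgroup.Gamma0 4) (τ : ℍ) :
    theta (γ • τ) ^ 3 * Derivative.normalizedDerivOfComplex theta (γ • τ) =
      denom γ τ ^ 4 * theta τ ^ 3 * Derivative.normalizedDerivOfComplex theta τ +
      (2 * (2 * Real.pi * I))⁻¹ * γ 1 0 * denom γ τ ^ 3 * theta τ ^ 4 := by
  have hF : MDiff (theta ^ 4) := mdifferentiable_theta.pow 4
  have h := congrFun (Derivative.normalizedDerivOfComplex_SL_slash (k := 2) hF (γ := γ)) τ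
  have h0 : denom γ τ ≠ 0 := denom_ne_zero γ τ
  rw [theta_pow_four_slash hγ, Pi.sub_apply, ModularForm.SL_slash_apply,
    Derivative.normalizedDerivOfComplex_pow _ _ mdifferentiable_theta] at h
  have e : (-(2 + 2) : ℤ) = -(4 : ℕ) := by norm_num
  rw [e, zpow_neg, zpow_natCast] at h
  simp only [Pi.mul_apply, Pi.pow_apply, Pi.ofNat_apply, Nat.cast_ofNat, Int.cast_ofNat,
    Nat.reduceSub] at h
  rw [mul_inv (2 : ℂ)]
  field_simp at h ⊢
  linear_combination -h

/-- `E₂` at `4τ` has an anomaly with lower left entry `γ 1 0 / 4`; after multiplication by `θ` it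
equals the anomaly of `6 D(θ)`. -/
theorem theta_mul_E2_sub_transform {γ : SL(2, ℤ)} (hγ : γ ∈ CongruenceSubgroup.Gamma0 4) (τ : ℍ) :
    (theta * levelRaise EisensteinSeries.E2 4
      - (6 : ℂ) • Derivative.normalizedDerivOfComplex theta) (γ • τ) * theta τ ^ 5 =
      theta (γ • τ) ^ 5 * (theta * levelRaise EisensteinSeries.E2 4
      - (6 : ℂ) • Derivative.normalizedDerivOfComplex theta) τ := by
  obtain ⟨δ, hc, hδ⟩ := exists_dilate_four_smul_of_mem_Gamma0 hγ
  obtain ⟨h1, h2⟩ := hδ τ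
  have hD := normalizedDeriv_theta_smul hγ τ
  have hθ := theta_pow_four_smul hγ τ
  have hθ0 := theta_ne_zero (γ • τ)
  have hθ1 := theta_ne_zero τ
  have hpi : (Real.pi : ℂ) ≠ 0 := by exact_mod_cast Real.pi_ne_zero
  have hc' : (γ 1 0 : ℂ) = 4 * δ 1 0 := by exact_mod_cast hc.symm
  simp only [Pi.mul_apply, Pi.sub_apply, Pi.smul_apply, smul_eq_mul, levelRaise]
  rw [h1, E2_smul, h2]
  rw [hc'] at hD
  have hinv : (2 * (2 * Real.pi * I))⁻¹ = -I / (4 * Real.pi) := by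
    rw [inv_eq_iff_eq_inv, inv_div]
    field_simp
    linear_combination (4 : ℂ) * I_sq
  rw [hinv] at hD
  generalize denom γ τ = j at *
  generalize Derivative.normalizedDerivOfComplex theta (γ • τ) = D' at *
  generalize Derivative.normalizedDerivOfComplex theta τ = D at *
  generalize theta (γ • τ) = t' at *
  generalize theta τ = t at *
  generalize EisensteinSeries.E2 (dilate 4 τ) = e at *
  -- With the anomalies gone, `θ ^ 3` times the form has weight 4; comparison with `θ ^ 8` of weight
  -- 4 gives the stated law.
  have key : t' ^ 3 * (t' * (j ^ 2 * e - 6 * I / Real.pi * δ 1 0 * j) - 6 * D') =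
      j ^ 4 * t ^ 3 * (t * e - 6 * D) := by
    have : t' ^ 3 * (t' * (j ^ 2 * e - 6 * I / Real.pi * δ 1 0 * j) - 6 * D') =
      t' ^ 4 * (j ^ 2 * e - 6 * I / Real.pi * δ 1 0 * j) - 6 * (t' ^ 3 * D') := by ring
    rw [this, hθ, hD]
    field_simp
    ring
  refine mul_left_cancel₀ (pow_ne_zero 3 hθ0) ?_
  linear_combination t ^ 5 * key - (t' ^ 4 + j ^ 2 * t ^ 4) * (t * e - 6 * D) * hθ

end Transformation

/-! ### Growth at the cusps -/

section Growth

open Complex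
open scoped ModularForm
open UpperHalfPlane hiding I I_im

/-- `F` grows at most like a form of weight `r` at all the cusps. -/
def HasGrowth (r : ℝ) (F : ℍ → ℂ) : Prop :=
  ∀ α : SL(2, ℤ), ∃ C B : ℝ, 0 ≤ C ∧ ∀ τ : ℍ, B ≤ τ.im → ‖F (α • τ)‖ ≤ C * ‖denom α τ‖ ^ r

variable {r s : ℝ} {F G : ℍ → ℂ}

theorem HasGrowth.mul (hF : HasGrowth r F) (hG : HasGrowth s G) : HasGrowth (r + s) (F * G) := by
  intro α
  obtain ⟨C, B, hC, h⟩ := hF α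
  obtain ⟨C', B', hC', h'⟩ := hG α
  refine ⟨C * C', max B B', by positivity, fun τ hτ => ?_⟩
  have h0 : 0 < ‖denom α τ‖ := norm_pos_iff.mpr (denom_ne_zero α τ)
  rw [Pi.mul_apply, norm_mul, Real.rpow_add h0, mul_mul_mul_comm]
  exact mul_le_mul (h τ (le_trans (le_max_left _ _) hτ)) (h' τ (le_trans (le_max_right _ _) hτ))
    (norm_nonneg _) (by positivity)

theorem HasGrowth.sub (hF : HasGrowth r F) (hG : HasGrowth r G) : HasGrowth r (F - G) := by
  intro α
  obtain ⟨C, B, hC, h⟩ := hF α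
  obtain ⟨C', B', hC', h'⟩ := hG α
  refine ⟨C + C', max B B', by positivity, fun τ hτ => ?_⟩
  rw [Pi.sub_apply, add_mul]
  exact (norm_sub_le _ _).trans (add_le_add (h τ (le_trans (le_max_left _ _) hτ))
    (h' τ (le_trans (le_max_right _ _) hτ)))

theorem HasGrowth.const_smul (c : ℂ) (hF : HasGrowth r F) : HasGrowth r (c • F) := by
  intro α
  obtain ⟨C, B, hC, h⟩ := hF α
  refine ⟨‖c‖ * C, B, by positivity, fun τ hτ => ?_⟩
  rw [Pi.smul_apply, norm_smul, mul_assoc]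
  exact mul_le_mul_of_nonneg_left (h τ hτ) (norm_nonneg _)

theorem HasGrowth.isBoundedAtImInfty {κ : ℕ} (hF : HasGrowth (κ / 2) F) (α : SL(2, ℤ)) :
    IsBoundedAtImInfty fun τ : ℍ => (denom α τ) ^ (-((κ : ℂ) / 2)) * F (α • τ) := by
  obtain ⟨C, B, hC, h⟩ := hF α
  refine isBoundedAtImInfty_iff.mpr ⟨C, B, fun τ hτ => ?_⟩
  have h0 : 0 < ‖denom α τ‖ := norm_pos_iff.mpr (denom_ne_zero α τ)
  have e : (-((κ : ℂ) / 2)) = ((-((κ : ℝ) / 2) : ℝ) : ℂ) := by push_cast; ring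
  rw [norm_mul, e, norm_cpow_real, Real.rpow_neg h0.le, inv_mul_le_iff₀ (by positivity), mul_comm]
  exact h τ hτ

theorem denom_SL_mul (γ δ : SL(2, ℤ)) (τ : ℍ) :
    denom (γ * δ : SL(2, ℤ)) τ = denom γ (δ • τ : ℍ) * denom δ τ := by
  have h0 : denom δ τ ≠ 0 := denom_ne_zero δ τ
  rw [ModularGroup.denom_apply] at h0
  rw [ModularGroup.denom_apply, ModularGroup.denom_apply, ModularGroup.denom_apply,
    coe_specialLinearGroup_apply, Matrix.SpecialLinearGroup.coe_mul]
  simp only [Matrix.mul_apply, Fin.sum_univ_two]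
  simp at h0 ⊢
  field_simp
  ring

theorem abs_lower_left_mul_im_le (α : SL(2, ℤ)) (τ : ℍ) : |(α 1 0 : ℝ)| * τ.im ≤ ‖denom α τ‖ := by
  have h : (denom α τ).im = α 1 0 * τ.im := by
    rw [ModularGroup.denom_apply]; simp
  calc |(α 1 0 : ℝ)| * τ.im = |(denom α τ).im| := by rw [h, abs_mul, abs_of_pos τ.im_pos]
    _ ≤ _ := abs_im_le_norm _

/-- Factor `diag(4, 1) α` as `δ` times an upper triangular matrix with diagonal `g` and `4 / g`,
where `g = gcd(4a, c)`; `w` is the image of `τ` under the latter. -/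
theorem exists_dilate_four_smul (α : SL(2, ℤ)) : ∃ δ : SL(2, ℤ), ∃ g : ℝ, 1 ≤ g ∧ ∀ τ : ℍ,
    ∃ w : ℍ, dilate 4 (α • τ) = δ • w ∧ τ.im ≤ 4 * w.im ∧ denom δ w = g / 4 * denom α τ := by
  have hdet := α.det_coe
  rw [Matrix.det_fin_two] at hdet
  have hpos : 0 < Int.gcd (4 * α 0 0) (α 1 0) := by
    refine Int.gcd_pos_iff.mpr ?_
    by_contra! h
    have h0 : α 0 0 = 0 := by omega
    rw [h0, h.2] at hdet
    simp at hdet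
  obtain ⟨p, c, hcop, hp, hc⟩ := Int.exists_gcd_one hpos
  obtain ⟨u, v, huv⟩ := Int.isCoprime_iff_gcd_eq_one.mpr hcop
  set g : ℕ := Int.gcd (4 * α 0 0) (α 1 0) with hg
  obtain ⟨δ, h00, h01, h10, h11⟩ := exists_SL_two_eq (a := p) (b := -v) (c := c) (d := u)
    (by linear_combination huv)
  have hg1 : (1 : ℝ) ≤ g := by exact_mod_cast hpos
  refine ⟨δ, g, hg1, fun τ => ?_⟩
  set w₀ : ℂ := g * (g * τ + (4 * α 0 1 * u + v * α 1 1)) / 4 with hw₀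
  have him : w₀.im = g ^ 2 * τ.im / 4 := by
    have : w₀ = ((g ^ 2 / 4 : ℝ) : ℂ) * τ + ((g * (4 * α 0 1 * u + v * α 1 1) / 4 : ℝ) : ℂ) := by
      rw [hw₀]; push_cast; ring
    rw [this, add_im, im_ofReal_mul, ofReal_im, coe_im]
    ring
  have hτ := τ.im_pos
  have hpC : (4 * α 0 0 : ℂ) = p * g := by exact_mod_cast hp
  have hcC : (α 1 0 : ℂ) = c * g := by exact_mod_cast hc
  have hdC : (α 0 0 * α 1 1 - α 0 1 * α 1 0 : ℂ) = 1 := by exact_mod_cast hdet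
  have huC : (u * p + v * c : ℂ) = 1 := by exact_mod_cast huv
  have hden : (c * w₀ + u : ℂ) = g / 4 * (α 1 0 * τ + α 1 1) := by
    rw [hw₀]
    linear_combination (v * α 1 1 / 4 - (g * τ + (4 * α 0 1 * u + v * α 1 1)) / 4) * hcC
      - u * hdC + u * α 1 1 / 4 * hpC + α 1 1 * g / 4 * huC
  have hnum : (p * w₀ - v : ℂ) = g * (α 0 0 * τ + α 0 1) := by
    rw [hw₀]
    linear_combination (α 0 1 * u - (g * τ + (4 * α 0 1 * u + v * α 1 1)) / 4) * hpC
      + v * hdC + v * α 0 1 * hcC + α 0 1 * g * huC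
  have h0 : (α 1 0 * τ + α 1 1 : ℂ) ≠ 0 := by
    rw [← ModularGroup.denom_apply]; exact denom_ne_zero α τ
  refine ⟨⟨w₀, by rw [him]; positivity⟩, ?_, ?_, ?_⟩
  · ext1
    rw [coe_dilate, coe_specialLinearGroup_apply, coe_specialLinearGroup_apply]
    simp only [h00, h01, h10, h11]
    simp only [algebraMap_int_eq, eq_intCast, ofReal_intCast, Int.cast_neg, ofReal_neg]
    rw [← sub_eq_add_neg, hnum, hden]
    have hg0 : (g : ℂ) ≠ 0 := by exact_mod_cast hpos.ne'
    simp
    field_simp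
  · change τ.im ≤ 4 * w₀.im
    rw [him]
    nlinarith [one_le_pow₀ hg1 (n := 2)]
  · rw [ModularGroup.denom_apply, ModularGroup.denom_apply, h10, h11]
    exact hden

theorem HasGrowth.levelRaise_four (hF : HasGrowth r F) : HasGrowth r (levelRaise F 4) := by
  intro α
  obtain ⟨δ, g, hg, hδ⟩ := exists_dilate_four_smul α
  obtain ⟨C, B, hC, h⟩ := hF δ
  refine ⟨C * (g / 4) ^ r, 4 * B, by positivity, fun τ hτ => ?_⟩
  obtain ⟨w, hw, him, hden⟩ := hδ τ
  have h1 := h w (by linarith)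
  have e : ‖(g / 4 * denom α τ : ℂ)‖ = g / 4 * ‖denom α τ‖ := by
    have e' : (g / 4 : ℂ) = ((g / 4 : ℝ) : ℂ) := by push_cast; rfl
    rw [norm_mul, e', norm_real, Real.norm_of_nonneg (by positivity)]
  rw [levelRaise, hw]
  rwa [hden, e, Real.mul_rpow (by positivity) (norm_nonneg _), ← mul_assoc] at h1

/-- The anomaly is harmless: its factor `α 1 0` is bounded by the denominator once `Im τ ≥ 1`. -/
theorem hasGrowth_E2 : HasGrowth 2 EisensteinSeries.E2 := by
  obtain ⟨M, A, h⟩ := isBoundedAtImInfty_iff.mp EisensteinSeries.isBoundedAtImInfty_E2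
  intro α
  refine ⟨|M| + ‖(6 * I / Real.pi : ℂ)‖, max A 1, by positivity, fun τ hτ => ?_⟩
  have h1 : |(α 1 0 : ℝ)| ≤ ‖denom α τ‖ := by
    refine le_trans ?_ (abs_lower_left_mul_im_le α τ)
    exact le_mul_of_one_le_right (abs_nonneg _) ((le_max_right _ _).trans hτ)
  have h2 := (h τ ((le_max_left _ _).trans hτ)).trans (le_abs_self M)
  rw [E2_smul]
  refine (norm_sub_le _ _).trans ?_
  have h3 : ‖((α 1 0 : ℤ) : ℂ)‖ = |(α 1 0 : ℝ)| := by rw [norm_intCast]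
  rw [norm_mul, norm_mul, norm_mul, norm_pow, h3, Real.rpow_two, add_mul, sq, mul_comm |M|]
  gcongr ?_ + ?_
  · gcongr
  · rw [mul_assoc]
    gcongr

theorem hasGrowth_E₄ : HasGrowth 4 ModularForm.E₄ := by
  obtain ⟨M, A, h⟩ := isBoundedAtImInfty_iff.mp (ModularFormClass.bdd_at_infty ModularForm.E₄)
  intro α
  refine ⟨|M|, A, by positivity, fun τ hτ => ?_⟩
  rw [E₄_smul, norm_mul, norm_pow, mul_comm, show (4 : ℝ) = (4 : ℕ) by norm_num, Real.rpow_natCast]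
  gcongr
  exact (h τ hτ).trans (le_abs_self M)

/-- Cauchy's estimate on the unit disc about `τ` for `F ∘ α`. On that disc the denominator changes
by at most `|c|`, hence at most doubles in size; the chain rule supplies the two extra powers. -/
theorem HasGrowth.normalizedDeriv (hr : 0 ≤ r) (hF : HasGrowth r F) (hd : MDiff F) :
    HasGrowth (r + 2) (Derivative.normalizedDerivOfComplex F) := by
  intro α
  obtain ⟨C, B, hC, h⟩ := hF α
  set G : ℍ → ℂ := F ∣[(0 : ℤ)] α with hG
  have hGapp (τ : ℍ) : G τ = F (α • τ) := by
    rw [hG, ModularForm.SL_slash_apply]; simp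
  have hGd : MDiff G := hd.slash _ _
  refine ⟨‖(2 * Real.pi * I : ℂ)⁻¹‖ * (C * 2 ^ r), max B 1 + 1, by positivity, fun τ hτ => ?_⟩
  have hB : B ≤ τ.im - 1 := by linarith [le_max_left B 1]
  have h1 : 1 ≤ τ.im - 1 := by linarith [le_max_right B 1]
  have h0 : 0 < ‖denom α τ‖ := norm_pos_iff.mpr (denom_ne_zero α τ)
  have hD := congrFun (Derivative.normalizedDerivOfComplex_SL_slash (k := 0) hd (γ := α)) τ
  have hD' : Derivative.normalizedDerivOfComplex F (α • τ) =
      denom α τ ^ 2 * Derivative.normalizedDerivOfComplex G τ := by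
    rw [hG, hD, Pi.sub_apply, ModularForm.SL_slash_apply]
    have : denom α τ ≠ 0 := denom_ne_zero α τ
    rw [show (-(0 + 2) : ℤ) = -(2 : ℕ) by norm_num, zpow_neg, zpow_natCast]
    simp
    field_simp
  have him {z : ℂ} (hz : z ∈ Metric.closedBall (τ : ℂ) 1) : τ.im - 1 ≤ z.im := by
    have h2 : |(z - τ).im| ≤ 1 := (abs_im_le_norm _).trans (by simpa [Complex.dist_eq] using hz)
    rw [sub_im, coe_im, abs_le] at h2
    linarith
  have hc : ‖deriv (G ∘ ofComplex) τ‖ ≤ C * (2 * ‖denom α τ‖) ^ r / 1 := by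
    refine norm_deriv_le_of_forall_mem_sphere_norm_le one_pos ?_ fun z hz => ?_
    · refine DifferentiableOn.diffContOnCl fun z hz => DifferentiableAt.differentiableWithinAt ?_
      rw [closure_ball _ one_ne_zero] at hz
      exact UpperHalfPlane.mdifferentiable_iff.mp hGd |>.differentiableAt
        (isOpen_upperHalfPlaneSet.mem_nhds (by have := him hz; simp; linarith))
    · have hz' := him (Metric.sphere_subset_closedBall hz)
      have hzpos : 0 < z.im := by linarith
      rw [Function.comp_apply, hGapp, ofComplex_apply_of_im_pos hzpos]
      refine (h ⟨z, hzpos⟩ (hB.trans hz')).trans ?_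
      gcongr
      have hsub : denom α (⟨z, hzpos⟩ : ℍ) = denom α τ + α 1 0 * (z - τ) := by
        rw [ModularGroup.denom_apply, ModularGroup.denom_apply]
        ring
      rw [hsub, two_mul]
      refine (norm_add_le _ _).trans ?_
      gcongr
      have hz1 : ‖z - τ‖ = 1 := by simpa [Complex.dist_eq] using hz
      rw [norm_mul, hz1, mul_one, norm_intCast]
      refine le_trans ?_ (abs_lower_left_mul_im_le α τ)
      exact le_mul_of_one_le_right (abs_nonneg _) (by linarith)
  rw [hD', norm_mul, norm_pow, Derivative.normalizedDerivOfComplex, norm_mul, Real.rpow_add h0,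
    Real.rpow_two]
  rw [div_one, Real.mul_rpow zero_le_two h0.le] at hc
  calc _ ≤ ‖denom α τ‖ ^ 2 * (‖(2 * Real.pi * I : ℂ)⁻¹‖ * (C * (2 ^ r * ‖denom α τ‖ ^ r))) := by
        gcongr
    _ = _ := by ring

end Growth

/-! ### Growth of `θ` at the cusps -/

section ThetaGrowth

open Complex
open UpperHalfPlane hiding I I_im

theorem norm_sq_jacobiTheta_neg_one_div {z : ℂ} (hz : 0 < z.im) :
    ‖jacobiTheta (-1 / z)‖ ^ 2 = ‖z‖ * ‖jacobiTheta z‖ ^ 2 := by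
  rw [jacobiTheta_neg_one_div hz, norm_mul, mul_pow, ← norm_pow, cpow_half_sq]
  simp

/-- Averaging over translation by 1 keeps the terms of even index. -/
theorem two_mul_jacobiTheta_four_mul {z : ℂ} (hz : 0 < z.im) :
    2 * jacobiTheta (4 * z) = jacobiTheta z + jacobiTheta (z + 1) := by
  have h4 : 0 < (4 * z).im := by simpa using hz
  have h1 : 0 < (z + 1).im := by simpa using hz
  simp only [jacobiTheta_eq_jacobiTheta₂]
  refine HasSum.unique ((hasSum_jacobiTheta₂_term 0 h4).mul_left 2) ?_
  have hinj : Function.Injective fun n : ℤ => 2 * n := fun a b h => by simpa using h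
  convert! (hinj.hasSum_iff fun n hn => ?_).mpr
    ((hasSum_jacobiTheta₂_term 0 hz).add (hasSum_jacobiTheta₂_term 0 h1)) using 1
  · ext n
    have e : Real.pi * I * (2 * n : ℂ) ^ 2 * (z + 1) =
        Real.pi * I * (n : ℂ) ^ 2 * (4 * z) + (2 * n ^ 2 : ℤ) * (2 * Real.pi * I) := by
      push_cast; ring
    have e' : Real.pi * I * (2 * n : ℂ) ^ 2 * z = Real.pi * I * (n : ℂ) ^ 2 * (4 * z) := by ring
    simp only [jacobiTheta₂_term, Function.comp_apply, mul_zero, zero_add, Int.cast_mul,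
      Int.cast_ofNat]
    rw [e, e', exp_add, exp_int_mul_two_pi_mul_I]
    ring
  · have hodd : Odd n := Int.not_even_iff_odd.mp fun ⟨m, hm⟩ => hn ⟨m, by simp; omega⟩
    obtain ⟨m, rfl⟩ := hodd
    have e : Real.pi * I * ((2 * m + 1 : ℤ) : ℂ) ^ 2 * (z + 1) =
        Real.pi * I * ((2 * m + 1 : ℤ) : ℂ) ^ 2 * z +
          ((2 * m ^ 2 + 2 * m : ℤ) * (2 * Real.pi * I) + Real.pi * I) := by
      push_cast; ring
    simp only [jacobiTheta₂_term, mul_zero, zero_add]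
    rw [e, exp_add, exp_add, exp_int_mul_two_pi_mul_I, exp_pi_mul_I]
    ring

/-- The plus-space recursion for `θ` expresses the translate by 1 through those by 0 and 2; the
latter is eliminated by the averaging identity. Hence `θ(τ)` and `θ(τ/4)` span a space stable under
`T`. -/
theorem jacobiTheta_add_one_div_two {z : ℂ} (hz : 0 < z.im) :
    jacobiTheta ((z + 1) / 2) = (1 - I) * jacobiTheta (2 * z) + I * jacobiTheta (z / 2) := by
  have h := hasPlusExpansion_theta.quarter_add_two hz
  rw [quarter_theta hz, quarter_theta (by simpa using hz), quarter_theta (by simpa using hz)] at h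
  have h2 := two_mul_jacobiTheta_four_mul (z := z / 2) (by simpa using hz)
  rw [show 4 * (z / 2) = 2 * z by ring, show z / 2 + 1 = (z + 2) / 2 by ring, h] at h2
  linear_combination -((1 - I) / 2) * h2 +
    (jacobiTheta ((z + 1) / 2) - jacobiTheta (z / 2)) / 2 * I_sq

/-- The bound of weight `1 / 2` for the pair of functions `θ(τ)` and `θ(τ / 4)` near the cusp `α`. -/
def ThetaPairBound (α : SL(2, ℤ)) : Prop :=
  ∃ C : ℝ, 0 ≤ C ∧ ∀ τ : ℍ, 2 ≤ τ.im →
    ‖jacobiTheta (2 * (α • τ : ℍ))‖ ^ 2 ≤ C * ‖denom α τ‖ ∧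
    ‖jacobiTheta ((α • τ : ℍ) / 2)‖ ^ 2 ≤ C * ‖denom α τ‖

/-- Inversion interchanges the two functions of the pair, up to the factor of weight `1/2`. -/
theorem ThetaPairBound.S_mul {α : SL(2, ℤ)} (h : ThetaPairBound α) :
    ThetaPairBound (ModularGroup.S * α) := by
  obtain ⟨C, hC, h⟩ := h
  refine ⟨2 * C, by positivity, fun τ hτ => ?_⟩
  obtain ⟨h1, h2⟩ := h τ hτ
  have hpos := (α • τ : ℍ).im_pos
  have e : ((ModularGroup.S * α) • τ : ℍ) = ModularGroup.S • (α • τ : ℍ) := mul_smul _ _ _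
  have hS : ((ModularGroup.S • (α • τ : ℍ) : ℍ) : ℂ) = -1 / (α • τ : ℍ) := by
    rw [modular_S_smul, coe_mk, inv_neg, neg_div, one_div]
  have hd : ‖denom (ModularGroup.S * α : SL(2, ℤ)) τ‖ = ‖((α • τ : ℍ) : ℂ)‖ * ‖denom α τ‖ := by
    rw [denom_SL_mul, norm_mul, ModularGroup.denom_S]
  have hz : ((α • τ : ℍ) : ℂ) ≠ 0 := ne_zero _
  have him : 0 < ((α • τ : ℍ) : ℂ).im := hpos
  rw [hd, e, hS]
  generalize ((α • τ : ℍ) : ℂ) = z at *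
  have e1 : 2 * (-1 / z) = -1 / (z / 2) := by field_simp
  have e2 : -1 / z / 2 = -1 / (2 * z) := by field_simp
  rw [e1, e2, norm_sq_jacobiTheta_neg_one_div (by simpa using him),
    norm_sq_jacobiTheta_neg_one_div (by simpa using him)]
  have n1 : ‖z / 2‖ = ‖z‖ / 2 := by simp
  have n2 : ‖2 * z‖ = 2 * ‖z‖ := by simp
  rw [n1, n2]
  have h1' := mul_le_mul_of_nonneg_left h1 (norm_nonneg z)
  have h2' := mul_le_mul_of_nonneg_left h2 (norm_nonneg z)
  have h0 : 0 ≤ ‖z‖ * (C * ‖denom α τ‖) := by positivity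
  constructor <;> nlinarith

theorem norm_sq_combination_le {x y : ℂ} {c : ℝ} (u v : ℂ) (hu : ‖u‖ ^ 2 ≤ 2) (hv : ‖v‖ ^ 2 ≤ 2)
    (hx : ‖x‖ ^ 2 ≤ c) (hy : ‖y‖ ^ 2 ≤ c) : ‖u * x + v * y‖ ^ 2 ≤ 8 * c := by
  have h := norm_add_le (u * x) (v * y)
  rw [norm_mul, norm_mul] at h
  have h1 : ‖u‖ ^ 2 * ‖x‖ ^ 2 ≤ 2 * c := mul_le_mul hu hx (by positivity) (by norm_num)
  have h2 : ‖v‖ ^ 2 * ‖y‖ ^ 2 ≤ 2 * c := mul_le_mul hv hy (by positivity) (by norm_num)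
  have h3 : ‖u * x + v * y‖ ^ 2 ≤ (‖u‖ * ‖x‖ + ‖v‖ * ‖y‖) ^ 2 := by gcongr
  nlinarith [sq_nonneg (‖u‖ * ‖x‖ - ‖v‖ * ‖y‖)]

theorem normSq_one_sub_I : ‖(1 - I : ℂ)‖ ^ 2 = 2 := by
  rw [← normSq_eq_norm_sq, normSq_apply]; simp; norm_num

theorem normSq_one_add_I : ‖(1 + I : ℂ)‖ ^ 2 = 2 := by
  rw [← normSq_eq_norm_sq, normSq_apply]; simp; norm_num

theorem ThetaPairBound.T_mul {α : SL(2, ℤ)} (h : ThetaPairBound α) :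
    ThetaPairBound (ModularGroup.T * α) := by
  obtain ⟨C, hC, h⟩ := h
  refine ⟨8 * C, by positivity, fun τ hτ => ?_⟩
  obtain ⟨h1, h2⟩ := h τ hτ
  have hT : (((ModularGroup.T * α) • τ : ℍ) : ℂ) = (α • τ : ℍ) + 1 := by
    rw [mul_smul, modular_T_smul, coe_vadd]; push_cast; ring
  have hd : denom (ModularGroup.T * α : SL(2, ℤ)) τ = denom α τ := by
    rw [denom_SL_mul, ModularGroup.denom_apply ModularGroup.T]; simp [ModularGroup.T]
  have him : 0 < ((α • τ : ℍ) : ℂ).im := (α • τ : ℍ).im_pos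
  rw [hd, hT]
  generalize ((α • τ : ℍ) : ℂ) = z at *
  have e : 2 * (z + 1) = 2 * z + 2 * (1 : ℤ) := by push_cast; ring
  rw [e, jacobiTheta_add_two_mul, jacobiTheta_add_one_div_two him, mul_assoc]
  refine ⟨by linarith [mul_nonneg hC (norm_nonneg (denom α τ))],
    norm_sq_combination_le _ _ normSq_one_sub_I.le (by simp) h1 h2⟩

theorem ThetaPairBound.T_inv_mul {α : SL(2, ℤ)} (h : ThetaPairBound α) :
    ThetaPairBound (ModularGroup.T⁻¹ * α) := by
  obtain ⟨C, hC, h⟩ := h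
  refine ⟨8 * C, by positivity, fun τ hτ => ?_⟩
  obtain ⟨h1, h2⟩ := h τ hτ
  have hα : α = ModularGroup.T * (ModularGroup.T⁻¹ * α) := by group
  set β := ModularGroup.T⁻¹ * α with hβ
  have hT : ((α • τ : ℍ) : ℂ) = (β • τ : ℍ) + 1 := by
    rw [hα, mul_smul, modular_T_smul, coe_vadd]; push_cast; ring
  have hd : denom α τ = denom β τ := by
    rw [hα, denom_SL_mul, ModularGroup.denom_apply ModularGroup.T]; simp [ModularGroup.T]
  have him : 0 < ((β • τ : ℍ) : ℂ).im := (β • τ : ℍ).im_pos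
  rw [hd, hT] at h1 h2
  generalize ((β • τ : ℍ) : ℂ) = z at *
  have e : 2 * (z + 1) = 2 * z + 2 * (1 : ℤ) := by push_cast; ring
  rw [e, jacobiTheta_add_two_mul] at h1
  have e2 : jacobiTheta (z / 2) = (1 + I) * jacobiTheta (2 * z) + -I * jacobiTheta ((z + 1) / 2) := by
    rw [jacobiTheta_add_one_div_two him]
    linear_combination (jacobiTheta (z / 2) - jacobiTheta (2 * z)) * I_sq
  rw [e2, mul_assoc]
  refine ⟨by linarith [mul_nonneg hC (norm_nonneg (denom β τ))],
    norm_sq_combination_le _ _ normSq_one_add_I.le (by simp) h1 h2⟩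

/-- Induction on a word in `S` and `T`: each letter preserves the pair up to bounded combinations,
so only the constant changes. -/
theorem thetaPairBound (α : SL(2, ℤ)) : ThetaPairBound α := by
  have hα : α ∈ Subgroup.closure {ModularGroup.S, ModularGroup.T} := by
    rw [SpecialLinearGroup.SL2Z_generators]; trivial
  induction hα using Subgroup.closure_induction_left with
  | one =>
    refine ⟨4, by norm_num, fun τ hτ => ?_⟩
    have h1 : 1 ≤ (2 * (τ : ℂ)).im := by simp; linarith
    have h2 : 1 ≤ ((τ : ℂ) / 2).im := by simp; linarith
    have hd : denom (1 : SL(2, ℤ)) τ = 1 := by rw [ModularGroup.denom_apply]; simp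
    have h1' := norm_jacobiTheta_le h1
    have h2' := norm_jacobiTheta_le h2
    rw [one_smul, hd]
    constructor <;> simp <;> nlinarith [norm_nonneg (jacobiTheta (2 * (τ : ℂ))),
      norm_nonneg (jacobiTheta ((τ : ℂ) / 2))]
  | mul_left x hx y _ hy =>
    rcases hx with rfl | rfl
    · exact hy.S_mul
    · exact hy.T_mul
  | inv_mul_cancel x hx y _ hy =>
    rcases hx with rfl | rfl
    · have : (ModularGroup.S⁻¹ : SL(2, ℤ)) = ModularGroup.S * ModularGroup.S * ModularGroup.S := by
        decide
      rw [this, mul_assoc, mul_assoc]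
      exact hy.S_mul.S_mul.S_mul
    · exact hy.T_inv_mul

theorem hasGrowth_theta : HasGrowth (1 / 2) theta := by
  intro α
  obtain ⟨C, hC, h⟩ := thetaPairBound α
  refine ⟨C ^ (1 / 2 : ℝ), 2, by positivity, fun τ hτ => ?_⟩
  have h1 := (h τ hτ).1
  rw [← Real.mul_rpow hC (norm_nonneg _), ← Real.sqrt_eq_rpow, theta_eq_jacobiTheta]
  exact Real.le_sqrt_of_sq_le h1

end ThetaGrowth

/-! ### The two forms lie in the plus space -/

section Forms

open Complex
open UpperHalfPlane hiding I I_im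

variable {f F G : ℍ → ℂ} {a b : ℕ → ℂ}

theorem mdifferentiable_levelRaise (hF : MDiff F) (d : ℕ+) : MDiff (levelRaise F d) := by
  have hd : (0 : ℝ) < d := by exact_mod_cast d.pos
  have h : MDiff fun τ : ℍ => (fun z : ℂ => (F ∘ ofComplex) (d * z)) τ :=
    mdifferentiable_of_differentiableAt fun z hz => by
      have h0 : 0 < ((d : ℂ) * z).im := by
        have : ((d : ℂ) * z).im = d * z.im := by simp
        rw [this]; positivity
      have := (UpperHalfPlane.mdifferentiable_iff.mp hF _ h0).differentiableAt
        (isOpen_upperHalfPlaneSet.mem_nhds h0)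
      exact DifferentiableAt.comp z (f := fun z => (d : ℂ) * z) this (by fun_prop)
  convert! h using 1
  ext τ
  simp only [Function.comp_apply, levelRaise]
  rw [← coe_dilate, ofComplex_apply]

/-- The constant coefficient is the limit of the function along the imaginary axis. -/
theorem HasPlusExpansion.ne_zero (hf : HasPlusExpansion f a) (h0 : a 0 ≠ 0) : f ≠ 0 := by
  rintro rfl
  obtain ⟨C, hC⟩ := hf.exists_bound
  refine h0 (norm_le_zero_iff.mp ?_)
  have ht : Filter.Tendsto (fun y : ℝ => C * Real.exp (-Real.pi * y / 2)) Filter.atTop (nhds 0) := by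
    rw [← mul_zero C]
    refine (Real.tendsto_exp_atBot.comp ?_).const_mul C
    have : (fun y : ℝ => -Real.pi * y / 2) = fun y => (-(Real.pi / 2)) * y := by ext y; ring
    rw [this]
    exact Filter.tendsto_id.const_mul_atTop_of_neg (by linarith [Real.pi_pos])
  refine ge_of_tendsto ht ?_
  filter_upwards [Filter.eventually_ge_atTop 1] with y hy
  have := (hC (y * I) (by simpa using hy)).2.1
  simpa [quarter] using this

theorem HasPlusExpansion.sub (hf : HasPlusExpansion F a) (hg : HasPlusExpansion G b) :
    HasPlusExpansion (F - G) (a - b) := by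
  refine ⟨fun τ => ?_, fun n h0 h1 => by simp [hf.2 n h0 h1, hg.2 n h0 h1]⟩
  simpa only [Pi.sub_apply, sub_mul] using (hf.1 τ).sub (hg.1 τ)

theorem HasPlusExpansion.const_smul (c : ℂ) (hf : HasPlusExpansion F a) :
    HasPlusExpansion (c • F) (c • a) := by
  refine ⟨fun τ => ?_, fun n h0 h1 => by simp [hf.2 n h0 h1]⟩
  simpa only [Pi.smul_apply, smul_eq_mul, mul_assoc] using (hf.1 τ).mul_left c

theorem q_dilate_four (τ : ℍ) : q (dilate 4 τ) = q τ ^ 4 := by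
  rw [q, q, ← exp_nat_mul, coe_dilate]
  congr 1
  push_cast
  ring

theorem hasSum_levelRaise_four (hG : ∀ τ, HasSum (fun n => b n * q τ ^ n) (G τ)) (τ : ℍ) :
    HasSum (fun n => (if 4 ∣ n then b (n / 4) else 0) * q τ ^ n) (levelRaise G 4 τ) := by
  have hinj : Function.Injective fun n : ℕ => 4 * n := fun a b h => by simpa using h
  refine (hinj.hasSum_iff fun n hn => ?_).mp ?_
  · rw [if_neg fun ⟨m, hm⟩ => hn ⟨m, hm.symm⟩, zero_mul]
  · convert! hG (dilate 4 τ) using 1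
    ext n
    simp [q_dilate_four, pow_mul]

/-- `G[4]` is a series in `q ^ 4`, so the product keeps the exponents in the same classes modulo 4.
-/
theorem HasPlusExpansion.mul_levelRaise_four (hF : HasPlusExpansion F a)
    (hG : ∀ τ, HasSum (fun n => b n * q τ ^ n) (G τ)) :
    HasPlusExpansion (F * levelRaise G 4) fun n => ∑ p ∈ Finset.HasAntidiagonal.antidiagonal n,
      a p.1 * if 4 ∣ p.2 then b (p.2 / 4) else 0 := by
  refine ⟨fun τ => ?_, fun n h0 h1 => Finset.sum_eq_zero fun p hp => ?_⟩
  · have h1 := hF.1 τ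
    have h2 := hasSum_levelRaise_four hG τ
    have h3 := summable_norm_sum_mul_antidiagonal_of_summable_norm h1.summable.norm h2.summable.norm
    have h4 := tsum_mul_tsum_eq_tsum_sum_antidiagonal_of_summable_norm h1.summable.norm
      h2.summable.norm
    rw [h1.tsum_eq, h2.tsum_eq] at h4
    rw [Pi.mul_apply, h4]
    convert! h3.of_norm.hasSum using 1
    ext n
    rw [Finset.sum_mul]
    refine Finset.sum_congr rfl fun p hp => ?_
    rw [← Finset.HasAntidiagonal.mem_antidiagonal.mp hp, pow_add]
    ring
  · rw [Finset.HasAntidiagonal.mem_antidiagonal] at hp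
    split_ifs with h
    · rw [hF.2 p.1 (by omega) (by omega), zero_mul]
    · rw [mul_zero]

/-- Termwise differentiation on the half-plane above height `τ.im / 2`, where the series is
dominated by its absolute values at that height. -/
theorem HasPlusExpansion.normalizedDeriv (hf : HasPlusExpansion f a) :
    HasPlusExpansion (Derivative.normalizedDerivOfComplex f) fun n => n * a n := by
  refine ⟨fun τ => ?_, fun n h0 h1 => by simp [hf.2 n h0 h1]⟩
  have hτ := τ.im_pos
  set w : ℍ := ⟨((τ.im / 2 : ℝ) : ℂ) * I, by simpa using hτ⟩ with hw
  set U : Set ℂ := {z | τ.im / 2 < z.im} with hU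
  have hUo : IsOpen U := isOpen_lt continuous_const continuous_im
  have hmem : (τ : ℂ) ∈ U := by simp only [hU, Set.mem_ofPred_eq, coe_im]; linarith
  set E : ℕ → ℂ → ℂ := fun n z => a n * exp (2 * Real.pi * I * z) ^ n with hE
  have hsum : Summable fun n => ‖a n * q w ^ n‖ := (hf.1 w).summable.norm
  have hderiv (n : ℕ) (z : ℂ) : HasDerivAt (E n) (2 * Real.pi * I * n * E n z) z := by
    have h1 : HasDerivAt (fun z : ℂ => exp (2 * Real.pi * I * z))
        (exp (2 * Real.pi * I * z) * (2 * Real.pi * I)) z := by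
      simpa using ((hasDerivAt_id z).const_mul (2 * Real.pi * I : ℂ)).cexp
    refine ((h1.pow n).const_mul (a n)).congr_deriv ?_
    rcases n with _ | n
    · simp
    · simp only [hE, Nat.add_sub_cancel]
      ring
  have h := hasSum_deriv_of_summable_norm (F := E) hsum
    (fun n z _ => (hderiv n z).differentiableAt.differentiableWithinAt) hUo (fun n z hz => ?_) hmem
  · have heq : (fun z => ∑' n, E n z) =ᶠ[nhds (τ : ℂ)] f ∘ ofComplex := by
      filter_upwards [hUo.mem_nhds hmem] with z hz
      have hz0 : 0 < z.im := lt_trans (by positivity) hz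
      rw [Function.comp_apply, ← (hf.1 (ofComplex z)).tsum_eq, q, ofComplex_apply_of_im_pos hz0]
    rw [heq.deriv_eq] at h
    have h2 := h.mul_left (2 * Real.pi * I)⁻¹
    rw [Derivative.normalizedDerivOfComplex]
    convert! h2 using 1
    ext n
    rw [(hderiv n _).deriv]
    have : (2 * Real.pi * I : ℂ) ≠ 0 := two_pi_I_ne_zero
    simp only [hE, q]
    field_simp
  · have hn : ∀ z : ℂ, ‖exp (2 * Real.pi * I * z)‖ = Real.exp (-(2 * Real.pi * z.im)) := fun z => by
      rw [norm_exp]; congr 1; simp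
    simp only [hE, norm_mul, norm_pow]
    rw [q, hn, hn]
    have : (w : ℂ).im = τ.im / 2 := by simp [hw]
    have hz' : τ.im / 2 < z.im := hz
    gcongr
    rw [this]; exact hz'.le

theorem hasSum_E2 (τ : ℍ) : HasSum (fun n : ℕ =>
    (if n = 0 then 1 else -24 * ArithmeticFunction.sigma 1 n : ℂ) * q τ ^ n)
    (EisensteinSeries.E2 τ) :=
  EisensteinSeries.hasSum_qExpansion_E2 τ

theorem hasSum_E₄ (τ : ℍ) : HasSum (fun n : ℕ =>
    (qExpansion 1 ModularForm.E₄).coeff n * q τ ^ n) (ModularForm.E₄ τ) := by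
  have := ModularForm.hasSum_qExpansion ModularForm.E₄ one_pos (by simp) τ
  simpa [q, Function.Periodic.qParam] using this

/-- The coefficients of `θ E₂[4] - 6 D(θ)`. -/
theorem exists_hasPlusExpansion_theta_mul_E2_sub : ∃ a : ℕ → ℂ, a 0 = 1 ∧
    HasPlusExpansion (theta * levelRaise EisensteinSeries.E2 4
      - (6 : ℂ) • Derivative.normalizedDerivOfComplex theta) a :=
  ⟨_, by simp [squareCount_zero], (hasPlusExpansion_theta.mul_levelRaise_four hasSum_E2).sub
    (hasPlusExpansion_theta.normalizedDeriv.const_smul 6)⟩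

theorem exists_hasPlusExpansion_theta_mul_E₄ : ∃ a : ℕ → ℂ, a 0 = 1 ∧
    HasPlusExpansion (theta * levelRaise ModularForm.E₄ 4) a :=
  ⟨_, by simp [squareCount_zero, EisensteinSeries.E_qExpansion_coeff_zero _ ⟨2, rfl⟩],
    hasPlusExpansion_theta.mul_levelRaise_four hasSum_E₄⟩

theorem theta_mul_E2_sub_mem_plusSpace : theta * levelRaise EisensteinSeries.E2 4
    - (6 : ℂ) • Derivative.normalizedDerivOfComplex theta ∈ plusSpace 2 := by
  obtain ⟨a, -, ha⟩ := exists_hasPlusExpansion_theta_mul_E2_sub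
  refine (mem_plusSpace_iff (m := 1)).mpr ⟨⟨?_, fun γ hγ τ => theta_mul_E2_sub_transform hγ τ,
    fun α => HasGrowth.isBoundedAtImInfty ?_ α⟩, a, ha⟩
  · exact (mdifferentiable_theta.mul (mdifferentiable_levelRaise E2_mdifferentiable
      4)).sub ((Derivative.normalizedDerivOfComplex_mdifferentiable mdifferentiable_theta).const_smul 6)
  -- Both terms have growth exponent `1/2 + 2 = 5/2`.
  · have h1 := hasGrowth_theta.mul hasGrowth_E2.levelRaise_four
    have h2 := (hasGrowth_theta.normalizedDeriv (by norm_num) mdifferentiable_theta).const_smul 6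
    convert h1.sub h2 using 1
    norm_num

theorem theta_mul_E₄_mem_plusSpace : theta * levelRaise ModularForm.E₄ 4 ∈ plusSpace 4 := by
  obtain ⟨a, -, ha⟩ := exists_hasPlusExpansion_theta_mul_E₄
  refine (mem_plusSpace_iff (m := 2)).mpr ⟨⟨?_, fun γ hγ τ => theta_mul_E₄_transform hγ τ,
    fun α => HasGrowth.isBoundedAtImInfty ?_ α⟩, a, ha⟩
  · exact mdifferentiable_theta.mul (mdifferentiable_levelRaise (ModularFormClass.holo _) 4)
  · convert hasGrowth_theta.mul hasGrowth_E₄.levelRaise_four using 1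
    norm_num

theorem exists_basis_plusSpace_two : ∃ b : Module.Basis Unit ℂ (plusSpace 2), (b () : ℍ → ℂ) =
    theta * levelRaise EisensteinSeries.E2 4
      - (6 : ℂ) • Derivative.normalizedDerivOfComplex theta := by
  obtain ⟨a, h0, ha⟩ := exists_hasPlusExpansion_theta_mul_E2_sub
  have hne := ha.ne_zero (by simp [h0])
  exact exists_basis_of_forall_smul theta_mul_E2_sub_mem_plusSpace hne fun f hf =>
    exists_eq_smul_of_mem_plusSpace_two theta_mul_E2_sub_mem_plusSpace hne hf

theorem exists_basis_plusSpace_four : ∃ b : Module.Basis Unit ℂ (plusSpace 4), (b () : ℍ → ℂ) =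
    theta * levelRaise ModularForm.E₄ 4 := by
  obtain ⟨a, h0, ha⟩ := exists_hasPlusExpansion_theta_mul_E₄
  exact exists_basis_of_forall_smul theta_mul_E₄_mem_plusSpace (ha.ne_zero (by simp [h0]))
    fun f hf => exists_eq_smul_of_mem_plusSpace_four hf

end Forms
end HalfIntegralWeight

theorem mainTheorem7 :
    (∃ b : Module.Basis Unit ℂ (HalfIntegralWeight.plusSpace 2),
      (b () : UpperHalfPlane → ℂ) =
        HalfIntegralWeight.theta * HalfIntegralWeight.levelRaise EisensteinSeries.E2 4
          - (6 : ℂ) • Derivative.normalizedDerivOfComplex HalfIntegralWeight.theta) ∧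
    (∃ b : Module.Basis Unit ℂ (HalfIntegralWeight.plusSpace 4),
      (b () : UpperHalfPlane → ℂ) =
        HalfIntegralWeight.theta * HalfIntegralWeight.levelRaise ModularForm.E₄ 4) ∧
    ∀ (D : ℤ) (hD : HalfIntegralWeight.IsFundamentalDiscriminant D), 1 < D →
      HalfIntegralWeight.quadraticL D hD (-1) = -(1 / 5) * (HalfIntegralWeight.sigmaSum 1 D 4 : ℂ) ∧
      HalfIntegralWeight.quadraticL D hD (-3) = (HalfIntegralWeight.sigmaSum 3 D 4 : ℂ) := by
  exact ⟨HalfIntegralWeight.exists_basis_plusSpace_two,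
    HalfIntegralWeight.exists_basis_plusSpace_four, fun D hD hD1 =>
    ⟨HalfIntegralWeight.quadraticL_neg_one hD hD1, HalfIntegralWeight.quadraticL_neg_three hD hD1⟩⟩
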